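/- Let $X$ be a closed Riemann surface, let $k\ge 2$ be an integer, and let $E=\bigotimes^{k-1}T^{1,0}_X$ be the $(k-1)$-fold tensor power of the holomorphic tangent bundle of $X$. Let $g$ be a smooth Riemannian metric on $X$ compatible with the complex structure, $g=e^{2\varphi}|dz|^2$ in a local holomorphic coordinate $z$, with area measure $dA_g$ and Gaussian curvature $K(g)$. Extend $g$ complex bilinearly; the Hermitian metric $h(v,w)=g(v,\overline w)$ on $T^{1,0}_X$, for which $h(\partial_z,\partial_z)=\tfrac12e^{2\varphi}$ and hence $\|d\bar z\|_g^2=2e^{-2\varphi}$, induces the pointwise norms $\|\cdot\|_g$ on $E$ and on $E$-valued $(0,1)$-forms. A section $\psi$ of $E$ belongs to $W^{1,2}(X,E)$ if it has a distributional derivative $\overline\partial\psi$ and $\int_X(\|\psi\|_g^2+\|\overline\partial\psi\|_g^2)\,dA_g<\infty$; on the compact surface $X$ this does not depend on $g$. Then the following hold, all the integrals being finite. 1. For every such metric $g$ and every $\psi\in W^{1,2}(X,E)$, $$\int_X\|\overline\partial\psi\|_g^2\,dA_g\ \ge\ -(k-1)\int_X K(g)\,\|\psi\|_g^2\,dA_g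 .$$ 2. In particular, if $g$ is a hyperbolic metric (that is, $K(g)=-1$), then for every $\psi\in W^{1,2}(X,E)$, with norms and area measure taken with respect to $g$, $$\int_X\|\overline\partial\psi\|^2\,dA\ \ge\ (k-1)\int_X\|\psi\|^2\,dA .$$ 3. If $g$ is a hyperbolic metric, $\Delta$ is its Laplace operator (so that $\Delta=4e^{-2\varphi}\partial_z\partial_{\bar z}$ where $g=e^{2\varphi}|dz|^2$), and $\phi$ is a smooth real function on $X$, then for every $\psi\in W^{1,2}(X,E)$, with norms and area measure taken with respect to $g$, $$\int_X\|\overline\partial\psi\|^2\,e^{2(k-1)\phi}\,dA\ \ge\ (k-1)\int_X(\Delta\phi+1)\,\|\psi\|^2\,e^{2(k-1)\phi}\,dA .$$ -/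

import Mathlib

open scoped Manifold ContDiff TensorProduct

noncomputable section

namespace RiemannSurface

/-- A Riemann surface is in particular a real analytic surface, modelled on `ℂ = ℝ²`. -/
instance (priority := low) realIsManifold (X : Type*) [TopologicalSpace X] [ChartedSpace ℂ X]
    [IsManifold 𝓘(ℂ) ω X] : IsManifold 𝓘(ℝ, ℂ) ω X := by
  refine isManifold_of_contDiffOn _ _ _ fun e e' he he' => ?_
  have h := (contDiffGroupoid ω 𝓘(ℂ)).compatible he he'
  rw [contDiffGroupoid, mem_groupoid_of_pregroupoid, contDiffPregroupoid] at h
  exact h.1.restrict_scalars ℝ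

variable {X : Type*} [TopologicalSpace X] [ChartedSpace ℂ X]

/-! ### The bundle `E` and the `E`-valued `(0,1)`-forms -/

/-- The fibre at `x` of `E = T^{1,0}X ⊗ ⋯ ⊗ T^{1,0}X` (`k - 1` factors). The holomorphic tangent
space at `x` is the tangent space of the complex manifold `X`. -/
abbrev EFibre (k : ℕ) (x : X) : Type := ⨂[ℂ]^(k - 1) (TangentSpace 𝓘(ℂ) x)

/-- The fibre at `x` of the bundle of `(0,1)`-forms with values in `E`: the antilinear maps from
the tangent space to `E_x`. -/
abbrev EForm01Fibre (k : ℕ) (x : X) : Type :=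
  TangentSpace 𝓘(ℂ) x →ₛₗ[starRingEnd ℂ] EFibre k x

/-- The coordinate differential `dz` at `x` of the holomorphic chart `z = e`. -/
def dz (e : OpenPartialHomeomorph X ℂ) (x : X) : TangentSpace 𝓘(ℂ) x →ₗ[ℂ] ℂ :=
  (mfderiv 𝓘(ℂ) 𝓘(ℂ) e x : TangentSpace 𝓘(ℂ) x →L[ℂ] TangentSpace 𝓘(ℂ) (e x)).toLinearMap

/-- The coordinate vector `∂/∂z` of the holomorphic chart `e`, at the point of coordinate `z`. -/
def partialZ (e : OpenPartialHomeomorph X ℂ) (z : ℂ) : TangentSpace 𝓘(ℂ) (e.symm z) :=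
  mfderiv 𝓘(ℂ) 𝓘(ℂ) e.symm z (1 : ℂ)

/-- The coefficient of an element of `E_x` in the frame `∂/∂z ⊗ ⋯ ⊗ ∂/∂z` of the chart
`z = e`, that is, its image under `dz ⊗ ⋯ ⊗ dz`. -/
def frameCoeff (k : ℕ) (e : OpenPartialHomeomorph X ℂ) (x : X) : EFibre k x →ₗ[ℂ] ℂ :=
  PiTensorProduct.lift
    ((MultilinearMap.mkPiAlgebra ℂ (Fin (k - 1)) ℂ).compLinearMap fun _ => dz e x)

/-- The function `ψ(z)` with `ψ = ψ(z) ∂/∂z ⊗ ⋯ ⊗ ∂/∂z` in the chart `e`. -/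
def sectionCoeff {k : ℕ} (e : OpenPartialHomeomorph X ℂ) (ψ : ∀ x : X, EFibre k x) (z : ℂ) : ℂ :=
  frameCoeff k e (e.symm z) (ψ (e.symm z))

/-- The function `β(z)` with `β = β(z) dz̄ ⊗ ∂/∂z ⊗ ⋯ ⊗ ∂/∂z` in the chart `e`. -/
def formCoeff {k : ℕ} (e : OpenPartialHomeomorph X ℂ) (β : ∀ x : X, EForm01Fibre k x)
    (z : ℂ) : ℂ :=
  frameCoeff k e (e.symm z) (β (e.symm z) (partialZ e z))

/-! ### The weak `∂̄` operator -/

/-- The derivative `∂f/∂z̄ = (∂f/∂x + i ∂f/∂y) / 2` of a function of `z = x + i y`. -/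
def partialZBar (f : ℂ → ℂ) (z : ℂ) : ℂ :=
  (fderiv ℝ f z 1 + Complex.I * fderiv ℝ f z Complex.I) / 2

/-- `b = ∂f/∂z̄` on the open set `U` in the sense of distributions, `f` and `b` being locally
integrable on `U`. -/
def IsWeakPartialZBar (U : Set ℂ) (f b : ℂ → ℂ) : Prop :=
  MeasureTheory.LocallyIntegrableOn f U ∧ MeasureTheory.LocallyIntegrableOn b U ∧
    ∀ χ : ℂ → ℂ, ContDiff ℝ ∞ χ → HasCompactSupport χ → tsupport χ ⊆ U →
      ∫ z in U, f z * partialZBar χ z = -∫ z in U, b z * χ z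

/-- `β = ∂̄ψ` in the sense of distributions. As `∂/∂z ⊗ ⋯ ⊗ ∂/∂z` is a holomorphic frame of `E`,
this says that `β(z) = ∂ψ(z)/∂z̄` weakly in every holomorphic chart. -/
def IsWeakDbar {k : ℕ} (ψ : ∀ x : X, EFibre k x) (β : ∀ x : X, EForm01Fibre k x) : Prop :=
  ∀ e ∈ atlas ℂ X, IsWeakPartialZBar e.target (sectionCoeff e ψ) (formCoeff e β)

/-! ### Metrics -/

/-- A (smooth) Riemannian metric on a Riemann surface `X` that is compatible with the complex
structure: multiplication by `i` on tangent vectors is an isometry. -/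
structure ConformalMetric (X : Type*) [TopologicalSpace X] [ChartedSpace ℂ X]
    [IsManifold 𝓘(ℂ) ω X] extends
    Bundle.ContMDiffRiemannianMetric 𝓘(ℝ, ℂ) ∞ ℂ (fun x : X => TangentSpace 𝓘(ℝ, ℂ) x) where
  conformal : ∀ (x : X) (v : ℂ),
    inner x (Complex.I * v : ℂ) (Complex.I * v : ℂ) = inner x v v

variable [IsManifold 𝓘(ℂ) ω X]

namespace ConformalMetric

/-- The function `ρ` with `g = ρ(z) |dz|² = ρ (dx² + dy²)` in the chart `e`, namely
`ρ = g(∂/∂x, ∂/∂x)`. -/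
def density (g : ConformalMetric X) (e : OpenPartialHomeomorph X ℂ) (z : ℂ) : ℝ :=
  let v : TangentSpace 𝓘(ℝ, ℂ) (e.symm z) := mfderiv 𝓘(ℝ, ℂ) 𝓘(ℝ, ℂ) e.symm z (1 : ℂ)
  g.inner (e.symm z) v v

/-- The coefficient `h(∂/∂z, ∂/∂z)` of the Hermitian metric `h(v, w) = g(v, w̄)` on the holomorphic
tangent bundle, where `g` is extended complex bilinearly: as `∂/∂z = (∂/∂x - i ∂/∂y) / 2`, it
is `g(∂/∂z, ∂/∂z̄) = (g(∂/∂x, ∂/∂x) + g(∂/∂y, ∂/∂y)) / 4 = ρ / 2`. -/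
def hermitianCoeff (g : ConformalMetric X) (e : OpenPartialHomeomorph X ℂ) (z : ℂ) : ℝ :=
  g.density e z / 2

/-- The pointwise square norm `⟨ψ, ψ⟩_g = |ψ(z)|² h^{k-1}` of a section of `E`, where
`h = h(∂/∂z, ∂/∂z)`. It is computed in one chart at `x` and does not depend on the chart. -/
def sectionNormSq (g : ConformalMetric X) {k : ℕ} (ψ : ∀ x : X, EFibre k x) (x : X) : ℝ :=
  ‖sectionCoeff (chartAt ℂ x) ψ (chartAt ℂ x x)‖ ^ 2 *
    g.hermitianCoeff (chartAt ℂ x) (chartAt ℂ x x) ^ (k - 1)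

/-- The pointwise square norm `⟨β, β⟩_g = |β(z)|² h^{-1} h^{k-1}` of an `E`-valued `(0,1)`-form,
where `h = h(∂/∂z, ∂/∂z)` and so `h^{-1}` is the square norm of `dz̄`. -/
def formNormSq (g : ConformalMetric X) {k : ℕ} (β : ∀ x : X, EForm01Fibre k x) (x : X) : ℝ :=
  ‖formCoeff (chartAt ℂ x) β (chartAt ℂ x x)‖ ^ 2 *
    (g.hermitianCoeff (chartAt ℂ x) (chartAt ℂ x x))⁻¹ *
      g.hermitianCoeff (chartAt ℂ x) (chartAt ℂ x x) ^ (k - 1)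

/-- The Laplace-Beltrami operator of `g` on functions, `Δ_g u = (∂²u/∂x² + ∂²u/∂y²) / ρ` in a
holomorphic chart. -/
def laplacian (g : ConformalMetric X) (u : X → ℝ) (x : X) : ℝ :=
  (Laplacian.laplacian (fun z => u ((chartAt ℂ x).symm z))) (chartAt ℂ x x) /
    g.density (chartAt ℂ x) (chartAt ℂ x x)

/-- The Gaussian curvature of `g = ρ(z) |dz|² = e^{2φ} |dz|²`, which in isothermal coordinates is
`K = - e^{-2φ} Δφ = - Δ(log ρ) / (2 ρ)`. -/
def gaussCurvature (g : ConformalMetric X) (x : X) : ℝ :=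
  -(Laplacian.laplacian (fun z => Real.log (g.density (chartAt ℂ x) z))) (chartAt ℂ x x) /
    (2 * g.density (chartAt ℂ x) (chartAt ℂ x x))

/-- A hyperbolic metric: constant Gaussian curvature `-1`. -/
def IsHyperbolic (g : ConformalMetric X) : Prop := ∀ x, g.gaussCurvature x = -1

/-- The area measure of `g` on the domain of the chart `e`, extended by zero: the image of
`ρ dx dy` under the parametrization `e.symm`. -/
def chartArea [MeasurableSpace X] (g : ConformalMetric X) (e : OpenPartialHomeomorph X ℂ) :
    MeasureTheory.Measure X :=
  ((MeasureTheory.volume.restrict e.target).withDensity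
    fun z => ENNReal.ofReal (g.density e z)).map e.symm

/-- The area measure `dA_g`. The measures `g.chartArea e` agree on the overlaps of the charts, and
`g.area` is their supremum: the measure whose restriction to the domain of each chart
`e` is `g.chartArea e`. -/
def area [MeasurableSpace X] (g : ConformalMetric X) : MeasureTheory.Measure X :=
  ⨆ e ∈ atlas ℂ X, g.chartArea e

/-- `ψ ∈ W^{1,2}(X, E)`: the section `ψ` has a weak derivative `∂̄ψ`, and
`∫ (‖ψ‖² + ‖∂̄ψ‖²) dA < ∞`. -/
def MemW12 [MeasurableSpace X] (g : ConformalMetric X) {k : ℕ} (ψ : ∀ x : X, EFibre k x) : Prop :=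
  ∃ β : ∀ x : X, EForm01Fibre k x, IsWeakDbar ψ β ∧
    MeasureTheory.Integrable (fun x => g.sectionNormSq ψ x + g.formNormSq β x) g.area

end ConformalMetric

end RiemannSurface

end

/-! Write n = k - 1. The inequalities are all cases of one weighted estimate: for every smooth real
φ, the integral of e^{2nφ}‖∂̄ψ‖² is at least n times the integral of (Δφ - K) e^{2nφ}‖ψ‖². Taking φ
= 0 gives the first claim, K = -1 the other two.

The estimate is the Bochner-Kodaira identity with a square dropped. In a chart let W = (ρ/2)^n
e^{2nφ} be the weight of the Hermitian metric on E. Two integrations by parts give ∫ W|∂̄f|² = ∫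
W⁻¹|∂(Wf)|² + ∫ (Δ log W / 4) W|f|² for compactly supported smooth f (`integral_bochner`, in
polarized form). The first term on the right is nonnegative. The last is the curvature term, since Δ
log W = 2nρ(Δ_g φ - K) in every chart (`laplacian_log_weight`): a change of chart multiplies W by
|τ'|^{2n}, and log |τ'| is harmonic.

To globalize, a section is recorded by the function `u : X → ℂ` of its coefficients at x in the
frame of the preferred chart at x. Such a function need not be continuous; regularity is always that
of `secCoeff n e u` in the charts. The three integrands of the identity are global functions,
because ∂̄u and ∂(Wu) transform as tensors (`frmCoeff_dbarAt`, `wirtinger_weight_mul`). A smooth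
section is taken as a finite sum of pieces supported in charts; the identity is applied with the
whole section in the first slot and one piece in the second, and summed
(`energy_inequality_of_smooth`).

For ψ in W^{1,2}, a partition of unity χ_i cuts ψ into pieces supported in charts. Mollifying each
χ_i ψ approximates it and ∂̄(χ_i ψ) in L² (`exists_local_approx`). The sum of the χ_i ∂̄ψ + (∂̄χ_i)ψ
is ∂̄ψ, as the ∂̄χ_i add up to zero, and the inequality passes to the limit because the curvature is
bounded on compact X (`integral_le_of_approx`, `energy_inequality`). -/

noncomputable section

namespace RiemannSurface

open MeasureTheory Filter Topology ComplexConjugate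

section

/-! ### Wirtinger derivatives -/

/-- The operator `(∂/∂x + s ∂/∂y) / 2`: it is `∂/∂z̄` for `s = i` and `∂/∂z` for `s = -i`. -/
def wirtinger (s : ℂ) (f : ℂ → ℂ) (z : ℂ) : ℂ :=
  (fderiv ℝ f z 1 + s * fderiv ℝ f z Complex.I) / 2

theorem partialZBar_eq_wirtinger (f : ℂ → ℂ) : partialZBar f = wirtinger Complex.I f := rfl

theorem wirtinger_mul (s : ℂ) {f g : ℂ → ℂ} {z : ℂ} (hf : DifferentiableAt ℝ f z)
    (hg : DifferentiableAt ℝ g z) :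
    wirtinger s (fun z => f z * g z) z = wirtinger s f z * g z + f z * wirtinger s g z := by
  have h : fderiv ℝ (fun z => f z * g z) z = f z • fderiv ℝ g z + g z • fderiv ℝ f z :=
    fderiv_fun_mul hf hg
  simp only [wirtinger, h, add_apply, smul_apply,
    smul_eq_mul]
  ring

theorem wirtinger_add (s : ℂ) {f g : ℂ → ℂ} {z : ℂ} (hf : DifferentiableAt ℝ f z)
    (hg : DifferentiableAt ℝ g z) :
    wirtinger s (fun z => f z + g z) z = wirtinger s f z + wirtinger s g z := by
  have h : fderiv ℝ (fun z => f z + g z) z = fderiv ℝ f z + fderiv ℝ g z := fderiv_fun_add hf hg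
  simp only [wirtinger, h, add_apply]
  ring

theorem wirtinger_sum (s : ℂ) {ι : Type*} (t : Finset ι) {f : ι → ℂ → ℂ} {z : ℂ}
    (hf : ∀ i ∈ t, DifferentiableAt ℝ (f i) z) :
    wirtinger s (fun z => ∑ i ∈ t, f i z) z = ∑ i ∈ t, wirtinger s (f i) z := by
  simp only [wirtinger, fderiv_fun_sum hf, sum_apply, Finset.mul_sum,
    ← Finset.sum_add_distrib, ← Finset.sum_div]

theorem wirtinger_congr (s : ℂ) {f g : ℂ → ℂ} {z : ℂ} (h : f =ᶠ[𝓝 z] g) :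
    wirtinger s f z = wirtinger s g z := by
  simp only [wirtinger, h.fderiv_eq]

theorem wirtinger_eq_zero (s : ℂ) {f : ℂ → ℂ} {z : ℂ} (h : f =ᶠ[𝓝 z] fun _ => 0) :
    wirtinger s f z = 0 := by
  rw [wirtinger_congr s h]; simp [wirtinger]

theorem wirtinger_contDiffOn (s : ℂ) {f : ℂ → ℂ} {U : Set ℂ} (hU : IsOpen U)
    (hf : ContDiffOn ℝ ∞ f U) : ContDiffOn ℝ ∞ (wirtinger s f) U := by
  have h : ContDiffOn ℝ ∞ (fderiv ℝ f) U := hf.fderiv_of_isOpen hU (by simp)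
  exact ((h.clm_apply contDiffOn_const).add
    (contDiffOn_const.mul (h.clm_apply contDiffOn_const))).div_const 2

theorem wirtinger_contDiff (s : ℂ) {f : ℂ → ℂ} (hf : ContDiff ℝ ∞ f) :
    ContDiff ℝ ∞ (wirtinger s f) :=
  contDiffOn_univ.1 (wirtinger_contDiffOn s isOpen_univ hf.contDiffOn)

theorem wirtinger_conj (s : ℂ) (f : ℂ → ℂ) (z : ℂ) :
    wirtinger (conj s) (fun z => conj (f z)) z = conj (wirtinger s f z) := by
  have h : fderiv ℝ (fun z => conj (f z)) z =
      (Complex.conjCLE : ℂ →L[ℝ] ℂ).comp (fderiv ℝ f z) :=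
    Complex.conjCLE.comp_fderiv
  simp [wirtinger, h, map_ofNat]

theorem tsupport_wirtinger_subset (s : ℂ) (f : ℂ → ℂ) :
    tsupport (wirtinger s f) ⊆ tsupport f := by
  refine closure_minimal (fun z hz => ?_) (isClosed_tsupport f)
  by_contra h
  exact hz (wirtinger_eq_zero s (notMem_tsupport_iff_eventuallyEq.1 h))

theorem real_linear_apply (L : ℂ →L[ℝ] ℂ) (v : ℂ) :
    L v = v.re * L 1 + v.im * L Complex.I := by
  conv_lhs => rw [show v = v.re • (1 : ℂ) + v.im • Complex.I by
    simp [Complex.re_add_im]]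
  rw [map_add, map_smul, map_smul, Complex.real_smul, Complex.real_smul]

theorem fderiv_comp_holomorphic {f τ : ℂ → ℂ} {z a : ℂ} (hτ : HasDerivAt τ a z)
    (hf : DifferentiableAt ℝ f (τ z)) (v : ℂ) :
    fderiv ℝ (fun z => f (τ z)) z v = fderiv ℝ f (τ z) (a * v) := by
  have h1 : HasFDerivAt τ ((ContinuousLinearMap.toSpanSingleton ℂ a).restrictScalars ℝ) z :=
    hτ.hasFDerivAt.restrictScalars ℝ
  have h2 := hf.hasFDerivAt.comp z h1
  have h3 : fderiv ℝ (fun z => f (τ z)) z = _ := h2.fderiv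
  rw [h3]
  simp [mul_comm]

/-- The differential of τ is multiplication by a, and the antilinear part of a real linear map sees
this factor through its conjugate; the linear part, treated next, sees a itself. -/
theorem wirtinger_I_comp {f τ : ℂ → ℂ} {z a : ℂ} (hτ : HasDerivAt τ a z)
    (hf : DifferentiableAt ℝ f (τ z)) :
    wirtinger Complex.I (fun z => f (τ z)) z = wirtinger Complex.I f (τ z) * conj a := by
  simp only [wirtinger, fderiv_comp_holomorphic hτ hf]
  rw [real_linear_apply _ (a * 1), real_linear_apply _ (a * Complex.I)]
  apply Complex.ext <;> simp <;> ring

theorem wirtinger_neg_I_comp {f τ : ℂ → ℂ} {z a : ℂ} (hτ : HasDerivAt τ a z)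
    (hf : DifferentiableAt ℝ f (τ z)) :
    wirtinger (-Complex.I) (fun z => f (τ z)) z = wirtinger (-Complex.I) f (τ z) * a := by
  simp only [wirtinger, fderiv_comp_holomorphic hτ hf]
  rw [real_linear_apply _ (a * 1), real_linear_apply _ (a * Complex.I)]
  apply Complex.ext <;> simp <;> ring

theorem wirtinger_I_holomorphic {τ : ℂ → ℂ} {z : ℂ} (hτ : DifferentiableAt ℂ τ z) :
    wirtinger Complex.I τ z = 0 := by
  have h := wirtinger_I_comp (f := fun w => w) hτ.hasDerivAt differentiableAt_id
  rw [h]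
  simp [wirtinger]

theorem wirtinger_neg_I_conj_holomorphic {τ : ℂ → ℂ} {z : ℂ} (hτ : DifferentiableAt ℂ τ z) :
    wirtinger (-Complex.I) (fun z => conj (τ z)) z = 0 := by
  have h := wirtinger_conj Complex.I τ z
  rwa [wirtinger_I_holomorphic hτ, map_zero, Complex.conj_I] at h

/-- Symmetry of the second derivative makes the formula symmetric in s and t, so ∂ and ∂̄ commute.
For s = -t = i the mixed term cancels and a quarter of the Laplacian remains. -/
theorem wirtinger_wirtinger {f : ℂ → ℂ} {z : ℂ} (hf : ContDiffAt ℝ 2 f z) (s t : ℂ) :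
    wirtinger s (wirtinger t f) z =
      (iteratedFDeriv ℝ 2 f z ![1, 1] + (s + t) * iteratedFDeriv ℝ 2 f z ![1, Complex.I] +
        s * t * iteratedFDeriv ℝ 2 f z ![Complex.I, Complex.I]) / 4 := by
  have hd : DifferentiableAt ℝ (fderiv ℝ f) z :=
    (hf.fderiv_right (m := 1) (by norm_num)).differentiableAt (by norm_num)
  have hsymm : IsSymmSndFDerivAt ℝ f z := hf.isSymmSndFDerivAt (by simp)
  have h : ∀ v : ℂ, fderiv ℝ (wirtinger t f) z v =
      (fderiv ℝ (fderiv ℝ f) z v 1 + t * fderiv ℝ (fderiv ℝ f) z v Complex.I) / 2 := by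
    intro v
    have h1 : HasFDerivAt (fun w => fderiv ℝ f w 1)
        ((ContinuousLinearMap.apply ℝ ℂ (1 : ℂ)).comp (fderiv ℝ (fderiv ℝ f) z)) z :=
      (ContinuousLinearMap.apply ℝ ℂ (1 : ℂ)).hasFDerivAt.comp z hd.hasFDerivAt
    have h2 : HasFDerivAt (fun w => fderiv ℝ f w Complex.I)
        ((ContinuousLinearMap.apply ℝ ℂ Complex.I).comp (fderiv ℝ (fderiv ℝ f) z)) z :=
      (ContinuousLinearMap.apply ℝ ℂ Complex.I).hasFDerivAt.comp z hd.hasFDerivAt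
    have h3 := (h1.add (h2.const_mul t)).mul_const (2⁻¹ : ℂ)
    have h4 : fderiv ℝ (wirtinger t f) z = _ := h3.fderiv
    rw [h4]
    simp [div_eq_mul_inv]
    ring
  simp only [wirtinger] at h ⊢
  rw [h, h]
  simp only [iteratedFDeriv_two_apply, Matrix.cons_val_zero, Matrix.cons_val_one]
  rw [hsymm.eq Complex.I 1]
  ring

theorem wirtinger_I_neg_I {f : ℂ → ℂ} {z : ℂ} (hf : ContDiffAt ℝ 2 f z) :
    wirtinger Complex.I (wirtinger (-Complex.I) f) z = Laplacian.laplacian f z / 4 := by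
  rw [wirtinger_wirtinger hf, InnerProductSpace.laplacian_eq_iteratedFDeriv_complexPlane]
  simp

theorem wirtinger_neg_I_I {f : ℂ → ℂ} {z : ℂ} (hf : ContDiffAt ℝ 2 f z) :
    wirtinger (-Complex.I) (wirtinger Complex.I f) z =
      wirtinger Complex.I (wirtinger (-Complex.I) f) z := by
  rw [wirtinger_wirtinger hf, wirtinger_wirtinger hf]
  ring

theorem laplacian_ofReal {v : ℂ → ℝ} {z : ℂ} (hv : ContDiffAt ℝ 2 v z) :
    Laplacian.laplacian (fun z => (v z : ℂ)) z = (Laplacian.laplacian v z : ℝ) :=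
  hv.laplacian_CLM_comp_left (l := Complex.ofRealCLM)

theorem contDiffAt_ofReal {v : ℂ → ℝ} {z : ℂ} {n : WithTop ℕ∞} (hv : ContDiffAt ℝ n v z) :
    ContDiffAt ℝ n (fun z => (v z : ℂ)) z :=
  Complex.ofRealCLM.contDiff.contDiffAt.comp z hv

theorem contDiffOn_ofReal {v : ℂ → ℝ} {U : Set ℂ} {n : WithTop ℕ∞} (hv : ContDiffOn ℝ n v U) :
    ContDiffOn ℝ n (fun z => (v z : ℂ)) U :=
  Complex.ofRealCLM.contDiff.comp_contDiffOn hv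

theorem contDiffOn_conj {f : ℂ → ℂ} {U : Set ℂ} {n : WithTop ℕ∞} (hf : ContDiffOn ℝ n f U) :
    ContDiffOn ℝ n (fun z => conj (f z)) U :=
  Complex.conjCLE.contDiff.comp_contDiffOn hf

/-- The Laplacian transforms by the factor `‖τ'‖²` under a holomorphic change of variables. -/
theorem laplacian_comp_holomorphic {v : ℂ → ℝ} {τ : ℂ → ℂ} {z : ℂ} (hτ : AnalyticAt ℂ τ z)
    (hv : ContDiffAt ℝ ∞ v (τ z)) :
    Laplacian.laplacian (fun z => v (τ z)) z =
      Laplacian.laplacian v (τ z) * ‖deriv τ z‖ ^ 2 := by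
  have h2 : (2 : WithTop ℕ∞) ≤ ∞ := ENat.LEInfty.out
  have hτR : ContDiffAt ℝ ∞ τ z := hτ.contDiffAt.restrict_scalars ℝ
  have hvτ : ContDiffAt ℝ 2 (fun z => v (τ z)) z := (hv.comp z hτR).of_le h2
  set V : ℂ → ℂ := fun w => (v w : ℂ) with hV
  have hVs : ContDiffAt ℝ ∞ V (τ z) := contDiffAt_ofReal hv
  -- With Δ = 4∂̄∂: the chain rule for ∂ produces the factor τ', which is holomorphic and so passes
  -- through ∂̄, while the chain rule for ∂̄ produces its conjugate.
  have key : wirtinger Complex.I (wirtinger (-Complex.I) fun z => V (τ z)) z =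
      wirtinger Complex.I (wirtinger (-Complex.I) V) (τ z) * conj (deriv τ z) * deriv τ z := by
    have e1 : (wirtinger (-Complex.I) fun z => V (τ z)) =ᶠ[𝓝 z]
        fun w => wirtinger (-Complex.I) V (τ w) * deriv τ w := by
      have hn : ∀ᶠ w in 𝓝 (τ z), DifferentiableAt ℝ V w := by
        have := (hVs.of_le (m := 1) (by exact_mod_cast le_top)).eventually (by simp)
        exact this.mono fun w hw => hw.differentiableAt (by norm_num)
      filter_upwards [hτ.eventually_analyticAt, hτ.continuousAt.eventually hn] with w h1 h2
      exact wirtinger_neg_I_comp h1.differentiableAt.hasDerivAt h2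
    have hd : DifferentiableAt ℝ (wirtinger (-Complex.I) V) (τ z) := by
      have hf : DifferentiableAt ℝ (fderiv ℝ V) (τ z) :=
        ((hVs.of_le h2).fderiv_right (m := 1) (by norm_num)).differentiableAt (by norm_num)
      exact ((hf.clm_apply (differentiableAt_const _)).add
        ((hf.clm_apply (differentiableAt_const _)).const_mul _)).mul_const _
    rw [wirtinger_congr _ e1, wirtinger_mul (f := fun w => wirtinger (-Complex.I) V (τ w)) _
      (hd.comp z (hτ.differentiableAt.restrictScalars ℝ))
      (hτ.deriv.differentiableAt.restrictScalars ℝ),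
      wirtinger_I_holomorphic hτ.deriv.differentiableAt,
      wirtinger_I_comp hτ.differentiableAt.hasDerivAt hd]
    ring
  rw [wirtinger_I_neg_I (contDiffAt_ofReal hvτ), wirtinger_I_neg_I (hVs.of_le h2),
    laplacian_ofReal hvτ, laplacian_ofReal (hv.of_le h2), mul_assoc, mul_comm (conj _),
    Complex.mul_conj, Complex.normSq_eq_norm_sq] at key
  have : (Laplacian.laplacian (fun z => v (τ z)) z : ℂ) =
      ((Laplacian.laplacian v (τ z) * ‖deriv τ z‖ ^ 2 : ℝ) : ℂ) := by
    push_cast at key ⊢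
    linear_combination 4 * key
  exact_mod_cast this

/-! ### Integration by parts -/

/-- `A` is controlled only on `U`; near a point outside `U` the product is identically zero because
σ is. -/
theorem contDiff_mul_of_tsupport {n : WithTop ℕ∞} {A σ : ℂ → ℂ} {U : Set ℂ} (hU : IsOpen U)
    (hA : ContDiffOn ℝ n A U) (hσ : ContDiffOn ℝ n σ U) (hs : tsupport σ ⊆ U) :
    ContDiff ℝ n fun z => A z * σ z := by
  refine contDiff_iff_contDiffAt.2 fun z => ?_
  by_cases hz : z ∈ U
  · exact (hA.contDiffAt (hU.mem_nhds hz)).mul (hσ.contDiffAt (hU.mem_nhds hz))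
  · have h : σ =ᶠ[𝓝 z] 0 := notMem_tsupport_iff_eventuallyEq.1 fun h => hz (hs h)
    have h' : (fun z => A z * σ z) =ᶠ[𝓝 z] fun _ => 0 := by
      filter_upwards [h] with w hw
      simp [hw]
    exact contDiffAt_const.congr_of_eventuallyEq h'

theorem continuous_mul_of_tsupport {A σ : ℂ → ℂ} {U : Set ℂ} (hU : IsOpen U)
    (hA : ContinuousOn A U) (hσ : ContinuousOn σ U) (hs : tsupport σ ⊆ U) :
    Continuous fun z => A z * σ z := by
  rw [← contDiff_zero (𝕜 := ℝ)]
  exact contDiff_mul_of_tsupport hU (contDiffOn_zero.2 hA) (contDiffOn_zero.2 hσ) hs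

theorem integrable_mul_of_tsupport {A σ : ℂ → ℂ} {U : Set ℂ} (hU : IsOpen U)
    (hA : ContinuousOn A U) (hσ : ContinuousOn σ U) (hs : tsupport σ ⊆ U)
    (hc : HasCompactSupport σ) : Integrable fun z => A z * σ z :=
  (continuous_mul_of_tsupport hU hA hσ hs).integrable_of_hasCompactSupport hc.mul_left

theorem integral_wirtinger_eq_zero (s : ℂ) {f : ℂ → ℂ} (hf : ContDiff ℝ ∞ f)
    (hc : HasCompactSupport f) : ∫ z, wirtinger s f z = 0 := by
  have hint : ∀ v : ℂ, Integrable fun z => fderiv ℝ f z v := fun v =>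
    ((hf.continuous_fderiv (by simp)).clm_apply continuous_const).integrable_of_hasCompactSupport
      (hc.fderiv_apply ℝ v)
  have h : ∀ v : ℂ, ∫ z, fderiv ℝ f z v = 0 := by
    intro v
    -- Integration by parts against the constant function 1.
    have := integral_mul_fderiv_eq_neg_fderiv_mul_of_integrable (μ := (volume : Measure ℂ))
      (f := fun _ : ℂ => (1 : ℂ)) (g := f) (v := v) (by simp) (by simpa using hint v)
      (by simpa using hf.continuous.integrable_of_hasCompactSupport hc)
      (fun _ _ => differentiableAt_const _)
      (fun x _ => (hf.differentiable (by simp)) x)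
    simpa using this
  simp only [wirtinger]
  rw [integral_div, integral_add (hint 1) ((hint Complex.I).const_mul s), integral_const_mul,
    h, h]
  simp

/-- Integration by parts for the Wirtinger derivatives. -/
theorem integral_mul_wirtinger (s : ℂ) {A σ : ℂ → ℂ} {U : Set ℂ} (hU : IsOpen U)
    (hA : ContDiffOn ℝ ∞ A U) (hσ : ContDiffOn ℝ ∞ σ U) (hs : tsupport σ ⊆ U)
    (hc : HasCompactSupport σ) :
    ∫ z, A z * wirtinger s σ z = -∫ z, wirtinger s A z * σ z := by
  have hs' := (tsupport_wirtinger_subset s σ).trans hs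
  have hc' : HasCompactSupport (wirtinger s σ) :=
    hc.of_isClosed_subset (isClosed_tsupport _) (tsupport_wirtinger_subset s σ)
  have i1 := integrable_mul_of_tsupport hU hA.continuousOn
    (wirtinger_contDiffOn s hU hσ).continuousOn hs' hc'
  have i2 := integrable_mul_of_tsupport hU (wirtinger_contDiffOn s hU hA).continuousOn
    hσ.continuousOn hs hc
  rw [eq_neg_iff_add_eq_zero, ← integral_add i1 i2,
    ← integral_wirtinger_eq_zero s (contDiff_mul_of_tsupport hU hA hσ hs) hc.mul_left]
  congr 1
  ext z
  by_cases hz : z ∈ U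
  · rw [wirtinger_mul s ((hA.contDiffAt (hU.mem_nhds hz)).differentiableAt (by simp))
      ((hσ.contDiffAt (hU.mem_nhds hz)).differentiableAt (by simp))]
    ring
  · have h : σ =ᶠ[𝓝 z] 0 := notMem_tsupport_iff_eventuallyEq.1 fun h => hz (hs h)
    have h' : (fun z => A z * σ z) =ᶠ[𝓝 z] fun _ => 0 := by
      filter_upwards [h] with w hw
      simp [hw]
    rw [wirtinger_eq_zero s h, wirtinger_eq_zero s h', h.self_of_nhds]
    simp

/-- The Bochner-Kodaira identity in a chart, for the weight `W`. -/
theorem integral_bochner {U : Set ℂ} (hU : IsOpen U) {W : ℂ → ℝ} (hW : ContDiffOn ℝ ∞ W U)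
    (hpos : ∀ z ∈ U, 0 < W z) {f η : ℂ → ℂ} (hf : ContDiffOn ℝ ∞ f U)
    (hη : ContDiffOn ℝ ∞ η U) (hs : tsupport η ⊆ U) (hc : HasCompactSupport η) :
    ∫ z, W z * wirtinger Complex.I f z * conj (wirtinger Complex.I η z) =
      (∫ z, (W z : ℂ)⁻¹ * wirtinger (-Complex.I) (fun z => W z * f z) z *
        conj (wirtinger (-Complex.I) (fun z => W z * η z) z)) +
      ∫ z, ((Laplacian.laplacian (fun z => Real.log (W z)) z / 4 : ℝ) : ℂ) *
        (W z * f z * conj (η z)) := by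
  have hWc := contDiffOn_ofReal hW
  have hne : ∀ z ∈ U, (W z : ℂ) ≠ 0 := fun z hz => by exact_mod_cast (hpos z hz).ne'
  have hlog : ContDiffOn ℝ ∞ (fun z => Real.log (W z)) U := hW.log fun z hz => (hpos z hz).ne'
  set ℓ : ℂ → ℂ := fun z => (Real.log (W z) : ℂ) with hℓ
  have hℓs : ContDiffOn ℝ ∞ ℓ U := contDiffOn_ofReal hlog
  have hηs := contDiffOn_conj hη
  have hηsupp : tsupport (fun z => conj (η z)) = tsupport η := by
    simp [tsupport, Function.support]
  have hηc : HasCompactSupport (fun z => conj (η z)) := by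
    rw [HasCompactSupport, hηsupp]; exact hc
  have hWη : tsupport (fun z => W z * conj (η z)) ⊆ U :=
    (tsupport_mul_subset_right).trans (hηsupp.subset.trans hs)
  have hWηc : HasCompactSupport (fun z => W z * conj (η z)) := hηc.mul_left
  have da : ∀ {g : ℂ → ℂ}, ContDiffOn ℝ ∞ g U → ∀ z ∈ U, DifferentiableAt ℝ g z :=
    fun hg z hz => (hg.contDiffAt (hU.mem_nhds hz)).differentiableAt (by simp)
  have h2 : (2 : WithTop ℕ∞) ≤ ∞ := ENat.LEInfty.out
  -- `∂W = W ∂(log W)`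
  have hdW : ∀ z ∈ U, wirtinger (-Complex.I) (fun z => (W z : ℂ)) z =
      W z * wirtinger (-Complex.I) ℓ z := by
    intro z hz
    have hd : DifferentiableAt ℝ W z :=
      (hW.contDiffAt (hU.mem_nhds hz)).differentiableAt (by simp)
    have e1 : HasFDerivAt (fun z => (W z : ℂ)) (Complex.ofRealCLM.comp (fderiv ℝ W z)) z :=
      Complex.ofRealCLM.hasFDerivAt.comp z hd.hasFDerivAt
    have e2 : HasFDerivAt ℓ (Complex.ofRealCLM.comp ((W z)⁻¹ • fderiv ℝ W z)) z :=
      Complex.ofRealCLM.hasFDerivAt.comp z (hd.hasFDerivAt.log (hpos z hz).ne')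
    simp only [wirtinger, e1.fderiv, e2.fderiv]
    have := hne z hz
    simp
    field_simp
  -- `A` is W⁻¹∂(Wf), the (1,0) part of the Chern connection of the weight applied to f.
  set A : ℂ → ℂ := fun z => wirtinger (-Complex.I) f z + wirtinger (-Complex.I) ℓ z * f z with hA
  have hAs : ContDiffOn ℝ ∞ A U :=
    (wirtinger_contDiffOn _ hU hf).add ((wirtinger_contDiffOn _ hU hℓs).mul hf)
  have hWf : ∀ z ∈ U, wirtinger (-Complex.I) (fun z => W z * f z) z = W z * A z := by
    intro z hz
    rw [wirtinger_mul _ (da hWc z hz) (da hf z hz), hdW z hz]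
    simp only [hA]
    ring
  have hsη : ∀ {s : ℂ} {z : ℂ}, z ∉ U → wirtinger s (fun z => W z * η z) z = 0 := by
    intro s z hz
    refine wirtinger_eq_zero s ?_
    have : η =ᶠ[𝓝 z] 0 := notMem_tsupport_iff_eventuallyEq.1 fun h => hz (hs h)
    filter_upwards [this] with w hw
    simp [hw]
  have hsη' : ∀ {s : ℂ} {z : ℂ}, z ∉ U → wirtinger s η z = 0 := by
    intro s z hz
    exact wirtinger_eq_zero s (notMem_tsupport_iff_eventuallyEq.1 fun h => hz (hs h))
  have I1 : ∫ z, W z * wirtinger Complex.I f z * conj (wirtinger Complex.I η z) =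
      -∫ z, wirtinger (-Complex.I) (fun z => W z * wirtinger Complex.I f z) z * conj (η z) := by
    rw [← integral_mul_wirtinger (-Complex.I) hU
      (hWc.mul (wirtinger_contDiffOn Complex.I hU hf)) hηs (hηsupp.subset.trans hs) hηc]
    congr 1; ext z
    rw [← wirtinger_conj, Complex.conj_I]
  have I2 : ∫ z, (W z : ℂ)⁻¹ * wirtinger (-Complex.I) (fun z => W z * f z) z *
        conj (wirtinger (-Complex.I) (fun z => W z * η z) z) =
      -∫ z, wirtinger Complex.I A z * (W z * conj (η z)) := by
    rw [← integral_mul_wirtinger Complex.I hU hAs (hWc.mul hηs) hWη hWηc]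
    congr 1; ext z
    have hconj : conj (wirtinger (-Complex.I) (fun z => W z * η z) z) =
        wirtinger Complex.I (fun z => W z * conj (η z)) z := by
      rw [← wirtinger_conj]; simp
    by_cases hz : z ∈ U
    · rw [hconj, hWf z hz, inv_mul_cancel_left₀ (hne z hz)]
    · rw [← hconj, hsη hz]; simp
  have j1 : Integrable fun z =>
      wirtinger (-Complex.I) (fun z => W z * wirtinger Complex.I f z) z * conj (η z) :=
    integrable_mul_of_tsupport hU (wirtinger_contDiffOn _ hU
      (hWc.mul (wirtinger_contDiffOn Complex.I hU hf))).continuousOn hηs.continuousOn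
      (hηsupp.subset.trans hs) hηc
  have j2 : Integrable fun z => wirtinger Complex.I A z * (W z * conj (η z)) :=
    integrable_mul_of_tsupport hU (wirtinger_contDiffOn _ hU hAs).continuousOn
      (hWc.mul hηs).continuousOn hWη hWηc
  -- It remains to compute W ∂̄A - ∂(W ∂̄f). The second derivatives of f cancel since ∂ and ∂̄
  -- commute, the first-order terms W ∂(log W) ∂̄f cancel, and only W (∂̄∂ log W) f survives.
  rw [I1, I2, ← sub_eq_iff_eq_add', sub_neg_eq_add, neg_add_eq_sub, ← integral_sub j2 j1]
  congr 1; ext z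
  by_cases hz : z ∈ U
  · have hfat := (hf.contDiffAt (hU.mem_nhds hz)).of_le h2
    have hlat := (hlog.contDiffAt (hU.mem_nhds hz)).of_le h2
    have hA' : wirtinger Complex.I A z = wirtinger Complex.I (wirtinger (-Complex.I) f) z +
        (wirtinger Complex.I (wirtinger (-Complex.I) ℓ) z * f z +
          wirtinger (-Complex.I) ℓ z * wirtinger Complex.I f z) := by
      simp only [hA]
      rw [wirtinger_add _ (da (wirtinger_contDiffOn _ hU hf) z hz)
        (da ((wirtinger_contDiffOn _ hU hℓs).mul hf) z hz),
        wirtinger_mul _ (da (wirtinger_contDiffOn _ hU hℓs) z hz) (da hf z hz)]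
    rw [hA', wirtinger_mul _ (da hWc z hz) (da (wirtinger_contDiffOn _ hU hf) z hz), hdW z hz,
      wirtinger_neg_I_I hfat, wirtinger_I_neg_I (contDiffAt_ofReal hlat), laplacian_ofReal hlat]
    push_cast
    ring
  · have : η z = 0 := image_eq_zero_of_notMem_tsupport fun h => hz (hs h)
    simp [this]

end

section

/-! ### Mollification in `L²` -/

/-- Translations act continuously on L²; this is that continuity at t = 0. -/
theorem tendsto_eLpNorm_translate {f : ℂ → ℂ} (hf : MemLp f 2) :
    Tendsto (fun t => eLpNorm (fun x => f (x - t) - f x) 2 volume) (𝓝 0) (𝓝 0) := by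
  have : Fact ((2 : ENNReal) ≠ ⊤) := ⟨by simp⟩
  have h1 : Tendsto (fun t : ℂ => DomAddAct.mk (-t) +ᵥ hf.toLp f) (𝓝 0) (𝓝 (hf.toLp f)) := by
    have hc : Continuous fun t : ℂ => DomAddAct.mk (-t) +ᵥ hf.toLp f := by
      have : Continuous fun t : ℂ => DomAddAct.mk (-t) :=
        DomAddAct.continuous_mk.comp continuous_neg
      exact this.vadd continuous_const
    have := hc.tendsto 0
    rwa [neg_zero, DomAddAct.mk_zero, zero_vadd] at this
  have h2 := tendsto_iff_edist_tendsto_0.1 h1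
  refine h2.congr fun t => ?_
  rw [DomAddAct.mk_vadd_toLp, Lp.edist_toLp_toLp]
  congr 1
  ext x
  simp [sub_eq_add_neg, add_comm]

/-- Jensen's inequality for the probability measure g dt, obtained from the inclusion of L² in L¹.
-/
theorem enorm_integral_sq_le {g : ℂ → ℝ} (hg : Continuous g) (hg0 : ∀ t, 0 ≤ g t)
    (hgi : Integrable g) (hg1 : ∫ t, g t = 1) {F : ℂ → ℂ} (hF : AEStronglyMeasurable F) :
    ‖∫ t, F t * g t‖ₑ ^ 2 ≤ ∫⁻ t, ENNReal.ofReal (g t) * ‖F t‖ₑ ^ 2 := by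
  set ν : Measure ℂ := volume.withDensity fun t => ENNReal.ofReal (g t) with hν
  have hgm : Measurable fun t => ENNReal.ofReal (g t) := hg.measurable.ennreal_ofReal
  have hac : ν ≪ volume := withDensity_absolutelyContinuous _ _
  have : IsProbabilityMeasure ν := ⟨by
    rw [hν, withDensity_apply _ MeasurableSet.univ, Measure.restrict_univ,
      ← ofReal_integral_eq_lintegral_ofReal hgi (ae_of_all _ hg0), hg1, ENNReal.ofReal_one]⟩
  have hFν : AEStronglyMeasurable F ν := hF.mono_ac hac
  have h1 : ‖∫ t, F t * g t‖ₑ ≤ ∫⁻ t, ‖F t‖ₑ ∂ν := by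
    refine (enorm_integral_le_lintegral_enorm _).trans ?_
    rw [hν, lintegral_withDensity_eq_lintegral_mul₀ hgm.aemeasurable hF.enorm]
    refine le_of_eq (lintegral_congr fun t => ?_)
    rw [enorm_mul, Pi.mul_apply, mul_comm]
    congr 1
    rw [← ofReal_norm, Complex.norm_real, Real.norm_of_nonneg (hg0 t)]
  have h2 : ∫⁻ t, ‖F t‖ₑ ∂ν ≤ (∫⁻ t, ‖F t‖ₑ ^ 2 ∂ν) ^ (1 / 2 : ℝ) := by
    have := eLpNorm_le_eLpNorm_of_exponent_le (p := 1) (q := 2) (by norm_num) hFν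
    rw [eLpNorm_one_eq_lintegral_enorm, eLpNorm_eq_lintegral_rpow_enorm_toReal (by simp) (by simp)]
      at this
    simpa using this
  calc ‖∫ t, F t * g t‖ₑ ^ 2 ≤ ((∫⁻ t, ‖F t‖ₑ ^ 2 ∂ν) ^ (1 / 2 : ℝ)) ^ 2 := by
        gcongr; exact h1.trans h2
    _ = ∫⁻ t, ‖F t‖ₑ ^ 2 ∂ν := by
        rw [← ENNReal.rpow_natCast, ← ENNReal.rpow_mul]; norm_num
    _ = _ := by
        rw [hν, lintegral_withDensity_eq_lintegral_mul₀ hgm.aemeasurable (hF.enorm.pow_const 2)]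
        rfl

/-- The convolution of `f` with the real kernel `g`. -/
def mollify (g : ℂ → ℝ) (f : ℂ → ℂ) (x : ℂ) : ℂ := ∫ t, f t * g (x - t)

theorem mollify_eq_convolution (g : ℂ → ℝ) (f : ℂ → ℂ) :
    mollify g f = MeasureTheory.convolution f (fun t => (g t : ℂ)) (ContinuousLinearMap.mul ℝ ℂ)
      volume := rfl

theorem mollify_swap (g : ℂ → ℝ) (f : ℂ → ℂ) (x : ℂ) :
    mollify g f x = ∫ t, f (x - t) * g t := by
  rw [mollify_eq_convolution, convolution_eq_swap]; rfl

theorem eLpNorm_two_sq (f : ℂ → ℂ) :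
    eLpNorm f 2 volume ^ 2 = ∫⁻ x, ‖f x‖ₑ ^ 2 := by
  rw [eLpNorm_eq_lintegral_rpow_enorm_toReal (by simp) (by simp), ← ENNReal.rpow_natCast,
    ← ENNReal.rpow_mul]
  simp

theorem mollify_congr {g : ℂ → ℝ} {f f' : ℂ → ℂ} (h : f =ᵐ[volume] f') :
    mollify g f = mollify g f' := by
  ext x
  refine integral_congr_ae ?_
  filter_upwards [h] with t ht
  rw [ht]

/-- The error is the g-average over t of f(x - t) - f(x). By Jensen its square is at most the
average of the squares, and exchanging the integrals leaves an average of squared L² norms of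
translation differences. -/
theorem lintegral_mollify_sub_le {f : ℂ → ℂ} (hf : MemLp f 2) {ε : ENNReal} {g : ℂ → ℝ}
    (hg : Continuous g) (hc : HasCompactSupport g) (hg0 : ∀ t, 0 ≤ g t)
    (hg1 : ∫ t, g t = 1)
    (hε : ∀ t, g t ≠ 0 → eLpNorm (fun x => f (x - t) - f x) 2 volume ≤ ε) :
    ∫⁻ x, ‖mollify g f x - f x‖ₑ ^ 2 ≤ ε ^ 2 := by
  -- The exchange of integrals needs f(x - t) to be jointly measurable, so f is replaced by a
  -- strongly measurable representative; neither side notices.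
  wlog hm : StronglyMeasurable f generalizing f
  · obtain ⟨f', hf'm, hff'⟩ := hf.1
    rw [mollify_congr hff']
    have hf' : MemLp f' 2 := (memLp_congr_ae hff').1 hf
    have := this hf' (fun t ht => ?_) hf'm
    · refine le_trans (le_of_eq (lintegral_congr_ae ?_)) this
      filter_upwards [hff'] with x hx
      rw [hx]
    · refine le_trans (le_of_eq (eLpNorm_congr_ae ?_)) (hε t ht)
      have h1 : (fun x => f (x - t)) =ᵐ[volume] fun x => f' (x - t) :=
        (measurePreserving_sub_right volume t).quasiMeasurePreserving.ae_eq hff'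
      filter_upwards [hff', h1] with x hx hx'
      rw [hx, hx']
  have hgi : Integrable g := hg.integrable_of_hasCompactSupport hc
  have hloc : LocallyIntegrable f := hf.locallyIntegrable (by norm_num)
  have hconv : ∀ x, Integrable fun t => f (x - t) * g t := by
    intro x
    have h := HasCompactSupport.convolutionExists_right (μ := volume)
      (ContinuousLinearMap.mul ℝ ℂ) (f := f) (g := fun t => (g t : ℂ))
      (hc.comp_left (g := ((↑) : ℝ → ℂ)) (by simp)) hloc
      (Complex.continuous_ofReal.comp hg) x
    have := ConvolutionExistsAt.integrable_swap h
    simpa using this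
  have hpt : ∀ x, ‖mollify g f x - f x‖ₑ ^ 2 ≤
      ∫⁻ t, ENNReal.ofReal (g t) * ‖f (x - t) - f x‖ₑ ^ 2 := by
    intro x
    have h1 : mollify g f x - f x = ∫ t, (f (x - t) - f x) * g t := by
      have h2 : f x = ∫ t, f x * (g t : ℂ) := by
        rw [integral_const_mul, integral_complex_ofReal, hg1]; simp
      rw [mollify_swap]
      conv_lhs => rw [h2]
      have hgC : Integrable fun t => (g t : ℂ) := hgi.ofReal
      rw [← integral_sub (hconv x) (hgC.const_mul _)]
      congr 1; ext t; ring
    rw [h1]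
    refine enorm_integral_sq_le hg hg0 hgi hg1 ?_
    exact ((hm.comp_measurable (measurable_const.sub measurable_id)).sub
      stronglyMeasurable_const).aestronglyMeasurable
  have hmeas : Measurable fun p : ℂ × ℂ =>
      ENNReal.ofReal (g p.2) * ‖f (p.1 - p.2) - f p.1‖ₑ ^ 2 := by
    have h1 : Measurable fun p : ℂ × ℂ => f (p.1 - p.2) :=
      hm.measurable.comp (measurable_fst.sub measurable_snd)
    have h2 : Measurable fun p : ℂ × ℂ => f p.1 := hm.measurable.comp measurable_fst
    exact ((hg.measurable.comp measurable_snd).ennreal_ofReal).mul ((h1.sub h2).enorm.pow_const 2)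
  calc ∫⁻ x, ‖mollify g f x - f x‖ₑ ^ 2
      ≤ ∫⁻ x, ∫⁻ t, ENNReal.ofReal (g t) * ‖f (x - t) - f x‖ₑ ^ 2 := lintegral_mono hpt
    _ = ∫⁻ t, ∫⁻ x, ENNReal.ofReal (g t) * ‖f (x - t) - f x‖ₑ ^ 2 :=
        lintegral_lintegral_swap hmeas.aemeasurable
    _ = ∫⁻ t, ENNReal.ofReal (g t) * eLpNorm (fun x => f (x - t) - f x) 2 volume ^ 2 := by
        refine lintegral_congr fun t => ?_
        rw [lintegral_const_mul' _ _ ENNReal.ofReal_ne_top, eLpNorm_two_sq]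
    _ ≤ ∫⁻ t, ENNReal.ofReal (g t) * ε ^ 2 := by
        refine lintegral_mono fun t => ?_
        by_cases ht : g t = 0
        · simp [ht]
        · gcongr; exact hε t ht
    _ = ε ^ 2 := by
        rw [lintegral_mul_const _ hg.measurable.ennreal_ofReal,
          ← ofReal_integral_eq_lintegral_ofReal hgi (ae_of_all _ hg0), hg1, ENNReal.ofReal_one,
          one_mul]

theorem mollify_contDiff {g : ℂ → ℝ} (hg : ContDiff ℝ ∞ g) (hc : HasCompactSupport g)
    {f : ℂ → ℂ} (hf : LocallyIntegrable f) : ContDiff ℝ ∞ (mollify g f) := by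
  rw [mollify_eq_convolution]
  exact HasCompactSupport.contDiff_convolution_right _
    (hc.comp_left (g := ((↑) : ℝ → ℂ)) (by simp)) hf (Complex.ofRealCLM.contDiff.comp hg)

/-- Mollification commutes with the weak derivative `∂/∂z̄`. -/
theorem wirtinger_mollify {g : ℂ → ℝ} (hg : ContDiff ℝ ∞ g) (hc : HasCompactSupport g)
    {f b : ℂ → ℂ} (hf : LocallyIntegrable f)
    (hw : ∀ χ : ℂ → ℂ, ContDiff ℝ ∞ χ → HasCompactSupport χ →
      ∫ z, f z * partialZBar χ z = -∫ z, b z * χ z) (x : ℂ) :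
    wirtinger Complex.I (mollify g f) x = mollify g b x := by
  set G : ℂ → ℂ := fun t => (g t : ℂ) with hG
  have hGs : ContDiff ℝ ∞ G := Complex.ofRealCLM.contDiff.comp hg
  have hGc : HasCompactSupport G := hc.comp_left (g := ((↑) : ℝ → ℂ)) (by simp)
  have hG1 : ContDiff ℝ 1 G := hGs.of_le (by exact_mod_cast le_top)
  have hd := hGc.hasFDerivAt_convolution_right (ContinuousLinearMap.mul ℝ ℂ) hf hG1 x
  have hcf : Continuous (fderiv ℝ G) := hGs.continuous_fderiv (by simp)
  have hd' : ∀ v, fderiv ℝ (mollify g f) x v = ∫ t, f t * fderiv ℝ G (x - t) v := by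
    intro v
    rw [mollify_eq_convolution, hd.fderiv,
      convolution_precompR_apply _ hf (hGc.fderiv ℝ) hcf]
    rfl
  have hint : ∀ v, Integrable fun t => f t * fderiv ℝ G (x - t) v := by
    intro v
    have h := HasCompactSupport.convolutionExists_right (μ := volume)
      (ContinuousLinearMap.mul ℝ ℂ) (f := f) (g := fun t => fderiv ℝ G t v)
      (hGc.fderiv_apply ℝ v) hf (hcf.clm_apply continuous_const) x
    simpa using h.integrable
  have hχs : ContDiff ℝ ∞ fun t => G (x - t) := hGs.comp (contDiff_const.sub contDiff_id)
  have hχc : HasCompactSupport fun t => G (x - t) :=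
    hGc.comp_homeomorph (Homeomorph.subLeft x)
  -- The reflected and translated kernel is the test function. Its reflection changes the sign of
  -- the derivative, which cancels the sign in the definition of a weak derivative.
  have key := hw _ hχs hχc
  have hpz : ∀ t, partialZBar (fun t => G (x - t)) t =
      -((fderiv ℝ G (x - t) 1 + Complex.I * fderiv ℝ G (x - t) Complex.I) / 2) := by
    intro t
    have h1 : HasFDerivAt (fun t : ℂ => x - t) (-ContinuousLinearMap.id ℝ ℂ) t :=
      (hasFDerivAt_id t).const_sub x
    have h2 : fderiv ℝ (fun t => G (x - t)) t = _ :=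
      ((hGs.differentiable (by simp) (x - t)).hasFDerivAt.comp t h1).fderiv
    simp only [partialZBar, h2]
    simp
    ring
  have e1 : ∫ z, f z * partialZBar (fun t => G (x - t)) z =
      -((∫ t, f t * fderiv ℝ G (x - t) 1) +
        Complex.I * ∫ t, f t * fderiv ℝ G (x - t) Complex.I) / 2 := by
    rw [← integral_const_mul, ← integral_add (hint 1) ((hint Complex.I).const_mul _),
      neg_div, ← integral_div, ← integral_neg]
    congr 1; ext t
    rw [hpz]
    ring
  rw [e1] at key
  simp only [wirtinger, hd']
  rw [mollify]
  linear_combination -key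

theorem tsupport_mollify_subset {g : ℂ → ℝ} {f : ℂ → ℂ} {K : Set ℂ} {δ : ℝ}
    (hg : ∀ t, δ ≤ ‖t‖ → g t = 0) (hf : ∀ z ∉ K, f z = 0) :
    tsupport (mollify g f) ⊆ Metric.cthickening δ K := by
  refine closure_minimal (fun x hx => ?_) Metric.isClosed_cthickening
  by_contra h
  refine hx ?_
  rw [mollify]
  refine integral_eq_zero_of_ae (ae_of_all _ fun t => ?_)
  by_cases ht : t ∈ K
  · have : δ ≤ ‖x - t‖ := by
      by_contra hlt
      push Not at hlt
      exact h (Metric.mem_cthickening_of_dist_le x t δ K ht (by rw [dist_eq_norm]; exact hlt.le))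
    simp [hg _ this]
  · simp [hf t ht]

/-- A compactly supported `L²` function with weak derivative `∂/∂z̄` in `L²` is approximated by
smooth functions supported in a fixed compact set. -/
theorem exists_smooth_approx {f b : ℂ → ℂ} (hf : MemLp f 2) (hb : MemLp b 2) {K U : Set ℂ}
    (hK : IsCompact K) (hU : IsOpen U) (hKU : K ⊆ U) (hfK : ∀ z ∉ K, f z = 0)
    (hw : ∀ χ : ℂ → ℂ, ContDiff ℝ ∞ χ → HasCompactSupport χ →
      ∫ z, f z * partialZBar χ z = -∫ z, b z * χ z) :
    ∃ K' : Set ℂ, IsCompact K' ∧ K' ⊆ U ∧ K ⊆ K' ∧ ∀ ε : ENNReal, 0 < ε →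
      ∃ F : ℂ → ℂ, ContDiff ℝ ∞ F ∧ tsupport F ⊆ K' ∧
        ∫⁻ x, ‖F x - f x‖ₑ ^ 2 ≤ ε ∧
        ∫⁻ x, ‖wirtinger Complex.I F x - b x‖ₑ ^ 2 ≤ ε := by
  obtain ⟨δ, hδ, hδU⟩ := hK.exists_cthickening_subset_open hU hKU
  refine ⟨Metric.cthickening δ K, hK.cthickening, hδU, Metric.self_subset_cthickening K, ?_⟩
  intro ε hε
  obtain ⟨η, hη, hηε⟩ : ∃ η : ENNReal, 0 < η ∧ η ^ 2 ≤ ε := by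
    -- The minimum with 1 ensures that the square is at most ε.
    refine ⟨min ε 1, lt_min hε one_pos, ?_⟩
    rw [sq]
    calc min ε 1 * min ε 1 ≤ ε * 1 := by gcongr <;> simp
      _ = ε := mul_one ε
  have ev := ((tendsto_eLpNorm_translate hf).eventually (eventually_le_nhds hη)).and
    ((tendsto_eLpNorm_translate hb).eventually (eventually_le_nhds hη))
  obtain ⟨r, hr, hball⟩ := Metric.eventually_nhds_iff.1 ev
  -- Radius at most r keeps the translates within η in L², and radius at most δ keeps the mollified
  -- function supported in the δ-thickening of `K`.
  set φ : ContDiffBump (0 : ℂ) := ⟨min r δ / 2, min r δ, by positivity, by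
    have : 0 < min r δ := lt_min hr hδ
    linarith⟩ with hφ
  set g : ℂ → ℝ := φ.normed volume with hg
  have hgs : ContDiff ℝ ∞ g := φ.contDiff_normed
  have hgc : HasCompactSupport g := φ.hasCompactSupport_normed
  have hg0 : ∀ t, 0 ≤ g t := φ.nonneg_normed
  have hg1 : ∫ t, g t = 1 := φ.integral_normed
  have hsupp : ∀ t, g t ≠ 0 → ‖t‖ < min r δ := by
    intro t ht
    have : t ∈ Function.support g := ht
    rw [hg, φ.support_normed_eq] at this
    simpa [hφ] using this
  refine ⟨mollify g f, mollify_contDiff hgs hgc (hf.locallyIntegrable (by norm_num)),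
    tsupport_mollify_subset (fun t ht => ?_) hfK, ?_, ?_⟩
  · by_contra h
    exact absurd (hsupp t h) (not_lt.2 ((min_le_right r δ).trans ht))
  · refine (lintegral_mollify_sub_le hf hgs.continuous hgc hg0 hg1 fun t ht => ?_).trans hηε
    exact (hball (by simpa using (hsupp t ht).trans_le (min_le_left _ _))).1
  · simp_rw [wirtinger_mollify hgs hgc (hf.locallyIntegrable (by norm_num)) hw]
    refine (lintegral_mollify_sub_le hb hgs.continuous hgc hg0 hg1 fun t ht => ?_).trans hηε
    exact (hball (by simpa using (hsupp t ht).trans_le (min_le_left _ _))).2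

end

section

variable {X : Type*} [TopologicalSpace X]

theorem eventually_symm_mem {e e' : OpenPartialHomeomorph X ℂ} {x : X} (hx : x ∈ e.source)
    (hx' : x ∈ e'.source) : ∀ᶠ z in 𝓝 (e' x), z ∈ e'.target ∧ e'.symm z ∈ e.source := by
  have h1 : e'.symm (e' x) ∈ e.source := by rwa [e'.left_inv hx']
  exact (e'.open_target.eventually_mem (e'.map_source hx')).and
    ((e'.continuousAt_symm (e'.map_source hx')).eventually (e.open_source.mem_nhds h1))

theorem deriv_transition_self {e : OpenPartialHomeomorph X ℂ} {x : X} (hx : x ∈ e.source) :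
    deriv (fun z => e (e.symm z)) (e x) = 1 := by
  refine (HasDerivAt.congr_of_eventuallyEq (hasDerivAt_id (e x)) ?_).deriv
  filter_upwards [e.open_target.eventually_mem (e.map_source hx)] with z hz
  simp [e.right_inv hz]

variable [ChartedSpace ℂ X]

/-! ### Coordinate changes -/

/-- The derivative at `x` of the change of coordinates from `e` to the preferred chart at `x`. -/
def transDeriv (e : OpenPartialHomeomorph X ℂ) (x : X) : ℂ :=
  deriv (fun z => chartAt ℂ x (e.symm z)) (e x)

theorem transDeriv_chartAt (x : X) : transDeriv (chartAt ℂ x) x = 1 :=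
  deriv_transition_self (mem_chart_source ℂ x)

/-- The coefficient in the chart `e` of the section of `E` with coefficients `u` in the frames of
the preferred charts, `E` being of degree `n`. -/
def secCoeff (n : ℕ) (e : OpenPartialHomeomorph X ℂ) (u : X → ℂ) (z : ℂ) : ℂ :=
  (transDeriv e (e.symm z))⁻¹ ^ n * u (e.symm z)

/-- The coefficient in the chart `e` of the `E`-valued `(0,1)`-form with coefficients `v` in the
frames of the preferred charts. -/
def frmCoeff (n : ℕ) (e : OpenPartialHomeomorph X ℂ) (v : X → ℂ) (z : ℂ) : ℂ :=
  conj (transDeriv e (e.symm z)) * (transDeriv e (e.symm z))⁻¹ ^ n * v (e.symm z)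

theorem secCoeff_chartAt (n : ℕ) (u : X → ℂ) (x : X) :
    secCoeff n (chartAt ℂ x) u (chartAt ℂ x x) = u x := by
  rw [secCoeff, (chartAt ℂ x).left_inv (mem_chart_source ℂ x), transDeriv_chartAt]
  simp

theorem frmCoeff_chartAt (n : ℕ) (v : X → ℂ) (x : X) :
    frmCoeff n (chartAt ℂ x) v (chartAt ℂ x x) = v x := by
  rw [frmCoeff, (chartAt ℂ x).left_inv (mem_chart_source ℂ x), transDeriv_chartAt]
  simp

section Transition

variable [IsManifold 𝓘(ℂ) ω X]

theorem analyticAt_transition {e e' : OpenPartialHomeomorph X ℂ} (he : e ∈ atlas ℂ X)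
    (he' : e' ∈ atlas ℂ X) {x : X} (hx : x ∈ e.source) (hx' : x ∈ e'.source) :
    AnalyticAt ℂ (fun z => e (e'.symm z)) (e' x) := by
  have h := (contDiffGroupoid ω 𝓘(ℂ)).compatible he' he
  rw [contDiffGroupoid, mem_groupoid_of_pregroupoid, contDiffPregroupoid] at h
  have h1 : ContDiffOn ℂ ω (fun z => e (e'.symm z)) (e'.symm ≫ₕ e).source := by
    simpa [Function.comp_def] using h.1
  have hmem : e' x ∈ (e'.symm ≫ₕ e).source := by
    simp [hx, hx']
  have h2 := h1.contDiffAt ((e'.symm ≫ₕ e).open_source.mem_nhds hmem)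
  rw [← contDiffWithinAt_univ, contDiffWithinAt_omega_iff_analyticWithinAt,
    analyticWithinAt_univ] at h2
  exact h2

/-- The chain rule as a cocycle relation; the transformation laws of sections, forms and densities
all come from it. -/
theorem deriv_transition_mul {e e' e'' : OpenPartialHomeomorph X ℂ} (he : e ∈ atlas ℂ X)
    (he' : e' ∈ atlas ℂ X) (he'' : e'' ∈ atlas ℂ X) {x : X} (hx : x ∈ e.source)
    (hx' : x ∈ e'.source) (hx'' : x ∈ e''.source) :
    deriv (fun z => e'' (e'.symm z)) (e' x) =
      deriv (fun z => e'' (e.symm z)) (e x) * deriv (fun z => e (e'.symm z)) (e' x) := by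
  have h1 := (analyticAt_transition he he' hx hx').differentiableAt.hasDerivAt
  have h2 := (analyticAt_transition he'' he hx'' hx).differentiableAt.hasDerivAt
  have h3 : e (e'.symm (e' x)) = e x := by rw [e'.left_inv hx']
  rw [← h3] at h2
  have h4 := h2.comp (e' x) h1
  rw [h3] at h4
  refine (HasDerivAt.congr_of_eventuallyEq h4 ?_).deriv
  filter_upwards [eventually_symm_mem hx hx'] with z hz
  simp only [Function.comp_apply]
  rw [e.left_inv hz.2]

theorem transDeriv_mul_deriv {e e' : OpenPartialHomeomorph X ℂ} (he : e ∈ atlas ℂ X)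
    (he' : e' ∈ atlas ℂ X) {x : X} (hx : x ∈ e.source) (hx' : x ∈ e'.source) :
    transDeriv e x * deriv (fun z => e (e'.symm z)) (e' x) = transDeriv e' x :=
  (deriv_transition_mul he he' (chart_mem_atlas ℂ x) hx hx' (mem_chart_source ℂ x)).symm

theorem deriv_chartAt_transition_mul {e : OpenPartialHomeomorph X ℂ} (he : e ∈ atlas ℂ X) {x : X}
    (hx : x ∈ e.source) :
    transDeriv e x * deriv (fun z => e ((chartAt ℂ x).symm z)) (chartAt ℂ x x) = 1 := by
  rw [transDeriv_mul_deriv he (chart_mem_atlas ℂ x) hx (mem_chart_source ℂ x),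
    transDeriv_chartAt]

theorem transDeriv_ne_zero {e : OpenPartialHomeomorph X ℂ} (he : e ∈ atlas ℂ X) {x : X}
    (hx : x ∈ e.source) : transDeriv e x ≠ 0 := by
  intro h
  have := deriv_chartAt_transition_mul he hx
  rw [h, zero_mul] at this
  exact zero_ne_one this

theorem deriv_chartAt_transition {e : OpenPartialHomeomorph X ℂ} (he : e ∈ atlas ℂ X) {x : X}
    (hx : x ∈ e.source) :
    deriv (fun z => e ((chartAt ℂ x).symm z)) (chartAt ℂ x x) = (transDeriv e x)⁻¹ :=
  (inv_eq_of_mul_eq_one_right (deriv_chartAt_transition_mul he hx)).symm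

/-! ### The frames in terms of the preferred charts -/

/-- The tangent space at x is the model ℂ, identified through the preferred chart at x; the
differential of `e` is therefore the derivative of the transition from that chart to `e`. -/
theorem dz_apply {e : OpenPartialHomeomorph X ℂ} (he : e ∈ atlas ℂ X) {x : X}
    (hx : x ∈ e.source) (v : ℂ) : dz e x v = (transDeriv e x)⁻¹ * v := by
  have hm : MDifferentiableAt 𝓘(ℂ) 𝓘(ℂ) e x :=
    ((contMDiffOn_of_mem_maximalAtlas (n := ω)
      (IsManifold.subset_maximalAtlas he)).contMDiffAt
        (e.open_source.mem_nhds hx)).mdifferentiableAt (by simp)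
  have h1 : mfderiv 𝓘(ℂ) 𝓘(ℂ) e x =
      fderiv ℂ (fun z => e ((chartAt ℂ x).symm z)) (chartAt ℂ x x) := by
    refine hm.mfderiv.trans ?_
    simp [writtenInExtChartAt, Function.comp_def, fderivWithin_univ]
    rfl
  have h2 : dz e x v = fderiv ℂ (fun z => e ((chartAt ℂ x).symm z)) (chartAt ℂ x x) v :=
    congrArg (fun L : ℂ →L[ℂ] ℂ => L v) h1
  rw [h2, ← deriv_chartAt_transition he hx, fderiv_eq_smul_deriv, smul_eq_mul, mul_comm]

theorem mdifferentiableAt_symm {e : OpenPartialHomeomorph X ℂ} (he : e ∈ atlas ℂ X) {z : ℂ}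
    (hz : z ∈ e.target) : MDifferentiableAt 𝓘(ℂ) 𝓘(ℂ) e.symm z :=
  ((contMDiffOn_symm_of_mem_maximalAtlas (n := ω)
    (IsManifold.subset_maximalAtlas he)).contMDiffAt
      (e.open_target.mem_nhds hz)).mdifferentiableAt (by simp)

theorem mem_maximalAtlas_real {e : OpenPartialHomeomorph X ℂ} (he : e ∈ atlas ℂ X)
    (n : WithTop ℕ∞) : e ∈ IsManifold.maximalAtlas 𝓘(ℝ, ℂ) n X :=
  IsManifold.maximalAtlas_subset_of_le le_top
    (IsManifold.subset_maximalAtlas (I := 𝓘(ℝ, ℂ)) (n := ω) he)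

theorem contMDiffOn_symm_real {e : OpenPartialHomeomorph X ℂ} (he : e ∈ atlas ℂ X)
    (n : WithTop ℕ∞) : ContMDiffOn 𝓘(ℝ, ℂ) 𝓘(ℝ, ℂ) n e.symm e.target :=
  contMDiffOn_symm_of_mem_maximalAtlas (mem_maximalAtlas_real he n)

theorem partialZ_eq {e : OpenPartialHomeomorph X ℂ} (he : e ∈ atlas ℂ X) {z : ℂ}
    (hz : z ∈ e.target) : partialZ e z = (transDeriv e (e.symm z) : ℂ) := by
  have h1 : mfderiv 𝓘(ℂ) 𝓘(ℂ) e.symm z =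
      fderiv ℂ (fun w => chartAt ℂ (e.symm z) (e.symm w)) z := by
    refine (mdifferentiableAt_symm he hz).mfderiv.trans ?_
    simp [writtenInExtChartAt, Function.comp_def, fderivWithin_univ]
    rfl
  have h2 : partialZ e z = (fderiv ℂ (fun w => chartAt ℂ (e.symm z) (e.symm w)) z 1 : ℂ) :=
    congrArg (fun L : ℂ →L[ℂ] ℂ => L 1) h1
  rw [h2, transDeriv, e.right_inv hz]
  rfl

theorem mfderiv_real_symm_one {e : OpenPartialHomeomorph X ℂ} (he : e ∈ atlas ℂ X) {z : ℂ}
    (hz : z ∈ e.target) :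
    (mfderiv 𝓘(ℝ, ℂ) 𝓘(ℝ, ℂ) e.symm z (1 : ℂ) : ℂ) = (transDeriv e (e.symm z) : ℂ) := by
  have hm : MDifferentiableAt 𝓘(ℝ, ℂ) 𝓘(ℝ, ℂ) e.symm z :=
    ((contMDiffOn_symm_real he 1).contMDiffAt
      (e.open_target.mem_nhds hz)).mdifferentiableAt (by simp)
  have h1 : mfderiv 𝓘(ℝ, ℂ) 𝓘(ℝ, ℂ) e.symm z =
      fderiv ℝ (fun w => chartAt ℂ (e.symm z) (e.symm w)) z := by
    refine hm.mfderiv.trans ?_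
    simp [writtenInExtChartAt, Function.comp_def, fderivWithin_univ]
    rfl
  have h2 : (mfderiv 𝓘(ℝ, ℂ) 𝓘(ℝ, ℂ) e.symm z (1 : ℂ) : ℂ) =
      (fderiv ℝ (fun w => chartAt ℂ (e.symm z) (e.symm w)) z 1 : ℂ) :=
    congrArg (fun L : ℂ →L[ℝ] ℂ => L 1) h1
  have h3 := (analyticAt_transition (chart_mem_atlas ℂ (e.symm z)) he
    (mem_chart_source ℂ (e.symm z)) (e.map_target hz)).differentiableAt
  rw [e.right_inv hz] at h3
  have h4 := (h3.hasDerivAt.hasFDerivAt.restrictScalars ℝ).fderiv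
  rw [h2, h4, transDeriv, e.right_inv hz]
  exact one_mul (deriv (fun w => chartAt ℂ (e.symm z) (e.symm w)) z)

/-- The coefficient of `ψ` at `x` in the frame of the preferred chart at `x`. -/
def baseSection {k : ℕ} (ψ : ∀ x : X, EFibre k x) (x : X) : ℂ :=
  frameCoeff k (chartAt ℂ x) x (ψ x)

/-- The coefficient of `β` at `x` in the frame of the preferred chart at `x`. -/
def baseForm {k : ℕ} (β : ∀ x : X, EForm01Fibre k x) (x : X) : ℂ :=
  frameCoeff k (chartAt ℂ x) x (β x (1 : ℂ))

/-- It suffices to compare the two linear maps on pure tensors, where each of the k - 1 factors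
contributes one inverse of `transDeriv`. -/
theorem frameCoeff_eq {k : ℕ} {e : OpenPartialHomeomorph X ℂ} (he : e ∈ atlas ℂ X) {x : X}
    (hx : x ∈ e.source) (t : EFibre k x) :
    frameCoeff k e x t = (transDeriv e x)⁻¹ ^ (k - 1) * frameCoeff k (chartAt ℂ x) x t := by
  have h : frameCoeff k e x =
      (transDeriv e x)⁻¹ ^ (k - 1) • frameCoeff k (chartAt ℂ x) x := by
    refine PiTensorProduct.ext (MultilinearMap.ext fun v => ?_)
    have h1 : ∀ i, dz e x (v i) = (transDeriv e x)⁻¹ * dz (chartAt ℂ x) x (v i) := by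
      intro i
      have ha := dz_apply he hx (v i)
      have hb : ∀ w : ℂ, dz (chartAt ℂ x) x w = w := fun w => by
        rw [dz_apply (chart_mem_atlas ℂ x) (mem_chart_source ℂ x), transDeriv_chartAt]
        simp
      exact ha.trans (congrArg _ (hb (v i)).symm)
    simp [frameCoeff, h1, Finset.prod_mul_distrib]
  rw [h]
  rfl

theorem sectionCoeff_eq {k : ℕ} {e : OpenPartialHomeomorph X ℂ} (he : e ∈ atlas ℂ X)
    (ψ : ∀ x : X, EFibre k x) {z : ℂ} (hz : z ∈ e.target) :
    sectionCoeff e ψ z = secCoeff (k - 1) e (baseSection ψ) z :=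
  frameCoeff_eq he (e.map_target hz) _

theorem formCoeff_eq {k : ℕ} {e : OpenPartialHomeomorph X ℂ} (he : e ∈ atlas ℂ X)
    (β : ∀ x : X, EForm01Fibre k x) {z : ℂ} (hz : z ∈ e.target) :
    formCoeff e β z = frmCoeff (k - 1) e (baseForm β) z := by
  -- The vector ∂/∂z is `transDeriv` times the basis vector 1, and antilinearity of β brings the
  -- factor out conjugated.
  have h1 : β (e.symm z) (partialZ e z) =
      conj (transDeriv e (e.symm z)) • β (e.symm z) (1 : ℂ) := by
    rw [partialZ_eq he hz]
    have := (β (e.symm z)).map_smulₛₗ (transDeriv e (e.symm z)) (1 : ℂ)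
    rw [← this]
    congr 1
    exact (mul_one (transDeriv e (e.symm z))).symm
  rw [formCoeff, h1, map_smul, frameCoeff_eq he (e.map_target hz), frmCoeff, baseForm, smul_eq_mul]
  ring

theorem secCoeff_transition (n : ℕ) (u : X → ℂ) {e e' : OpenPartialHomeomorph X ℂ}
    (he : e ∈ atlas ℂ X) (he' : e' ∈ atlas ℂ X) {z : ℂ} (hz : z ∈ e'.target)
    (hz' : e'.symm z ∈ e.source) :
    secCoeff n e' u z =
      (deriv (fun w => e (e'.symm w)) z)⁻¹ ^ n * secCoeff n e u (e (e'.symm z)) := by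
  have h := transDeriv_mul_deriv he he' hz' (e'.map_target hz)
  rw [e'.right_inv hz] at h
  rw [secCoeff, secCoeff, e.left_inv hz', ← h, mul_inv, mul_pow]
  ring

/-! ### Densities -/

namespace ConformalMetric

variable (g : ConformalMetric X)

/-- The density of `g` at `x` in the preferred chart at `x`. -/
def baseDensity (x : X) : ℝ := g.inner x (1 : ℂ) (1 : ℂ)

theorem baseDensity_pos (x : X) : 0 < g.baseDensity x :=
  g.pos x (1 : ℂ) (one_ne_zero (α := ℂ))

/-- Invariance under multiplication by i, applied to 1, makes 1 and i equally long; applied to 1 +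
i, it makes them orthogonal. -/
theorem inner_self_eq (x : X) (v : ℂ) : g.inner x v v = ‖v‖ ^ 2 * g.baseDensity x := by
  set B : ℂ →L[ℝ] ℂ →L[ℝ] ℝ := g.inner x with hB
  have hs : ∀ v w, B v w = B w v := g.symm x
  have hc : ∀ v, B (Complex.I * v) (Complex.I * v) = B v v := g.conformal x
  have hv : v = v.re • (1 : ℂ) + v.im • Complex.I := by simp [Complex.re_add_im]
  have h1 : B Complex.I Complex.I = B 1 1 := by simpa using hc 1
  have h2 : B 1 Complex.I = 0 := by
    have := hc (1 + Complex.I)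
    rw [mul_add, mul_one, Complex.I_mul_I] at this
    simp only [map_add, add_apply, map_neg, neg_apply] at this
    rw [hs Complex.I 1, h1] at this
    linarith
  have h3 : B v v = ‖v‖ ^ 2 * B 1 1 := by
    conv_lhs => rw [hv]
    simp only [map_add, add_apply, map_smul, smul_apply, smul_eq_mul]
    rw [hs Complex.I 1, h1, h2, ← Complex.normSq_eq_norm_sq, Complex.normSq_apply]
    ring
  exact h3

theorem density_eq {e : OpenPartialHomeomorph X ℂ} (he : e ∈ atlas ℂ X) {z : ℂ}
    (hz : z ∈ e.target) :
    g.density e z = ‖transDeriv e (e.symm z)‖ ^ 2 * g.baseDensity (e.symm z) := by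
  rw [← inner_self_eq, ← mfderiv_real_symm_one he hz]
  rfl

theorem density_pos {e : OpenPartialHomeomorph X ℂ} (he : e ∈ atlas ℂ X) {z : ℂ}
    (hz : z ∈ e.target) : 0 < g.density e z := by
  rw [g.density_eq he hz]
  have := transDeriv_ne_zero he (e.map_target hz)
  have := g.baseDensity_pos (e.symm z)
  positivity

theorem density_chartAt (x : X) :
    g.density (chartAt ℂ x) (chartAt ℂ x x) = g.baseDensity x := by
  rw [g.density_eq (chart_mem_atlas ℂ x) (mem_chart_target ℂ x),
    (chartAt ℂ x).left_inv (mem_chart_source ℂ x), transDeriv_chartAt]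
  simp

theorem density_transition {e e' : OpenPartialHomeomorph X ℂ}
    (he : e ∈ atlas ℂ X) (he' : e' ∈ atlas ℂ X) {z : ℂ} (hz : z ∈ e'.target)
    (hz' : e'.symm z ∈ e.source) :
    g.density e' z =
      ‖deriv (fun w => e (e'.symm w)) z‖ ^ 2 * g.density e (e (e'.symm z)) := by
  have h := transDeriv_mul_deriv he he' hz' (e'.map_target hz)
  rw [e'.right_inv hz] at h
  rw [g.density_eq he' hz, g.density_eq he (e.map_source hz'), e.left_inv hz', ← h, norm_mul]
  ring

/-- The field ∂/∂x is the tangent map of `e.symm` along the constant field 1, hence smooth, and the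
metric is a smooth family of bilinear forms evaluated on it. -/
theorem density_contDiffOn {e : OpenPartialHomeomorph X ℂ} (he : e ∈ atlas ℂ X) :
    ContDiffOn ℝ ∞ (g.density e) e.target := by
  rw [← contMDiffOn_iff_contDiffOn]
  have hs := contMDiffOn_symm_real he (∞ + 1)
  have ht : ContMDiffOn 𝓘(ℝ, ℂ) 𝓘(ℝ, ℂ).tangent ∞
      (fun z => (⟨e.symm z, mfderiv 𝓘(ℝ, ℂ) 𝓘(ℝ, ℂ) e.symm z (1 : ℂ)⟩ :
        TangentBundle 𝓘(ℝ, ℂ) X)) e.target := by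
    have h1 := hs.contMDiffOn_tangentMapWithin le_rfl e.open_target.uniqueMDiffOn
    have h2 : ContMDiffOn 𝓘(ℝ, ℂ) 𝓘(ℝ, ℂ).tangent ∞
        (fun z => (⟨z, (1 : ℂ)⟩ : TangentBundle 𝓘(ℝ, ℂ) ℂ)) e.target :=
      contMDiffOn_vectorSpace_iff_contDiffOn.2
        (contDiffOn_const : ContDiffOn ℝ ∞ (fun _ : ℂ => (1 : ℂ)) e.target)
    refine (h1.comp h2 fun z hz => hz).congr fun z hz => ?_
    simp only [Function.comp_apply, tangentMapWithin]
    rw [mfderivWithin_of_isOpen e.open_target hz]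
  intro z hz
  have hv := ht z hz
  have h : ContMDiffWithinAt 𝓘(ℝ, ℂ) (𝓘(ℝ, ℂ).prod 𝓘(ℝ)) ∞
      (fun z => Bundle.TotalSpace.mk' ℝ (E := Bundle.Trivial X ℝ) (e.symm z) (g.density e z))
      e.target z := by
    apply ContMDiffWithinAt.clm_bundle_apply₂ (F₁ := ℂ) (F₂ := ℂ)
      (E₁ := fun x : X => TangentSpace 𝓘(ℝ, ℂ) x) (E₂ := fun x : X => TangentSpace 𝓘(ℝ, ℂ) x)
    · exact g.contMDiff.contMDiffAt.comp_contMDiffWithinAt z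
        ((hs.of_le (by simp)) z hz)
    · exact hv
    · exact hv
  simp only [Bundle.contMDiffWithinAt_totalSpace] at h
  exact h.2

end ConformalMetric

end Transition

end

section

/-! ### The area measure -/

/-- The determinant of multiplication by a is the algebra norm of ℂ over ℝ. It is the Jacobian of a
transition map. -/
theorem abs_det_toSpanSingleton (a : ℂ) :
    |((ContinuousLinearMap.toSpanSingleton ℂ a).restrictScalars ℝ).det| = ‖a‖ ^ 2 := by
  have h : (((ContinuousLinearMap.toSpanSingleton ℂ a).restrictScalars ℝ : ℂ →L[ℝ] ℂ) :
      ℂ →ₗ[ℝ] ℂ) = LinearMap.mul ℝ ℂ a := by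
    ext
    simp [mul_comm]
  rw [ContinuousLinearMap.det, h]
  have : LinearMap.det (LinearMap.mul ℝ ℂ a) = Complex.normSq a := by
    rw [← Algebra.norm_complex_apply, Algebra.norm_apply]; rfl
  rw [this, abs_of_nonneg (Complex.normSq_nonneg a), Complex.normSq_eq_norm_sq]

variable {X : Type*} [TopologicalSpace X]

theorem aemeasurable_chart_symm [MeasurableSpace X] [BorelSpace X] {e : OpenPartialHomeomorph X ℂ} :
    AEMeasurable e.symm (volume.restrict e.target) :=
  e.continuousOn_symm.aemeasurable e.open_target.measurableSet

/-- Since `e.symm` is continuous only on the target, measurability is obtained on the subtype and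
pushed forward. -/
theorem measurableSet_target_inter_preimage [MeasurableSpace X] [BorelSpace X]
    (e : OpenPartialHomeomorph X ℂ) {s : Set X} (hs : MeasurableSet s) :
    MeasurableSet (e.target ∩ e.symm ⁻¹' s) := by
  have : e.target ∩ e.symm ⁻¹' s = Subtype.val '' (e.target.domRestrict e.symm ⁻¹' s) := by
    ext z
    simp [Set.domRestrict, and_comm]
  rw [this]
  exact e.open_target.measurableSet.subtype_image
    ((e.continuousOn_symm.domRestrict).measurable hs)

theorem image_transition {e e' : OpenPartialHomeomorph X ℂ} {s : Set X}
    (hs : s ⊆ e.source) (hs' : s ⊆ e'.source) :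
    (fun z => e (e'.symm z)) '' (e'.target ∩ e'.symm ⁻¹' s) = e.target ∩ e.symm ⁻¹' s := by
  ext z
  constructor
  · rintro ⟨w, ⟨-, hws⟩, rfl⟩
    refine ⟨e.map_source (hs hws), ?_⟩
    rw [Set.mem_preimage, e.left_inv (hs hws)]
    exact hws
  · rintro ⟨hz, hzs⟩
    refine ⟨e' (e.symm z), ⟨e'.map_source (hs' hzs), ?_⟩, ?_⟩
    · rw [Set.mem_preimage, e'.left_inv (hs' hzs)]
      exact hzs
    · simp only
      rw [e'.left_inv (hs' hzs), e.right_inv hz]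

variable [ChartedSpace ℂ X] [IsManifold 𝓘(ℂ) ω X]

namespace ConformalMetric

variable (g : ConformalMetric X)

/-- The area measure of `g` on the target of the chart `e`. -/
def targetArea (e : OpenPartialHomeomorph X ℂ) : Measure ℂ :=
  (volume.restrict e.target).withDensity fun z => ENNReal.ofReal (g.density e z)

theorem targetArea_absolutelyContinuous (e : OpenPartialHomeomorph X ℂ) :
    g.targetArea e ≪ volume.restrict e.target :=
  withDensity_absolutelyContinuous _ _

theorem aemeasurable_density {e : OpenPartialHomeomorph X ℂ} (he : e ∈ atlas ℂ X) :
    AEMeasurable (fun z => ENNReal.ofReal (g.density e z)) (volume.restrict e.target) :=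
  ((g.density_contDiffOn he).continuousOn.aemeasurable e.open_target.measurableSet).ennreal_ofReal

variable [MeasurableSpace X]

theorem chartArea_eq (e : OpenPartialHomeomorph X ℂ) :
    g.chartArea e = (g.targetArea e).map e.symm := rfl

variable [BorelSpace X]

theorem aemeasurable_symm_targetArea {e : OpenPartialHomeomorph X ℂ} :
    AEMeasurable e.symm (g.targetArea e) :=
  aemeasurable_chart_symm.mono_ac (g.targetArea_absolutelyContinuous e)

theorem chartArea_apply {e : OpenPartialHomeomorph X ℂ} {s : Set X} (hs : MeasurableSet s) :
    g.chartArea e s =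
      ∫⁻ z in e.target ∩ e.symm ⁻¹' s, ENNReal.ofReal (g.density e z) := by
  have hn : NullMeasurableSet (e.symm ⁻¹' s) (volume.restrict e.target) :=
    aemeasurable_chart_symm.nullMeasurable hs
  rw [chartArea_eq, Measure.map_apply_of_aemeasurable g.aemeasurable_symm_targetArea hs,
    targetArea, withDensity_apply₀ _ hn, Measure.restrict_restrict₀ hn, Set.inter_comm]

/-- The density picks up |τ'|² under a change of chart, exactly the Jacobian in the change of
variables formula. -/
theorem chartArea_eq_of_subset {e e' : OpenPartialHomeomorph X ℂ} (he : e ∈ atlas ℂ X)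
    (he' : e' ∈ atlas ℂ X) {s : Set X} (hs : MeasurableSet s) (hse : s ⊆ e.source)
    (hse' : s ⊆ e'.source) : g.chartArea e s = g.chartArea e' s := by
  have hm := measurableSet_target_inter_preimage e' hs
  rw [g.chartArea_apply hs, g.chartArea_apply hs, ← image_transition hse hse',
    lintegral_image_eq_lintegral_abs_det_fderiv_mul volume hm
      (f' := fun z => (ContinuousLinearMap.toSpanSingleton ℂ
        (deriv (fun w => e (e'.symm w)) z)).restrictScalars ℝ)]
  · refine setLIntegral_congr_fun hm fun z hz => ?_
    rw [abs_det_toSpanSingleton, g.density_transition he he' hz.1 (hse hz.2),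
      ENNReal.ofReal_mul (by positivity)]
  · intro z hz
    have h := (analyticAt_transition he he' (hse hz.2) (hse' hz.2)).differentiableAt
    rw [e'.right_inv hz.1] at h
    exact (h.hasDerivAt.hasFDerivAt.restrictScalars ℝ).hasFDerivWithinAt
  · intro z hz w hw h
    have h1 : e'.symm z = e'.symm w := e.injOn (hse hz.2) (hse hw.2) h
    exact e'.symm.injOn hz.1 hw.1 h1

theorem chartArea_compl {e : OpenPartialHomeomorph X ℂ} : g.chartArea e e.sourceᶜ = 0 := by
  rw [g.chartArea_apply e.open_source.measurableSet.compl]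
  have : e.target ∩ e.symm ⁻¹' e.sourceᶜ = ∅ := by
    ext z
    simp only [Set.mem_inter_iff, Set.mem_preimage, Set.mem_compl_iff, Set.mem_empty_iff_false,
      iff_false, not_and, not_not]
    exact fun hz => e.map_target hz
  rw [this, Measure.restrict_empty, lintegral_zero_measure]

/-- The restriction of the area measure to the domain of a chart is the area measure of the
chart. -/
theorem area_restrict {e : OpenPartialHomeomorph X ℂ} (he : e ∈ atlas ℂ X) :
    g.area.restrict e.source = g.chartArea e := by
  have hms : MeasurableSet e.source := e.open_source.measurableSet
  refine le_antisymm ?_ ?_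
  -- A bound on a supremum of measures need only be checked on each member: inside the domain of `e`
  -- every chart area agrees with that of `e` on the overlap, and outside it is at most the area.
  · have h1 : g.area ≤ g.chartArea e + g.area.restrict e.sourceᶜ := by
      refine iSup₂_le fun e' he' => Measure.le_iff.2 fun s hs => ?_
      rw [← measure_inter_add_sdiff s hms, Measure.add_apply, Measure.restrict_apply hs]
      refine add_le_add ?_ ?_
      · calc g.chartArea e' (s ∩ e.source)
            ≤ g.chartArea e' (s ∩ e.source ∩ e'.source) + g.chartArea e' e'.sourceᶜ := by
              rw [← measure_inter_add_sdiff (s ∩ e.source) e'.open_source.measurableSet]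
              gcongr
              exact fun x hx => hx.2
          _ = g.chartArea e (s ∩ e.source ∩ e'.source) := by
              rw [g.chartArea_compl, add_zero, g.chartArea_eq_of_subset he' he
                ((hs.inter hms).inter e'.open_source.measurableSet) (fun x hx => hx.2)
                (fun x hx => hx.1.2)]
          _ ≤ g.chartArea e s := measure_mono fun x hx => hx.1.1
      · have : g.chartArea e' ≤ g.area := le_iSup₂ (f := fun e _ => g.chartArea e) e' he'
        exact this _
    calc g.area.restrict e.source
        ≤ (g.chartArea e + g.area.restrict e.sourceᶜ).restrict e.source :=
          Measure.restrict_mono le_rfl h1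
      _ = (g.chartArea e).restrict e.source := by
          rw [Measure.restrict_add, Measure.restrict_restrict hms, Set.inter_compl_self]
          simp
      _ ≤ g.chartArea e := Measure.restrict_le_self
  · have h2 : (g.chartArea e).restrict e.source = g.chartArea e :=
      Measure.restrict_eq_self_of_ae_mem (mem_ae_iff.2 g.chartArea_compl)
    have : g.chartArea e ≤ g.area := le_iSup₂ (f := fun e _ => g.chartArea e) e he
    rw [← h2]
    exact Measure.restrict_mono le_rfl this

theorem aemeasurable_chart {e : OpenPartialHomeomorph X ℂ} :
    AEMeasurable e (g.area.restrict e.source) :=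
  e.continuousOn.aemeasurable e.open_source.measurableSet

theorem map_area_restrict {e : OpenPartialHomeomorph X ℂ} (he : e ∈ atlas ℂ X) :
    (g.area.restrict e.source).map e = g.targetArea e := by
  have h := g.aemeasurable_chart (e := e)
  rw [g.area_restrict he, chartArea_eq] at h ⊢
  rw [AEMeasurable.map_map_of_aemeasurable h g.aemeasurable_symm_targetArea]
  have h1 : e ∘ e.symm =ᵐ[g.targetArea e] id := by
    refine (g.targetArea_absolutelyContinuous e).ae_le ?_
    filter_upwards [ae_restrict_mem e.open_target.measurableSet] with z hz
    exact e.right_inv hz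
  rw [Measure.map_congr h1, Measure.map_id]

/-! ### Transfer of measurability, null sets and integrals between X and a chart. -/

variable {E : Type*} [NormedAddCommGroup E]

theorem aestronglyMeasurable_of_chart {e : OpenPartialHomeomorph X ℂ} (he : e ∈ atlas ℂ X)
    {F : X → E} {G : ℂ → E} (hG : AEStronglyMeasurable G (volume.restrict e.target))
    (hFG : ∀ x ∈ e.source, F x = G (e x)) :
    AEStronglyMeasurable F (g.area.restrict e.source) := by
  have h1 : AEStronglyMeasurable G ((g.area.restrict e.source).map e) := by
    rw [g.map_area_restrict he]
    exact hG.mono_ac (g.targetArea_absolutelyContinuous e)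
  refine (h1.comp_aemeasurable g.aemeasurable_chart).congr ?_
  filter_upwards [ae_restrict_mem e.open_source.measurableSet] with x hx
  exact (hFG x hx).symm

theorem ae_restrict_of_chart {e : OpenPartialHomeomorph X ℂ} (he : e ∈ atlas ℂ X)
    {p : X → Prop} {q : ℂ → Prop} (hq : ∀ᵐ z ∂volume.restrict e.target, q z)
    (hpq : ∀ x ∈ e.source, q (e x) → p x) : ∀ᵐ x ∂g.area.restrict e.source, p x := by
  have h1 : ∀ᵐ z ∂(g.area.restrict e.source).map e, q z := by
    rw [g.map_area_restrict he]
    exact (g.targetArea_absolutelyContinuous e).ae_le hq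
  filter_upwards [ae_of_ae_map g.aemeasurable_chart h1,
    ae_restrict_mem e.open_source.measurableSet] with x hx hxe
  exact hpq x hxe hx

variable [NormedSpace ℝ E]

theorem setIntegral_area {e : OpenPartialHomeomorph X ℂ} (he : e ∈ atlas ℂ X)
    {F : X → E} {G : ℂ → E} (hG : AEStronglyMeasurable G (volume.restrict e.target))
    (hFG : ∀ x ∈ e.source, F x = G (e x)) :
    ∫ x in e.source, F x ∂g.area = ∫ z in e.target, g.density e z • G z := by
  have h1 : AEStronglyMeasurable G ((g.area.restrict e.source).map e) := by
    rw [g.map_area_restrict he]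
    exact hG.mono_ac (g.targetArea_absolutelyContinuous e)
  rw [setIntegral_congr_fun e.open_source.measurableSet hFG,
    ← integral_map g.aemeasurable_chart h1, g.map_area_restrict he, targetArea,
    integral_withDensity_eq_integral_toReal_smul₀ (g.aemeasurable_density he)
      (ae_of_all _ fun _ => ENNReal.ofReal_lt_top)]
  refine setIntegral_congr_fun e.open_target.measurableSet fun z hz => ?_
  rw [ENNReal.toReal_ofReal (g.density_pos he hz).le]

theorem integrableOn_area_iff {e : OpenPartialHomeomorph X ℂ} (he : e ∈ atlas ℂ X)
    {F : X → E} {G : ℂ → E} (hG : AEStronglyMeasurable G (volume.restrict e.target))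
    (hFG : ∀ x ∈ e.source, F x = G (e x)) :
    IntegrableOn F e.source g.area ↔ IntegrableOn (fun z => g.density e z • G z) e.target := by
  have h1 : AEStronglyMeasurable G ((g.area.restrict e.source).map e) := by
    rw [g.map_area_restrict he]
    exact hG.mono_ac (g.targetArea_absolutelyContinuous e)
  rw [integrableOn_congr_fun hFG e.open_source.measurableSet, IntegrableOn,
    show (fun x => G (e x)) = G ∘ e from rfl, ← integrable_map_measure h1 g.aemeasurable_chart,
    g.map_area_restrict he, targetArea,
    integrable_withDensity_iff_integrable_smul₀' (g.aemeasurable_density he)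
      (ae_of_all _ fun _ => ENNReal.ofReal_lt_top)]
  refine integrableOn_congr_fun (fun z hz => ?_) e.open_target.measurableSet
  rw [ENNReal.toReal_ofReal (g.density_pos he hz).le]

end ConformalMetric

end

section

/-! ### The weights of `E` and their curvature -/

variable {X : Type*} [TopologicalSpace X] [ChartedSpace ℂ X] [IsManifold 𝓘(ℂ) ω X]

theorem contDiffOn_comp_symm {φ : X → ℝ} (hφ : ContMDiff 𝓘(ℝ, ℂ) 𝓘(ℝ, ℝ) ∞ φ)
    {e : OpenPartialHomeomorph X ℂ} (he : e ∈ atlas ℂ X) :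
    ContDiffOn ℝ ∞ (fun z => φ (e.symm z)) e.target := by
  rw [← contMDiffOn_iff_contDiffOn]
  exact hφ.comp_contMDiffOn (contMDiffOn_symm_real he ∞)

namespace ConformalMetric

variable (g : ConformalMetric X) (n : ℕ) (φ : X → ℝ)

/-- The coefficient in the chart `e` of the Hermitian metric on the `n`-th power of the tangent
bundle that is induced by `e^{2φ} g`. -/
def weight (e : OpenPartialHomeomorph X ℂ) (z : ℂ) : ℝ :=
  g.hermitianCoeff e z ^ n * Real.exp (2 * n * φ (e.symm z))

/-- The value of `ConformalMetric.weight` in the preferred chart at `x`. -/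
def baseWeight (x : X) : ℝ := (g.baseDensity x / 2) ^ n * Real.exp (2 * n * φ x)

theorem baseWeight_pos (x : X) : 0 < g.baseWeight n φ x := by
  have := g.baseDensity_pos x
  unfold baseWeight
  positivity

theorem weight_eq {e : OpenPartialHomeomorph X ℂ} (he : e ∈ atlas ℂ X) {z : ℂ}
    (hz : z ∈ e.target) :
    g.weight n φ e z = (‖transDeriv e (e.symm z)‖ ^ 2) ^ n * g.baseWeight n φ (e.symm z) := by
  rw [weight, hermitianCoeff, g.density_eq he hz, mul_div_assoc, mul_pow, baseWeight, mul_assoc]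

theorem weight_pos {e : OpenPartialHomeomorph X ℂ} (he : e ∈ atlas ℂ X) {z : ℂ}
    (hz : z ∈ e.target) : 0 < g.weight n φ e z := by
  have := g.density_pos he hz
  unfold weight hermitianCoeff
  positivity

theorem weight_transition {e e' : OpenPartialHomeomorph X ℂ}
    (he : e ∈ atlas ℂ X) (he' : e' ∈ atlas ℂ X) {z : ℂ} (hz : z ∈ e'.target)
    (hz' : e'.symm z ∈ e.source) :
    g.weight n φ e' z =
      (‖deriv (fun w => e (e'.symm w)) z‖ ^ 2) ^ n * g.weight n φ e (e (e'.symm z)) := by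
  rw [weight, weight, hermitianCoeff, hermitianCoeff, g.density_transition he he' hz hz',
    mul_div_assoc, mul_pow, mul_assoc, e.left_inv hz']

variable {φ}

theorem weight_contDiffOn (hφ : ContMDiff 𝓘(ℝ, ℂ) 𝓘(ℝ, ℝ) ∞ φ)
    {e : OpenPartialHomeomorph X ℂ} (he : e ∈ atlas ℂ X) :
    ContDiffOn ℝ ∞ (g.weight n φ e) e.target :=
  (((g.density_contDiffOn he).div_const 2).pow n).mul
    (contDiffOn_const.mul (contDiffOn_comp_symm hφ he)).exp

theorem log_weight_contDiffOn (hφ : ContMDiff 𝓘(ℝ, ℂ) 𝓘(ℝ, ℝ) ∞ φ)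
    {e : OpenPartialHomeomorph X ℂ} (he : e ∈ atlas ℂ X) :
    ContDiffOn ℝ ∞ (fun z => Real.log (g.weight n φ e z)) e.target :=
  (g.weight_contDiffOn n hφ he).log fun _ hz => (g.weight_pos n φ he hz).ne'

/-- Here log W = n log ρ + 2nφ - n log 2, and at the centre of the preferred chart the Laplacian and
the curvature are by definition the chart expressions. -/
theorem laplacian_log_weight_chartAt (hφ : ContMDiff 𝓘(ℝ, ℂ) 𝓘(ℝ, ℝ) ∞ φ) (x : X) :
    Laplacian.laplacian (fun z => Real.log (g.weight n φ (chartAt ℂ x) z)) (chartAt ℂ x x) =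
      2 * n * g.baseDensity x * (g.laplacian φ x - g.gaussCurvature x) := by
  set c := chartAt ℂ x with hc
  have hca : c ∈ atlas ℂ X := chart_mem_atlas ℂ x
  have hx : c x ∈ c.target := mem_chart_target ℂ x
  have h2 : (2 : WithTop ℕ∞) ≤ ∞ := ENat.LEInfty.out
  have hnhds := c.open_target.mem_nhds hx
  have d1 : ContDiffAt ℝ 2 (fun z => Real.log (g.density c z)) (c x) :=
    (((g.density_contDiffOn hca).log fun z hz => (g.density_pos hca hz).ne').contDiffAt
      hnhds).of_le h2
  have d2 : ContDiffAt ℝ 2 (fun z => φ (c.symm z)) (c x) :=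
    ((contDiffOn_comp_symm hφ hca).contDiffAt hnhds).of_le h2
  have s1 : ContDiffAt ℝ 2 ((n : ℝ) • fun z => Real.log (g.density c z)) (c x) :=
    contDiffAt_const.smul d1
  have s2 : ContDiffAt ℝ 2 ((2 * n : ℝ) • fun z => φ (c.symm z)) (c x) :=
    contDiffAt_const.smul d2
  have s3 : ContDiffAt ℝ 2 (((2 * n : ℝ) • fun z => φ (c.symm z)) +
      fun _ => -(n * Real.log 2)) (c x) := s2.add contDiffAt_const
  have e1 : (fun z => Real.log (g.weight n φ c z)) =ᶠ[𝓝 (c x)]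
      ((n : ℝ) • fun z => Real.log (g.density c z)) +
        (((2 * n : ℝ) • fun z => φ (c.symm z)) + fun _ => -(n * Real.log 2)) := by
    filter_upwards [hnhds] with z hz
    have := g.density_pos hca hz
    simp only [weight, hermitianCoeff, Pi.add_apply, Pi.smul_apply, smul_eq_mul]
    rw [Real.log_mul (by positivity) (by positivity), Real.log_exp, Real.log_pow,
      Real.log_div (by positivity) (by positivity)]
    ring
  rw [(InnerProductSpace.laplacian_congr_nhds e1).self_of_nhds,
    ContDiffAt.laplacian_add s1 s3,
    ContDiffAt.laplacian_add s2 contDiffAt_const,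
    InnerProductSpace.laplacian_smul _ d1, InnerProductSpace.laplacian_smul _ d2,
    InnerProductSpace.laplacian_const]
  have hρ := g.baseDensity_pos x
  rw [gaussCurvature, laplacian, ← hc, hc, g.density_chartAt, ← hc]
  simp only [smul_eq_mul, Pi.zero_apply]
  field_simp
  ring

/-- The curvature of the weight in an arbitrary chart. -/
theorem laplacian_log_weight (hφ : ContMDiff 𝓘(ℝ, ℂ) 𝓘(ℝ, ℝ) ∞ φ)
    {e : OpenPartialHomeomorph X ℂ} (he : e ∈ atlas ℂ X) {z : ℂ} (hz : z ∈ e.target) :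
    Laplacian.laplacian (fun z => Real.log (g.weight n φ e z)) z =
      2 * n * g.density e z * (g.laplacian φ (e.symm z) - g.gaussCurvature (e.symm z)) := by
  set x := e.symm z with hx
  have hxe : x ∈ e.source := e.map_target hz
  set c := chartAt ℂ x with hc
  have hca : c ∈ atlas ℂ X := chart_mem_atlas ℂ x
  have hxc : x ∈ c.source := mem_chart_source ℂ x
  have hτ := analyticAt_transition he hca hxe hxc
  have hτz : e (c.symm (c x)) = z := by rw [c.left_inv hxc, hx, e.right_inv hz]
  have ha : deriv (fun w => e (c.symm w)) (c x) = (transDeriv e x)⁻¹ :=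
    deriv_chartAt_transition he hxe
  have hT := transDeriv_ne_zero he hxe
  have hane : deriv (fun w => e (c.symm w)) (c x) ≠ 0 := by
    rw [ha]; exact inv_ne_zero hT
  have h2 : (2 : WithTop ℕ∞) ≤ ∞ := ENat.LEInfty.out
  -- The logarithms of the weights in the two charts differ by 2n log |τ'|, which is harmonic; the
  -- rest is the transformation of the Laplacian under τ.
  have harm := hτ.deriv.harmonicAt_log_norm hane
  have hlog : ContDiffAt ℝ ∞ (fun z => Real.log (g.weight n φ e z)) (e (c.symm (c x))) := by
    rw [hτz]
    exact (g.log_weight_contDiffOn n hφ he).contDiffAt (e.open_target.mem_nhds hz)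
  have hcomp : ContDiffAt ℝ 2 (fun w => Real.log (g.weight n φ e (e (c.symm w)))) (c x) :=
    (ContDiffAt.comp (g := fun z => Real.log (g.weight n φ e z)) (c x) hlog
      (hτ.contDiffAt.restrict_scalars ℝ)).of_le h2
  have hs : ContDiffAt ℝ 2
      ((2 * n : ℝ) • fun w => Real.log ‖deriv (fun w => e (c.symm w)) w‖) (c x) :=
    contDiffAt_const.smul harm.1
  have e1 : (fun w => Real.log (g.weight n φ c w)) =ᶠ[𝓝 (c x)]
      ((2 * n : ℝ) • fun w => Real.log ‖deriv (fun w => e (c.symm w)) w‖) +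
        fun w => Real.log (g.weight n φ e (e (c.symm w))) := by
    filter_upwards [eventually_symm_mem hxe hxc, hτ.deriv.continuousAt.eventually_ne hane]
      with w hw hne
    have h1 := g.weight_pos n φ he (e.map_source hw.2)
    have h3 : 0 < ‖deriv (fun w => e (c.symm w)) w‖ := norm_pos_iff.2 hne
    simp only [Pi.add_apply, Pi.smul_apply, smul_eq_mul]
    rw [g.weight_transition n φ he hca hw.1 hw.2, Real.log_mul (by positivity) h1.ne',
      Real.log_pow, Real.log_pow]
    push_cast
    ring
  have key := (InnerProductSpace.laplacian_congr_nhds e1).self_of_nhds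
  rw [ContDiffAt.laplacian_add hs hcomp,
    InnerProductSpace.laplacian_smul _ harm.1, harm.2.self_of_nhds,
    laplacian_comp_holomorphic (v := fun z => Real.log (g.weight n φ e z)) hτ hlog,
    g.laplacian_log_weight_chartAt n hφ x, hτz, ha] at key
  rw [g.density_eq he hz, ← hx]
  have hTn : ‖transDeriv e x‖ ≠ 0 := norm_ne_zero_iff.2 hT
  rw [norm_inv] at key
  simp only [Pi.zero_apply, smul_zero, zero_add] at key
  field_simp at key
  linear_combination -key

/-- The definitions use a chart that varies with the point, so continuity is not visible from them.
In one fixed chart the function is Δ log W / (2ρ) for the weight with n = 1. -/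
theorem continuous_laplacian_sub_gaussCurvature (hφ : ContMDiff 𝓘(ℝ, ℂ) 𝓘(ℝ, ℝ) ∞ φ) :
    Continuous fun x => g.laplacian φ x - g.gaussCurvature x := by
  refine continuous_iff_continuousAt.2 fun x => ?_
  set e := chartAt ℂ x
  have he : e ∈ atlas ℂ X := chart_mem_atlas ℂ x
  have hxe : x ∈ e.source := mem_chart_source ℂ x
  set V : ℂ → ℂ := fun z => (Real.log (g.weight 1 φ e z) : ℂ) with hV
  have hlog := g.log_weight_contDiffOn 1 hφ he
  have hVs : ContDiffOn ℝ ∞ V e.target := contDiffOn_ofReal hlog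
  have hc : ContinuousOn (fun z => (4 * wirtinger Complex.I (wirtinger (-Complex.I) V) z).re /
      (2 * g.density e z)) e.target :=
    (Complex.continuous_re.comp_continuousOn (continuousOn_const.mul
      (wirtinger_contDiffOn _ e.open_target
        (wirtinger_contDiffOn _ e.open_target hVs)).continuousOn)).div
      (continuousOn_const.mul (g.density_contDiffOn he).continuousOn)
      fun z hz => by have := g.density_pos he hz; positivity
  have h1 : ContinuousOn (fun x => g.laplacian φ x - g.gaussCurvature x) e.source := by
    refine (hc.comp e.continuousOn e.mapsTo).congr fun y hy => ?_
    have hz := e.map_source hy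
    have h2 : ContDiffAt ℝ 2 (fun z => Real.log (g.weight 1 φ e z)) (e y) :=
      (hlog.contDiffAt (e.open_target.mem_nhds hz)).of_le ENat.LEInfty.out
    have h3 := g.laplacian_log_weight 1 hφ he hz
    rw [e.left_inv hy] at h3
    have hρ := g.density_pos he hz
    simp only [Function.comp_apply, hV]
    rw [wirtinger_I_neg_I (contDiffAt_ofReal h2), laplacian_ofReal h2, h3, mul_div_cancel₀ _ (by
      norm_num : (4 : ℂ) ≠ 0), Complex.ofReal_re]
    push_cast
    field_simp
  exact h1.continuousAt (e.open_source.mem_nhds hxe)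

end ConformalMetric

/-! ### The Cauchy-Riemann operators on sections -/

/-- The coefficient at `x` of `∂̄u` in the preferred chart. -/
def dbarAt (n : ℕ) (u : X → ℂ) (x : X) : ℂ :=
  wirtinger Complex.I (secCoeff n (chartAt ℂ x) u) (chartAt ℂ x x)

theorem secCoeff_chartAt_eventuallyEq (n : ℕ) (u : X → ℂ) {e : OpenPartialHomeomorph X ℂ}
    (he : e ∈ atlas ℂ X) {x : X} (hx : x ∈ e.source) :
    secCoeff n (chartAt ℂ x) u =ᶠ[𝓝 (chartAt ℂ x x)] fun w =>
      (deriv (fun w => e ((chartAt ℂ x).symm w)) w)⁻¹ ^ n *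
        secCoeff n e u (e ((chartAt ℂ x).symm w)) := by
  filter_upwards [eventually_symm_mem hx (mem_chart_source ℂ x)] with w hw
  exact secCoeff_transition n u he (chart_mem_atlas ℂ x) hw.1 hw.2

/-- Transition factors of E are holomorphic, so ∂̄ passes through them, and the chain rule adds the
conjugate factor of a (0,1)-form. Thus the pointwise values `dbarAt` form a global E-valued form. -/
theorem frmCoeff_dbarAt (n : ℕ) (u : X → ℂ) {e : OpenPartialHomeomorph X ℂ}
    (he : e ∈ atlas ℂ X) {z : ℂ} (hz : z ∈ e.target)
    (hd : DifferentiableAt ℝ (secCoeff n e u) z) :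
    frmCoeff n e (dbarAt n u) z = wirtinger Complex.I (secCoeff n e u) z := by
  set x := e.symm z with hx
  have hxe : x ∈ e.source := e.map_target hz
  set c := chartAt ℂ x with hc
  have hxc : x ∈ c.source := mem_chart_source ℂ x
  have hτ := analyticAt_transition he (chart_mem_atlas ℂ x) hxe hxc
  have hτz : e (c.symm (c x)) = z := by rw [c.left_inv hxc, hx, e.right_inv hz]
  have hT := transDeriv_ne_zero he hxe
  have ha := deriv_chartAt_transition he hxe
  rw [← hc] at hτ ha
  have hpow : DifferentiableAt ℂ (fun w => (deriv (fun w => e (c.symm w)) w)⁻¹ ^ n) (c x) :=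
    (hτ.deriv.differentiableAt.inv (by rw [ha]; exact inv_ne_zero hT)).pow n
  have hd' : DifferentiableAt ℝ (secCoeff n e u) (e (c.symm (c x))) := by rwa [hτz]
  have h1 : dbarAt n u x = _ := wirtinger_congr _ (secCoeff_chartAt_eventuallyEq n u he hxe)
  rw [← hc, wirtinger_mul (g := fun w => secCoeff n e u (e (c.symm w))) _
    (hpow.restrictScalars ℝ)
    (DifferentiableAt.comp (g := secCoeff n e u) (c x) hd'
      (hτ.differentiableAt.restrictScalars ℝ)),
    wirtinger_I_holomorphic hpow,
    wirtinger_I_comp hτ.differentiableAt.hasDerivAt hd', hτz, ha] at h1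
  rw [frmCoeff, ← hx, h1, map_inv₀]
  have hTc : conj (transDeriv e x) ≠ 0 := (map_ne_zero _).2 hT
  simp only [zero_mul, zero_add, inv_inv, inv_pow]
  field_simp

namespace ConformalMetric

variable (g : ConformalMetric X)

/-- The coefficient at `x`, in the preferred chart, of the conjugate-linear dual of the derivative
`∂u` that is taken with respect to the Chern connection of the weight. -/
def delAt (n : ℕ) (φ : X → ℝ) (u : X → ℂ) (x : X) : ℂ :=
  wirtinger (-Complex.I)
    (fun z => g.weight n φ (chartAt ℂ x) z * secCoeff n (chartAt ℂ x) u z) (chartAt ℂ x x)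

/-- With a = τ', the weight acquires |a|^{2n} and the section a^{-n}, so their product acquires the
antiholomorphic factor conj(a)^n, which ∂ does not differentiate. -/
theorem wirtinger_weight_mul (n : ℕ) {φ : X → ℝ} (hφ : ContMDiff 𝓘(ℝ, ℂ) 𝓘(ℝ, ℝ) ∞ φ) (u : X → ℂ)
    {e : OpenPartialHomeomorph X ℂ} (he : e ∈ atlas ℂ X) {z : ℂ} (hz : z ∈ e.target)
    (hd : DifferentiableAt ℝ (secCoeff n e u) z) :
    wirtinger (-Complex.I) (fun z => g.weight n φ e z * secCoeff n e u z) z =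
      conj (transDeriv e (e.symm z)) ^ n * transDeriv e (e.symm z) *
        g.delAt n φ u (e.symm z) := by
  set x := e.symm z with hx
  have hxe : x ∈ e.source := e.map_target hz
  set c := chartAt ℂ x with hc
  have hca : c ∈ atlas ℂ X := chart_mem_atlas ℂ x
  have hxc : x ∈ c.source := mem_chart_source ℂ x
  have hτ := analyticAt_transition he hca hxe hxc
  have hτz : e (c.symm (c x)) = z := by rw [c.left_inv hxc, hx, e.right_inv hz]
  have hT := transDeriv_ne_zero he hxe
  have ha : deriv (fun w => e (c.symm w)) (c x) = (transDeriv e x)⁻¹ :=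
    deriv_chartAt_transition he hxe
  set P : ℂ → ℂ := fun z => g.weight n φ e z * secCoeff n e u z with hP
  have hPd : DifferentiableAt ℝ P z :=
    (((contDiffOn_ofReal (g.weight_contDiffOn n hφ he)).contDiffAt
      (e.open_target.mem_nhds hz)).differentiableAt (by simp)).mul hd
  have hd' : DifferentiableAt ℝ P (e (c.symm (c x))) := by rwa [hτz]
  have hpow : DifferentiableAt ℂ (fun w => deriv (fun w => e (c.symm w)) w ^ n) (c x) :=
    hτ.deriv.differentiableAt.pow n
  have hpow' : DifferentiableAt ℝ (fun w => conj (deriv (fun w => e (c.symm w)) w ^ n)) (c x) :=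
    Complex.conjCLE.differentiableAt.comp (c x) (hpow.restrictScalars ℝ)
  have e1 : (fun w => (g.weight n φ c w : ℂ) * secCoeff n c u w) =ᶠ[𝓝 (c x)] fun w =>
      conj (deriv (fun w => e (c.symm w)) w ^ n) * P (e (c.symm w)) := by
    filter_upwards [eventually_symm_mem hxe hxc, hτ.deriv.continuousAt.eventually_ne
      (by rw [ha]; exact inv_ne_zero hT)] with w hw hne
    rw [secCoeff_transition n u he hca hw.1 hw.2, g.weight_transition n φ he hca hw.1 hw.2]
    simp only [hP]
    push_cast
    rw [← Complex.mul_conj', map_pow, mul_pow, inv_pow]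
    field_simp
  have h1 : g.delAt n φ u x = _ := wirtinger_congr _ e1
  rw [wirtinger_mul (g := fun w => P (e (c.symm w))) _ hpow'
    (DifferentiableAt.comp (g := P) (c x) hd' (hτ.differentiableAt.restrictScalars ℝ)),
    wirtinger_neg_I_conj_holomorphic hpow,
    wirtinger_neg_I_comp hτ.differentiableAt.hasDerivAt hd', hτz, ha] at h1
  rw [h1, map_pow, map_inv₀]
  have hTc : conj (transDeriv e x) ≠ 0 := (map_ne_zero _).2 hT
  simp only [zero_mul, zero_add, inv_pow]
  field_simp

end ConformalMetric

end

section

variable {X : Type*} [TopologicalSpace X] [ChartedSpace ℂ X]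

/-! ### Sections supported in a chart -/

/-- The section of `E` with coefficient `F` in the chart `e`, extended by zero. -/
def extendSec (n : ℕ) (e : OpenPartialHomeomorph X ℂ) (F : ℂ → ℂ) : X → ℂ :=
  e.source.indicator fun x => transDeriv e x ^ n * F (e x)

/-- The `E`-valued `(0,1)`-form with coefficient `B` in the chart `e`, extended by zero. -/
def extendFrm (n : ℕ) (e : OpenPartialHomeomorph X ℂ) (B : ℂ → ℂ) : X → ℂ :=
  e.source.indicator fun x => (conj (transDeriv e x))⁻¹ * transDeriv e x ^ n * B (e x)

theorem secCoeff_sum (n : ℕ) {ι : Type*} (t : Finset ι) (e : OpenPartialHomeomorph X ℂ)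
    (u : ι → X → ℂ) :
    secCoeff n e (fun x => ∑ i ∈ t, u i x) = fun z => ∑ i ∈ t, secCoeff n e (u i) z := by
  ext z
  simp [secCoeff, Finset.mul_sum]

variable [IsManifold 𝓘(ℂ) ω X]

theorem secCoeff_extendSec (n : ℕ) {e : OpenPartialHomeomorph X ℂ} (he : e ∈ atlas ℂ X)
    (F : ℂ → ℂ) {z : ℂ} (hz : z ∈ e.target) : secCoeff n e (extendSec n e F) z = F z := by
  have hx := e.map_target hz
  have hT := transDeriv_ne_zero he hx
  rw [secCoeff, extendSec, Set.indicator_of_mem hx, e.right_inv hz, inv_pow]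
  field_simp

theorem frmCoeff_extendFrm (n : ℕ) {e : OpenPartialHomeomorph X ℂ} (he : e ∈ atlas ℂ X)
    (B : ℂ → ℂ) {z : ℂ} (hz : z ∈ e.target) : frmCoeff n e (extendFrm n e B) z = B z := by
  have hx := e.map_target hz
  have hT := transDeriv_ne_zero he hx
  have hTc : conj (transDeriv e (e.symm z)) ≠ 0 := (map_ne_zero _).2 hT
  rw [frmCoeff, extendFrm, Set.indicator_of_mem hx, e.right_inv hz, inv_pow]
  field_simp

theorem frmCoeff_injective (n : ℕ) {e : OpenPartialHomeomorph X ℂ} (he : e ∈ atlas ℂ X)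
    {v v' : X → ℂ} {x : X} (hx : x ∈ e.source)
    (h : frmCoeff n e v (e x) = frmCoeff n e v' (e x)) : v x = v' x := by
  have hT := transDeriv_ne_zero he hx
  have hTc : conj (transDeriv e x) ≠ 0 := (map_ne_zero _).2 hT
  rw [frmCoeff, frmCoeff, e.left_inv hx] at h
  exact mul_left_cancel₀ (mul_ne_zero hTc (pow_ne_zero n (inv_ne_zero hT))) h

/-! ### Smoothness of extensions by zero. -/

section Extend

variable [T2Space X]

-- The image of `K` in X is compact, hence closed in a Hausdorff space. This is what makes extension
-- by zero vanish near every point outside the chart domain.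
omit [ChartedSpace ℂ X] [IsManifold 𝓘(ℂ) ω X] in
theorem eventually_chart_notMem {e : OpenPartialHomeomorph X ℂ} {K : Set ℂ}
    (hK : IsCompact K) (hKe : K ⊆ e.target) {x : X} (hx : x ∉ e.source) :
    ∀ᶠ y in 𝓝 x, y ∈ e.source → e y ∉ K := by
  have hc : IsClosed (e.symm '' K) := (hK.image_of_continuousOn
    (e.continuousOn_symm.mono hKe)).isClosed
  have hxn : x ∉ e.symm '' K := by
    rintro ⟨z, hz, rfl⟩
    exact hx (e.map_target (hKe hz))
  filter_upwards [hc.isOpen_compl.mem_nhds hxn] with y hy hye hyK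
  exact hy ⟨e y, hyK, e.left_inv hye⟩

omit [IsManifold 𝓘(ℂ) ω X] in
theorem secCoeff_extendSec_eventually_zero (n : ℕ) {e e' : OpenPartialHomeomorph X ℂ}
    {F : ℂ → ℂ} (hc : HasCompactSupport F) (hs : tsupport F ⊆ e.target) {z : ℂ}
    (hz : z ∈ e'.target) (hz' : e'.symm z ∉ e.source) :
    secCoeff n e' (extendSec n e F) =ᶠ[𝓝 z] fun _ => 0 := by
  filter_upwards [(e'.continuousAt_symm hz).eventually (eventually_chart_notMem hc hs hz')]
    with w hw
  rw [secCoeff]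
  by_cases h : e'.symm w ∈ e.source
  · rw [extendSec, Set.indicator_of_mem h, image_eq_zero_of_notMem_tsupport (hw h)]
    simp
  · rw [extendSec, Set.indicator_of_notMem h, mul_zero]

theorem secCoeff_extendSec_contDiffOn (n : ℕ) {e e' : OpenPartialHomeomorph X ℂ}
    (he : e ∈ atlas ℂ X) (he' : e' ∈ atlas ℂ X) {F : ℂ → ℂ} (hF : ContDiff ℝ ∞ F)
    (hc : HasCompactSupport F) (hs : tsupport F ⊆ e.target) :
    ContDiffOn ℝ ∞ (secCoeff n e' (extendSec n e F)) e'.target := by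
  intro z hz
  refine ContDiffAt.contDiffWithinAt ?_
  by_cases hx : e'.symm z ∈ e.source
  · have hτ := analyticAt_transition he he' hx (e'.map_target hz)
    have hmem := eventually_symm_mem hx (e'.map_target hz)
    have hT := transDeriv_ne_zero he' (e'.map_target hz)
    have hmul := transDeriv_mul_deriv he he' hx (e'.map_target hz)
    rw [e'.right_inv hz] at hτ hmem hmul
    have hane : deriv (fun w => e (e'.symm w)) z ≠ 0 := by
      intro h0
      rw [h0, mul_zero] at hmul
      exact hT hmul.symm
    have h1 : ContDiffAt ℝ ∞ (fun w => (deriv (fun w => e (e'.symm w)) w)⁻¹ ^ n) z :=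
      ((hτ.deriv.inv hane).pow n).contDiffAt.restrict_scalars ℝ
    have h2 : ContDiffAt ℝ ∞ (fun w => F (e (e'.symm w))) z :=
      hF.contDiffAt.comp z (hτ.contDiffAt.restrict_scalars ℝ)
    refine (h1.mul h2).congr_of_eventuallyEq ?_
    filter_upwards [hmem] with w hw
    rw [secCoeff_transition n _ he he' hw.1 hw.2,
      secCoeff_extendSec n he F (e.map_source hw.2)]
  · exact contDiffAt_const.congr_of_eventuallyEq
      (secCoeff_extendSec_eventually_zero n hc hs hz hx)

theorem dbarAt_extendSec (n : ℕ) {e : OpenPartialHomeomorph X ℂ}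
    (he : e ∈ atlas ℂ X) {F : ℂ → ℂ} (hF : ContDiff ℝ ∞ F)
    (hc : HasCompactSupport F) (hs : tsupport F ⊆ e.target) :
    dbarAt n (extendSec n e F) = extendFrm n e (wirtinger Complex.I F) := by
  ext x
  by_cases hx : x ∈ e.source
  · refine frmCoeff_injective n he hx ?_
    have hz := e.map_source hx
    rw [frmCoeff_extendFrm n he _ hz, frmCoeff_dbarAt n _ he hz
      (((secCoeff_extendSec_contDiffOn n he he hF hc hs).contDiffAt
        (e.open_target.mem_nhds hz)).differentiableAt (by simp))]
    refine wirtinger_congr _ ?_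
    filter_upwards [e.open_target.mem_nhds hz] with w hw
    exact secCoeff_extendSec n he F hw
  · rw [extendFrm, Set.indicator_of_notMem hx]
    refine wirtinger_eq_zero _ (secCoeff_extendSec_eventually_zero n hc hs
      (mem_chart_target ℂ x) ?_)
    rwa [(chartAt ℂ x).left_inv (mem_chart_source ℂ x)]

theorem ConformalMetric.delAt_extendSec_of_notMem (g : ConformalMetric X) (n : ℕ) (φ : X → ℝ)
    {e : OpenPartialHomeomorph X ℂ} {F : ℂ → ℂ}
    (hc : HasCompactSupport F) (hs : tsupport F ⊆ e.target) {x : X} (hx : x ∉ e.source) :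
    g.delAt n φ (extendSec n e F) x = 0 := by
  refine wirtinger_eq_zero _ ?_
  have := secCoeff_extendSec_eventually_zero n hc hs (e' := chartAt ℂ x)
    (mem_chart_target ℂ x) (by rwa [(chartAt ℂ x).left_inv (mem_chart_source ℂ x)])
  filter_upwards [this] with w hw
  rw [hw, mul_zero]

end Extend

/-! ### The energy densities -/

namespace ConformalMetric

variable (g : ConformalMetric X) (n : ℕ) (φ : X → ℝ)

/-- The Hermitian pairing of `E`-valued `(0,1)`-forms that is induced by `g` and the weight. -/
def formPair (v v' : X → ℂ) (x : X) : ℂ :=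
  (2 * g.baseWeight n φ x / g.baseDensity x : ℝ) * (v x * conj (v' x))

/-- The Hermitian pairing of the derivatives `ConformalMetric.delAt`. -/
def delPair (d d' : X → ℂ) (x : X) : ℂ :=
  (2 / (g.baseWeight n φ x * g.baseDensity x) : ℝ) * (d x * conj (d' x))

/-- The Hermitian pairing of sections of `E` that is induced by the weight, multiplied by the
curvature term. -/
def curvPair (u u' : X → ℂ) (x : X) : ℂ :=
  (n * (g.laplacian φ x - g.gaussCurvature x) * g.baseWeight n φ x : ℝ) * (u x * conj (u' x))

/-- After multiplication by the area density, each of the three pairings becomes twice the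
corresponding integrand of `integral_bochner`; all factors of `transDeriv` cancel. The 2 is the
square norm of dz̄ multiplied by ρ. -/
theorem density_mul_formPair (v v' : X → ℂ) {e : OpenPartialHomeomorph X ℂ} (he : e ∈ atlas ℂ X)
    {z : ℂ} (hz : z ∈ e.target) :
    (g.density e z : ℂ) * g.formPair n φ v v' (e.symm z) =
      2 * (g.weight n φ e z * frmCoeff n e v z * conj (frmCoeff n e v' z)) := by
  have hT := transDeriv_ne_zero he (e.map_target hz)
  have hTc : conj (transDeriv e (e.symm z)) ≠ 0 := (map_ne_zero _).2 hT
  have hρ : (g.baseDensity (e.symm z) : ℂ) ≠ 0 := by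
    exact_mod_cast (g.baseDensity_pos (e.symm z)).ne'
  rw [g.density_eq he hz, g.weight_eq n φ he hz, formPair, frmCoeff, frmCoeff]
  push_cast
  rw [← Complex.mul_conj', map_mul, map_mul, map_pow, map_inv₀, Complex.conj_conj]
  simp only [mul_pow, inv_pow]
  field_simp

theorem density_mul_delPair {d d' : X → ℂ} {D D' : ℂ} {e : OpenPartialHomeomorph X ℂ}
    (he : e ∈ atlas ℂ X) {z : ℂ} (hz : z ∈ e.target)
    (hD : D = conj (transDeriv e (e.symm z)) ^ n * transDeriv e (e.symm z) * d (e.symm z))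
    (hD' : D' = conj (transDeriv e (e.symm z)) ^ n * transDeriv e (e.symm z) * d' (e.symm z)) :
    (g.density e z : ℂ) * g.delPair n φ d d' (e.symm z) =
      2 * ((g.weight n φ e z : ℂ)⁻¹ * D * conj D') := by
  have hT := transDeriv_ne_zero he (e.map_target hz)
  have hTc : conj (transDeriv e (e.symm z)) ≠ 0 := (map_ne_zero _).2 hT
  have hρ : (g.baseDensity (e.symm z) : ℂ) ≠ 0 := by
    exact_mod_cast (g.baseDensity_pos (e.symm z)).ne'
  have hW : (g.baseWeight n φ (e.symm z) : ℂ) ≠ 0 := by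
    exact_mod_cast (g.baseWeight_pos n φ (e.symm z)).ne'
  rw [g.density_eq he hz, g.weight_eq n φ he hz, delPair, hD, hD']
  push_cast
  rw [← Complex.mul_conj', map_mul, map_mul, map_pow, Complex.conj_conj]
  simp only [mul_pow]
  field_simp

theorem weight_mul_secCoeff (u u' : X → ℂ) {e : OpenPartialHomeomorph X ℂ}
    (he : e ∈ atlas ℂ X) {z : ℂ} (hz : z ∈ e.target) :
    g.weight n φ e z * secCoeff n e u z * conj (secCoeff n e u' z) =
      g.baseWeight n φ (e.symm z) * (u (e.symm z) * conj (u' (e.symm z))) := by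
  have hT := transDeriv_ne_zero he (e.map_target hz)
  have hTc : conj (transDeriv e (e.symm z)) ≠ 0 := (map_ne_zero _).2 hT
  rw [g.weight_eq n φ he hz, secCoeff, secCoeff]
  push_cast
  rw [← Complex.mul_conj', map_mul, map_pow, map_inv₀]
  simp only [mul_pow, inv_pow]
  field_simp

variable {φ}

theorem density_mul_curvPair (hφ : ContMDiff 𝓘(ℝ, ℂ) 𝓘(ℝ, ℝ) ∞ φ) (u u' : X → ℂ)
    {e : OpenPartialHomeomorph X ℂ} (he : e ∈ atlas ℂ X) {z : ℂ} (hz : z ∈ e.target) :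
    (g.density e z : ℂ) * g.curvPair n φ u u' (e.symm z) =
      2 * (((Laplacian.laplacian (fun z => Real.log (g.weight n φ e z)) z / 4 : ℝ) : ℂ) *
        (g.weight n φ e z * secCoeff n e u z * conj (secCoeff n e u' z))) := by
  rw [g.weight_mul_secCoeff n φ u u' he hz, g.laplacian_log_weight n hφ he hz, curvPair]
  push_cast
  ring

variable (φ)

theorem formPair_self (v : X → ℂ) (x : X) :
    g.formPair n φ v v x = (2 * g.baseWeight n φ x / g.baseDensity x * ‖v x‖ ^ 2 : ℝ) := by
  rw [formPair, Complex.mul_conj']; push_cast; ring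

theorem delPair_self (d : X → ℂ) (x : X) :
    g.delPair n φ d d x = (2 / (g.baseWeight n φ x * g.baseDensity x) * ‖d x‖ ^ 2 : ℝ) := by
  rw [delPair, Complex.mul_conj']; push_cast; ring

theorem curvPair_self (u : X → ℂ) (x : X) :
    g.curvPair n φ u u x = (n * (g.laplacian φ x - g.gaussCurvature x) *
      (g.baseWeight n φ x * ‖u x‖ ^ 2) : ℝ) := by
  rw [curvPair, Complex.mul_conj']; push_cast; ring

variable [MeasurableSpace X] [BorelSpace X] {φ}

/-- The integral over `X` of a function supported in the domain of a chart. -/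
theorem integral_area_of_chart {E : Type*} [NormedAddCommGroup E] [NormedSpace ℝ E]
    {e : OpenPartialHomeomorph X ℂ} (he : e ∈ atlas ℂ X)
    {F : X → E} {G : ℂ → E} (hG : Integrable G) (hG0 : ∀ z ∉ e.target, G z = 0)
    (hF0 : ∀ x ∉ e.source, F x = 0)
    (hFG : ∀ z ∈ e.target, g.density e z • F (e.symm z) = G z) :
    Integrable F g.area ∧ ∫ x, F x ∂g.area = ∫ z, G z := by
  -- The given `G` already contains the area density; `G'` is the coordinate expression of `F`
  -- itself.
  set G' : ℂ → E := fun z => (g.density e z)⁻¹ • G z with hG'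
  have hm : AEStronglyMeasurable G' (volume.restrict e.target) :=
    (((g.density_contDiffOn he).continuousOn.aemeasurable
      e.open_target.measurableSet).inv.aestronglyMeasurable).smul hG.1.restrict
  have hFG' : ∀ x ∈ e.source, F x = G' (e x) := by
    intro x hx
    have hz := e.map_source hx
    have := hFG _ hz
    rw [e.left_inv hx] at this
    simp only [hG']
    rw [← this, inv_smul_smul₀ (g.density_pos he hz).ne']
  have heq : Set.EqOn (fun z => g.density e z • G' z) G e.target := fun z hz =>
    smul_inv_smul₀ (g.density_pos he hz).ne' _
  have hsupp : Function.support F ⊆ e.source := fun x hx => by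
    by_contra h
    exact hx (hF0 x h)
  constructor
  · rw [← integrableOn_iff_integrable_of_support_subset hsupp, g.integrableOn_area_iff he hm hFG',
      integrableOn_congr_fun heq e.open_target.measurableSet]
    exact hG.integrableOn
  · rw [← setIntegral_eq_integral_of_forall_compl_eq_zero hF0, g.setIntegral_area he hm hFG',
      setIntegral_congr_fun e.open_target.measurableSet heq,
      setIntegral_eq_integral_of_forall_compl_eq_zero hG0]

variable [T2Space X]

/-- The Bochner-Kodaira identity for two sections, the second of which is supported in a chart. -/
theorem integral_formPair_extendSec (hφ : ContMDiff 𝓘(ℝ, ℂ) 𝓘(ℝ, ℝ) ∞ φ) {u : X → ℂ}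
    {e : OpenPartialHomeomorph X ℂ} (he : e ∈ atlas ℂ X)
    (hu : ContDiffOn ℝ ∞ (secCoeff n e u) e.target) {F : ℂ → ℂ} (hF : ContDiff ℝ ∞ F)
    (hc : HasCompactSupport F) (hs : tsupport F ⊆ e.target) :
    Integrable (g.formPair n φ (dbarAt n u) (dbarAt n (extendSec n e F))) g.area ∧
    Integrable (g.delPair n φ (g.delAt n φ u) (g.delAt n φ (extendSec n e F))) g.area ∧
    Integrable (g.curvPair n φ u (extendSec n e F)) g.area ∧
    ∫ x, g.formPair n φ (dbarAt n u) (dbarAt n (extendSec n e F)) x ∂g.area =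
      (∫ x, g.delPair n φ (g.delAt n φ u) (g.delAt n φ (extendSec n e F)) x ∂g.area) +
      ∫ x, g.curvPair n φ u (extendSec n e F) x ∂g.area := by
  have hU := e.open_target
  set W := g.weight n φ e with hWdef
  have hW : ContDiffOn ℝ ∞ W e.target := g.weight_contDiffOn n hφ he
  have hWc := contDiffOn_ofReal hW
  have hlog := g.log_weight_contDiffOn n hφ he
  set f := secCoeff n e u with hf
  have hext := secCoeff_extendSec_contDiffOn n he he hF hc hs
  have da : ∀ {h : ℂ → ℂ}, ContDiffOn ℝ ∞ h e.target → ∀ z ∈ e.target, DifferentiableAt ℝ h z :=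
    fun hg z hz => (hg.contDiffAt (hU.mem_nhds hz)).differentiableAt (by simp)
  have hFe : ∀ z ∈ e.target, secCoeff n e (extendSec n e F) =ᶠ[𝓝 z] F := fun z hz => by
    filter_upwards [hU.mem_nhds hz] with w hw
    exact secCoeff_extendSec n he F hw
  have tz : ∀ z ∉ e.target, F =ᶠ[𝓝 z] fun _ => 0 := fun z hz =>
    notMem_tsupport_iff_eventuallyEq.1 fun h => hz (hs h)
  have c1 : ∀ {h : ℂ → ℂ}, tsupport h ⊆ tsupport F →
      tsupport (fun z => conj (h z)) ⊆ e.target ∧ HasCompactSupport fun z => conj (h z) := by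
    intro h hh
    have : tsupport (fun z => conj (h z)) = tsupport h := by simp [tsupport, Function.support]
    exact ⟨this ▸ hh.trans hs, hc.of_isClosed_subset (isClosed_tsupport _) (this ▸ hh)⟩
  have s1 := c1 (tsupport_wirtinger_subset Complex.I F)
  have s2 := c1 ((tsupport_wirtinger_subset (-Complex.I) fun z => W z * F z).trans
    tsupport_mul_subset_right)
  have s3 := c1 (subset_refl (tsupport F))
  have hWF : ContDiffOn ℝ ∞ (fun z => W z * F z) e.target := hWc.mul hF.contDiffOn
  have i1 : Integrable fun z => W z * wirtinger Complex.I f z * conj (wirtinger Complex.I F z) :=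
    integrable_mul_of_tsupport hU (hWc.mul (wirtinger_contDiffOn _ hU hu)).continuousOn
      (contDiffOn_conj (wirtinger_contDiff _ hF).contDiffOn).continuousOn s1.1 s1.2
  have i2 : Integrable fun z => (W z : ℂ)⁻¹ * wirtinger (-Complex.I) (fun z => W z * f z) z *
      conj (wirtinger (-Complex.I) (fun z => W z * F z) z) :=
    integrable_mul_of_tsupport hU ((hWc.inv fun z hz => by
      exact_mod_cast (g.weight_pos n φ he hz).ne').mul
        (wirtinger_contDiffOn _ hU (hWc.mul hu))).continuousOn
      (contDiffOn_conj (wirtinger_contDiffOn _ hU hWF)).continuousOn s2.1 s2.2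
  have hΔ : ContinuousOn (fun z =>
      ((Laplacian.laplacian (fun z => Real.log (W z)) z / 4 : ℝ) : ℂ)) e.target := by
    refine (wirtinger_contDiffOn Complex.I hU (wirtinger_contDiffOn (-Complex.I) hU
      (contDiffOn_ofReal hlog))).continuousOn.congr fun z hz => ?_
    have h2 : ContDiffAt ℝ 2 (fun z => Real.log (W z)) z :=
      (hlog.contDiffAt (hU.mem_nhds hz)).of_le ENat.LEInfty.out
    rw [wirtinger_I_neg_I (contDiffAt_ofReal h2), laplacian_ofReal h2]
    push_cast
    rfl
  have i3 : Integrable fun z => ((Laplacian.laplacian (fun z => Real.log (W z)) z / 4 : ℝ) : ℂ) *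
      (W z * f z * conj (F z)) := by
    have := integrable_mul_of_tsupport hU (hΔ.mul (hWc.mul hu).continuousOn)
      (contDiffOn_conj hF.contDiffOn).continuousOn s3.1 s3.2
    refine this.congr (ae_of_all _ fun z => ?_)
    simp only [Pi.mul_apply]
    ring
  have w0 : ∀ {s : ℂ}, ∀ z ∉ e.target, wirtinger s F z = 0 := fun z hz =>
    wirtinger_eq_zero _ (tz z hz)
  have r1 := g.integral_area_of_chart he
    (F := g.formPair n φ (dbarAt n u) (dbarAt n (extendSec n e F))) (i1.const_mul 2)
    (fun z hz => by simp [w0 z hz])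
    (fun x hx => by
      rw [formPair, dbarAt_extendSec n he hF hc hs, extendFrm, Set.indicator_of_notMem hx]
      simp)
    (fun z hz => by
      rw [Complex.real_smul, g.density_mul_formPair n φ _ _ he hz,
        frmCoeff_dbarAt n u he hz (da hu z hz),
        frmCoeff_dbarAt n _ he hz (da hext z hz), wirtinger_congr _ (hFe z hz)])
  have r2 := g.integral_area_of_chart he
    (F := g.delPair n φ (g.delAt n φ u) (g.delAt n φ (extendSec n e F))) (i2.const_mul 2)
    (fun z hz => by
      have : wirtinger (-Complex.I) (fun z => W z * F z) z = 0 := by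
        refine wirtinger_eq_zero _ ?_
        filter_upwards [tz z hz] with w hw
        rw [hw, mul_zero]
      simp [this])
    (fun x hx => by
      rw [delPair, g.delAt_extendSec_of_notMem n φ hc hs hx]
      simp)
    (fun z hz => by
      have : wirtinger (-Complex.I) (fun z => W z * F z) z =
          wirtinger (-Complex.I) (fun z => W z * secCoeff n e (extendSec n e F) z) z := by
        refine wirtinger_congr _ ?_
        filter_upwards [hFe z hz] with w hw
        rw [hw]
      rw [Complex.real_smul, this]
      exact g.density_mul_delPair n φ he hz
        (g.wirtinger_weight_mul n hφ u he hz (da hu z hz))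
        (g.wirtinger_weight_mul n hφ _ he hz (da hext z hz)))
  have r3 := g.integral_area_of_chart he
    (F := g.curvPair n φ u (extendSec n e F)) (i3.const_mul 2)
    (fun z hz => by simp [(tz z hz).self_of_nhds])
    (fun x hx => by
      rw [curvPair, extendSec, Set.indicator_of_notMem hx]
      simp)
    (fun z hz => by
      rw [Complex.real_smul, g.density_mul_curvPair n hφ _ _ he hz, (hFe z hz).self_of_nhds])
  refine ⟨r1.1, r2.1, r3.1, ?_⟩
  rw [r1.2, r2.2, r3.2, integral_const_mul, integral_const_mul, integral_const_mul, ← mul_add]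
  congr 1
  exact integral_bochner hU hW (fun z hz => g.weight_pos n φ he hz) hu hF.contDiffOn hs hc

/-- The energy inequality for smooth sections. -/
theorem energy_inequality_of_smooth (hφ : ContMDiff 𝓘(ℝ, ℂ) 𝓘(ℝ, ℝ) ∞ φ) {ι : Type*} [Fintype ι]
    {e : ι → OpenPartialHomeomorph X ℂ} (he : ∀ i, e i ∈ atlas ℂ X) {F : ι → ℂ → ℂ}
    (hF : ∀ i, ContDiff ℝ ∞ (F i)) (hc : ∀ i, HasCompactSupport (F i))
    (hs : ∀ i, tsupport (F i) ⊆ (e i).target) :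
    Integrable (fun x => 2 * g.baseWeight n φ x / g.baseDensity x *
      ‖∑ i, extendFrm n (e i) (wirtinger Complex.I (F i)) x‖ ^ 2) g.area ∧
    Integrable (fun x => n * (g.laplacian φ x - g.gaussCurvature x) *
      (g.baseWeight n φ x * ‖∑ i, extendSec n (e i) (F i) x‖ ^ 2)) g.area ∧
    ∫ x, n * (g.laplacian φ x - g.gaussCurvature x) *
      (g.baseWeight n φ x * ‖∑ i, extendSec n (e i) (F i) x‖ ^ 2) ∂g.area ≤
    ∫ x, 2 * g.baseWeight n φ x / g.baseDensity x *
      ‖∑ i, extendFrm n (e i) (wirtinger Complex.I (F i)) x‖ ^ 2 ∂g.area := by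
  set u : X → ℂ := fun x => ∑ i, extendSec n (e i) (F i) x with hu
  have hus : ∀ e' ∈ atlas ℂ X, ContDiffOn ℝ ∞ (secCoeff n e' u) e'.target := by
    intro e' he'
    rw [hu, secCoeff_sum]
    exact ContDiffOn.sum fun i _ =>
      secCoeff_extendSec_contDiffOn n (he i) he' (hF i) (hc i) (hs i)
  have hdi : ∀ x i, DifferentiableAt ℝ (secCoeff n (chartAt ℂ x) (extendSec n (e i) (F i)))
      (chartAt ℂ x x) := fun x i =>
    ((secCoeff_extendSec_contDiffOn n (he i) (chart_mem_atlas ℂ x) (hF i) (hc i)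
      (hs i)).contDiffAt ((chartAt ℂ x).open_target.mem_nhds
        (mem_chart_target ℂ x))).differentiableAt (by simp)
  have hdbar : dbarAt n u = fun x => ∑ i, dbarAt n (extendSec n (e i) (F i)) x := by
    ext x
    rw [dbarAt, hu, secCoeff_sum, wirtinger_sum _ _ fun i _ => hdi x i]
    rfl
  have hdel : g.delAt n φ u = fun x => ∑ i, g.delAt n φ (extendSec n (e i) (F i)) x := by
    ext x
    have hWd : DifferentiableAt ℝ (fun z => (g.weight n φ (chartAt ℂ x) z : ℂ))
        (chartAt ℂ x x) :=
      ((contDiffOn_ofReal (g.weight_contDiffOn n hφ (chart_mem_atlas ℂ x))).contDiffAt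
        ((chartAt ℂ x).open_target.mem_nhds (mem_chart_target ℂ x))).differentiableAt (by simp)
    rw [delAt, hu, secCoeff_sum]
    simp only [Finset.mul_sum]
    exact wirtinger_sum _ _ fun i _ => hWd.mul (hdi x i)
  -- Only the second slot must be supported in a chart, so the full section stays in the first and
  -- no cross terms between charts arise.
  have B := fun i => g.integral_formPair_extendSec n hφ (he i) (hus _ (he i)) (hF i) (hc i) (hs i)
  have p1 : g.formPair n φ (dbarAt n u) (dbarAt n u) = fun x => ∑ i,
      g.formPair n φ (dbarAt n u) (dbarAt n (extendSec n (e i) (F i))) x := by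
    ext x
    simp only [formPair, ← Finset.mul_sum, ← map_sum]
    rw [hdbar]
  have p2 : g.delPair n φ (g.delAt n φ u) (g.delAt n φ u) = fun x => ∑ i,
      g.delPair n φ (g.delAt n φ u) (g.delAt n φ (extendSec n (e i) (F i))) x := by
    ext x
    simp only [delPair, ← Finset.mul_sum, ← map_sum]
    rw [hdel]
  have p3 : g.curvPair n φ u u = fun x => ∑ i,
      g.curvPair n φ u (extendSec n (e i) (F i)) x := by
    ext x
    simp only [curvPair, ← Finset.mul_sum, ← map_sum]
    rfl
  have hform : ∀ x, ∑ i, extendFrm n (e i) (wirtinger Complex.I (F i)) x = dbarAt n u x := by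
    intro x
    rw [hdbar]
    exact Finset.sum_congr rfl fun i _ => by
      rw [dbarAt_extendSec n (he i) (hF i) (hc i) (hs i)]
  have q1 : Integrable (g.formPair n φ (dbarAt n u) (dbarAt n u)) g.area := by
    rw [p1]; exact integrable_finsetSum _ fun i _ => (B i).1
  have q3 : Integrable (g.curvPair n φ u u) g.area := by
    rw [p3]; exact integrable_finsetSum _ fun i _ => (B i).2.2.1
  have key : ∫ x, g.formPair n φ (dbarAt n u) (dbarAt n u) x ∂g.area =
      (∫ x, g.delPair n φ (g.delAt n φ u) (g.delAt n φ u) x ∂g.area) +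
      ∫ x, g.curvPair n φ u u x ∂g.area := by
    rw [p1, p2, p3, integral_finsetSum _ fun i _ => (B i).1,
      integral_finsetSum _ fun i _ => (B i).2.1, integral_finsetSum _ fun i _ => (B i).2.2.1,
      ← Finset.sum_add_distrib]
    exact Finset.sum_congr rfl fun i _ => (B i).2.2.2
  simp only [formPair_self, delPair_self, curvPair_self, integral_complex_ofReal] at key
  have q1' := q1.re
  have q3' := q3.re
  simp only [hform]
  refine ⟨q1'.congr (ae_of_all _ fun x => ?_), q3'.congr (ae_of_all _ fun x => ?_), ?_⟩
  · simp only [formPair_self]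
    exact Complex.ofReal_re _
  · simp only [curvPair_self]
    exact Complex.ofReal_re _
  · have key' := congrArg Complex.re key
    rw [Complex.add_re, Complex.ofReal_re, Complex.ofReal_re, Complex.ofReal_re] at key'
    rw [key']
    -- The square of ∂(Wu) is discarded here; this is the only inequality in the smooth case.
    refine le_add_of_nonneg_left (integral_nonneg fun x => ?_)
    have h1 := g.baseWeight_pos n φ x
    have h2 := g.baseDensity_pos x
    positivity

end ConformalMetric

end

section

/-! ### Weak derivatives in the plane -/

theorem integrable_mul_of_locallyIntegrableOn {b χ : ℂ → ℂ} {U : Set ℂ}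
    (hb : LocallyIntegrableOn b U) (hχ : Continuous χ) (hc : HasCompactSupport χ)
    (hs : tsupport χ ⊆ U) : Integrable fun z => b z * χ z := by
  have h1 : IntegrableOn (fun z => b z * χ z) (tsupport χ) :=
    (hb.integrableOn_compact_subset hs hc).mul_continuousOn hχ.continuousOn hc
  refine (integrableOn_iff_integrable_of_support_subset ?_).1 h1
  exact (Function.support_mul_subset_right _ _).trans (subset_tsupport χ)

theorem setIntegral_mul_of_tsupport {b χ : ℂ → ℂ} {U : Set ℂ} (hs : tsupport χ ⊆ U) :
    ∫ z in U, b z * χ z = ∫ z, b z * χ z :=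
  setIntegral_eq_integral_of_forall_compl_eq_zero fun z hz => by
    rw [image_eq_zero_of_notMem_tsupport fun h => hz (hs h), mul_zero]

theorem IsWeakPartialZBar.congr {U : Set ℂ} (hU : IsOpen U) {f f' b b' : ℂ → ℂ}
    (h : IsWeakPartialZBar U f b) (hf : Set.EqOn f f' U) (hb : Set.EqOn b b' U) :
    IsWeakPartialZBar U f' b' := by
  have hli : ∀ {f f' : ℂ → ℂ}, LocallyIntegrableOn f U → Set.EqOn f f' U →
      LocallyIntegrableOn f' U := by
    intro f f' hl he
    rw [locallyIntegrableOn_iff hU.isLocallyClosed] at hl ⊢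
    exact fun K hKU hK => (hl K hKU hK).congr_fun (he.mono hKU) hK.measurableSet
  refine ⟨hli h.1 hf, hli h.2.1 hb, fun χ h1 h2 h3 => ?_⟩
  have := h.2.2 χ h1 h2 h3
  have e1 : ∫ z in U, f' z * partialZBar χ z = ∫ z in U, f z * partialZBar χ z :=
    setIntegral_congr_fun hU.measurableSet fun z hz => by simp only [hf hz]
  have e2 : ∫ z in U, b' z * χ z = ∫ z in U, b z * χ z :=
    setIntegral_congr_fun hU.measurableSet fun z hz => by simp only [hb hz]
  rw [e1, e2, this]

/-- Weak derivatives are unique. -/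
theorem IsWeakPartialZBar.ae_eq {U : Set ℂ} (hU : IsOpen U) {f b b' : ℂ → ℂ}
    (h : IsWeakPartialZBar U f b) (h' : IsWeakPartialZBar U f b') :
    ∀ᵐ z ∂volume.restrict U, b z = b' z := by
  rw [ae_restrict_iff' hU.measurableSet]
  -- Real test functions already determine a locally integrable function; each is fed into the weak
  -- equations as a complex one.
  have key := hU.ae_eq_zero_of_integral_contDiff_smul_eq_zero (μ := volume)
    (h.2.1.sub h'.2.1) fun χ h1 h2 h3 => ?_
  · filter_upwards [key] with z hz hzU
    exact sub_eq_zero.1 (hz hzU)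
  · have hχ : ContDiff ℝ ∞ fun z => (χ z : ℂ) := Complex.ofRealCLM.contDiff.comp h1
    have hχc : HasCompactSupport fun z => (χ z : ℂ) :=
      h2.comp_left (g := ((↑) : ℝ → ℂ)) (by simp)
    have hχs : tsupport (fun z => (χ z : ℂ)) ⊆ U := by
      have : tsupport (fun z => (χ z : ℂ)) = tsupport χ := by simp [tsupport, Function.support]
      rwa [this]
    have e1 := h.2.2 _ hχ hχc hχs
    rw [h'.2.2 _ hχ hχc hχs, neg_inj, setIntegral_mul_of_tsupport hχs,
      setIntegral_mul_of_tsupport hχs] at e1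
    have e2 : ∀ z, χ z • (b - b') z = b z * (χ z : ℂ) - b' z * (χ z : ℂ) := fun z => by
      simp only [Pi.sub_apply, Complex.real_smul]; ring
    simp only [e2]
    rw [integral_sub (integrable_mul_of_locallyIntegrableOn h.2.1 hχ.continuous hχc hχs)
      (integrable_mul_of_locallyIntegrableOn h'.2.1 hχ.continuous hχc hχs), e1, sub_self]

/-- The product rule for a weak derivative and a smooth function with compact support. -/
theorem IsWeakPartialZBar.mul {U : Set ℂ} {f b : ℂ → ℂ}
    (h : IsWeakPartialZBar U f b) {θ : ℂ → ℂ} (hθ : ContDiff ℝ ∞ θ)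
    (hc : HasCompactSupport θ) (hs : tsupport θ ⊆ U) {χ : ℂ → ℂ} (hχ : ContDiff ℝ ∞ χ) :
    ∫ z, (θ z * f z) * partialZBar χ z =
      -∫ z, (θ z * b z + wirtinger Complex.I θ z * f z) * χ z := by
  have hsub : tsupport (fun z => θ z * χ z) ⊆ tsupport θ := tsupport_mul_subset_left
  have hθχ : ContDiff ℝ ∞ fun z => θ z * χ z := hθ.mul hχ
  have hθχc : HasCompactSupport fun z => θ z * χ z := hc.mul_right
  -- The weak equation is tested with θχ. Since θ carries the compact support inside `U`, χ may be
  -- any smooth function on the plane.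
  have key := h.2.2 _ hθχ hθχc (hsub.trans hs)
  have hpz : ∀ z, partialZBar (fun z => θ z * χ z) z =
      wirtinger Complex.I θ z * χ z + θ z * partialZBar χ z := fun z =>
    wirtinger_mul _ (hθ.differentiable (by simp) z) (hχ.differentiable (by simp) z)
  have hd := (tsupport_wirtinger_subset Complex.I fun z => θ z * χ z)
  rw [partialZBar_eq_wirtinger] at key
  rw [setIntegral_mul_of_tsupport (hd.trans (hsub.trans hs)),
    setIntegral_mul_of_tsupport (hsub.trans hs)] at key
  have i1 : Integrable fun z => f z * (wirtinger Complex.I θ z * χ z) :=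
    integrable_mul_of_locallyIntegrableOn h.1
      ((wirtinger_contDiff _ hθ).continuous.mul hχ.continuous)
      (HasCompactSupport.mul_right
        (hc.of_isClosed_subset (isClosed_tsupport _) (tsupport_wirtinger_subset _ θ)))
      ((tsupport_mul_subset_left.trans (tsupport_wirtinger_subset _ θ)).trans hs)
  have i2 : Integrable fun z => f z * (θ z * partialZBar χ z) :=
    integrable_mul_of_locallyIntegrableOn h.1
      (hθ.continuous.mul (wirtinger_contDiff _ hχ).continuous) hc.mul_right
      (tsupport_mul_subset_left.trans hs)
  have i3 : Integrable fun z => b z * (θ z * χ z) :=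
    integrable_mul_of_locallyIntegrableOn h.2.1 hθχ.continuous hθχc (hsub.trans hs)
  have e1 : ∫ z, f z * wirtinger Complex.I (fun z => θ z * χ z) z =
      (∫ z, f z * (wirtinger Complex.I θ z * χ z)) + ∫ z, f z * (θ z * partialZBar χ z) := by
    rw [← integral_add i1 i2]
    congr 1; ext z
    rw [← partialZBar_eq_wirtinger, hpz]; ring
  have e2 : ∫ z, (θ z * b z + wirtinger Complex.I θ z * f z) * χ z =
      (∫ z, b z * (θ z * χ z)) + ∫ z, f z * (wirtinger Complex.I θ z * χ z) := by
    rw [← integral_add i3 i1]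
    congr 1; ext z; ring
  have e3 : ∫ z, (θ z * f z) * partialZBar χ z = ∫ z, f z * (θ z * partialZBar χ z) := by
    congr 1; ext z; ring
  rw [e2, e3]
  rw [e1] at key
  linear_combination key

/-- The positive weight is bounded below on the compact support of θ, so |θ|² is at most a constant
times w. -/
theorem memLp_mul_of_tsupport {U : Set ℂ} (hU : IsOpen U) {θ f : ℂ → ℂ} {w : ℂ → ℝ}
    (hθ : Continuous θ) (hc : HasCompactSupport θ) (hs : tsupport θ ⊆ U)
    (hw : ContinuousOn w U) (hpos : ∀ z ∈ U, 0 < w z)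
    (hf : AEStronglyMeasurable f (volume.restrict U))
    (hi : IntegrableOn (fun z => w z * ‖f z‖ ^ 2) U) : MemLp (fun z => θ z * f z) 2 := by
  have h0 : ∀ z ∉ U, θ z = 0 := fun z hz =>
    image_eq_zero_of_notMem_tsupport fun h => hz (hs h)
  have hm : AEStronglyMeasurable (fun z => θ z * f z) := by
    have : (fun z => θ z * f z) = U.indicator fun z => θ z * f z := by
      ext z
      by_cases hz : z ∈ U
      · rw [Set.indicator_of_mem hz]
      · rw [Set.indicator_of_notMem hz, h0 z hz, zero_mul]
    rw [this, aestronglyMeasurable_indicator_iff hU.measurableSet]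
    exact hθ.aestronglyMeasurable.mul hf
  rw [memLp_two_iff_integrable_sq_norm hm]
  -- This is |θ|²/w. Splitting off the last factor θ exhibits it as continuous on the whole plane
  -- with compact support, hence bounded.
  have hcont : Continuous fun z => ((w z : ℂ)⁻¹ * conj (θ z)) * θ z :=
    continuous_mul_of_tsupport hU
      (((Complex.continuous_ofReal.comp_continuousOn hw).inv₀ fun z hz => by
        exact Complex.ofReal_ne_zero.2 (hpos z hz).ne').mul (Complex.continuous_conj.comp hθ).continuousOn)
      hθ.continuousOn hs
  obtain ⟨C, hC⟩ := hcont.bounded_above_of_compact_support hc.mul_left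
  have h1 : IntegrableOn (fun z => ‖θ z * f z‖ ^ 2) U := by
    refine Integrable.mono' (hi.const_mul C) (hm.restrict.norm.pow 2) ?_
    filter_upwards [ae_restrict_mem hU.measurableSet] with z hz
    have hw := hpos z hz
    have h2 := hC z
    rw [norm_mul, norm_mul, RCLike.norm_conj, norm_inv, Complex.norm_real,
      Real.norm_of_nonneg hw.le] at h2
    rw [Real.norm_of_nonneg (by positivity), norm_mul, mul_pow]
    calc ‖θ z‖ ^ 2 * ‖f z‖ ^ 2 = ((w z)⁻¹ * ‖θ z‖ * ‖θ z‖) * (w z * ‖f z‖ ^ 2) := by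
          field_simp
      _ ≤ C * (w z * ‖f z‖ ^ 2) := by gcongr
  refine (integrableOn_iff_integrable_of_support_subset fun z hz => ?_).1 h1
  by_contra h
  exact hz (by simp [h0 z h])

/-- Weighted `L²` norms are controlled by the unweighted ones on compact sets. -/
theorem exists_integral_weight_le {U K : Set ℂ} (hK : IsCompact K)
    (hKU : K ⊆ U) {w : ℂ → ℝ} (hw : ContinuousOn w U) (hpos : ∀ z ∈ U, 0 < w z) :
    ∃ C : ℝ, 0 < C ∧ ∀ h : ℂ → ℂ, AEStronglyMeasurable h → (∀ z ∉ K, h z = 0) → ∀ ε : ℝ, 0 ≤ ε →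
      ∫⁻ z, ‖h z‖ₑ ^ 2 ≤ ENNReal.ofReal ε →
      Integrable (fun z => w z * ‖h z‖ ^ 2) ∧ ∫ z, w z * ‖h z‖ ^ 2 ≤ C * ε := by
  obtain ⟨C, hC⟩ := hK.exists_bound_of_continuousOn (hw.mono hKU)
  refine ⟨max C 1, by positivity, fun h hh h0 ε hε hb => ?_⟩
  have hnn : ∀ z, ‖h z‖ₑ ^ 2 = ENNReal.ofReal (‖h z‖ ^ 2) := fun z => by
    rw [ENNReal.ofReal_pow (norm_nonneg _), ofReal_norm]
  simp only [hnn] at hb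
  have hm : AEStronglyMeasurable (fun z => ‖h z‖ ^ 2) := hh.norm.pow 2
  have hi : Integrable fun z => ‖h z‖ ^ 2 := by
    refine ⟨hm, ?_⟩
    rw [hasFiniteIntegral_iff_ofReal (ae_of_all _ fun z => by positivity)]
    exact hb.trans_lt ENNReal.ofReal_lt_top
  have hle : ∫ z, ‖h z‖ ^ 2 ≤ ε := by
    rw [integral_eq_lintegral_of_nonneg_ae (ae_of_all _ fun z => by positivity) hm]
    exact ENNReal.toReal_le_of_le_ofReal hε hb
  have hbd : ∀ z, w z * ‖h z‖ ^ 2 ≤ max C 1 * ‖h z‖ ^ 2 := fun z => by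
    by_cases hz : z ∈ K
    · gcongr
      exact ((le_abs_self _).trans (hC z hz)).trans (le_max_left _ _)
    · simp [h0 z hz]
  have hnonneg : ∀ z, 0 ≤ w z * ‖h z‖ ^ 2 := fun z => by
    by_cases hz : z ∈ K
    · have := hpos z (hKU hz); positivity
    · simp [h0 z hz]
  have hwm : AEStronglyMeasurable fun z => w z * ‖h z‖ ^ 2 := by
    have : (fun z => w z * ‖h z‖ ^ 2) = K.indicator fun z => w z * ‖h z‖ ^ 2 := by
      ext z
      by_cases hz : z ∈ K
      · rw [Set.indicator_of_mem hz]
      · rw [Set.indicator_of_notMem hz, h0 z hz]; simp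
    rw [this, aestronglyMeasurable_indicator_iff hK.measurableSet]
    exact ((hw.mono hKU).aestronglyMeasurable hK.measurableSet).mul hm.restrict
  have hiw : Integrable fun z => w z * ‖h z‖ ^ 2 :=
    (hi.const_mul (max C 1)).mono' hwm (ae_of_all _ fun z => by
      rw [Real.norm_of_nonneg (hnonneg z)]; exact hbd z)
  refine ⟨hiw, ?_⟩
  calc ∫ z, w z * ‖h z‖ ^ 2 ≤ ∫ z, max C 1 * ‖h z‖ ^ 2 :=
        integral_mono hiw (hi.const_mul _) hbd
    _ = max C 1 * ∫ z, ‖h z‖ ^ 2 := integral_const_mul _ _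
    _ ≤ max C 1 * ε := by gcongr

end

section

variable {X : Type*} [TopologicalSpace X] [ChartedSpace ℂ X] [IsManifold 𝓘(ℂ) ω X]

/-! ### Cutoff functions -/

/-- The coordinate expression of a function that is supported in the domain of the chart `e`. -/
def chartFun (e : OpenPartialHomeomorph X ℂ) (χ : X → ℝ) : ℂ → ℂ :=
  e.target.indicator fun z => (χ (e.symm z) : ℂ)

omit [ChartedSpace ℂ X] [IsManifold 𝓘(ℂ) ω X] in
theorem chartFun_of_mem {e : OpenPartialHomeomorph X ℂ} {χ : X → ℝ} {z : ℂ} (hz : z ∈ e.target) :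
    chartFun e χ z = χ (e.symm z) := Set.indicator_of_mem hz _

omit [IsManifold 𝓘(ℂ) ω X] in
theorem chartFun_eq_secCoeff {e : OpenPartialHomeomorph X ℂ} {χ : X → ℝ} {z : ℂ}
    (hz : z ∈ e.target) : chartFun e χ z = secCoeff 0 e (fun x => (χ x : ℂ)) z := by
  rw [chartFun_of_mem hz, secCoeff, pow_zero, one_mul]

omit [ChartedSpace ℂ X] [IsManifold 𝓘(ℂ) ω X] in
theorem tsupport_chartFun [CompactSpace X] {e : OpenPartialHomeomorph X ℂ} {χ : X → ℝ}
    (hs : tsupport χ ⊆ e.source) :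
    HasCompactSupport (chartFun e χ) ∧ tsupport (chartFun e χ) ⊆ e.target := by
  have hK : IsCompact (e '' tsupport χ) :=
    (isClosed_tsupport χ).isCompact.image_of_continuousOn (e.continuousOn.mono hs)
  have hsub : tsupport (chartFun e χ) ⊆ e '' tsupport χ := by
    refine closure_minimal (fun z hz => ?_) hK.isClosed
    have hze : z ∈ e.target := by
      by_contra h
      exact hz (Set.indicator_of_notMem h _)
    rw [Function.mem_support, chartFun_of_mem hze] at hz
    exact ⟨e.symm z, subset_tsupport _ fun h => hz (by simp [h]), e.right_inv hze⟩
  refine ⟨hK.of_isClosed_subset (isClosed_tsupport _) hsub, hsub.trans ?_⟩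
  rintro - ⟨x, hx, rfl⟩
  exact e.map_source (hs hx)

theorem chartFun_contDiff [CompactSpace X] {e : OpenPartialHomeomorph X ℂ} (he : e ∈ atlas ℂ X)
    {χ : X → ℝ} (hχ : ContMDiff 𝓘(ℝ, ℂ) 𝓘(ℝ, ℝ) ∞ χ) (hs : tsupport χ ⊆ e.source) :
    ContDiff ℝ ∞ (chartFun e χ) := by
  rw [contDiff_iff_contDiffAt]
  intro z
  by_cases hz : z ∈ e.target
  · refine ((contDiffOn_ofReal (contDiffOn_comp_symm hχ he)).contDiffAt
      (e.open_target.mem_nhds hz)).congr_of_eventuallyEq ?_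
    filter_upwards [e.open_target.mem_nhds hz] with w hw
    exact chartFun_of_mem hw
  · exact contDiffAt_const.congr_of_eventuallyEq
      (notMem_tsupport_iff_eventuallyEq.1 fun h => hz ((tsupport_chartFun hs).2 h))

/-- Functions are sections of the power n = 0, so the same operator gives the scalar form ∂̄χ. -/
theorem frmCoeff_dbarAt_zero {e : OpenPartialHomeomorph X ℂ} (he : e ∈ atlas ℂ X)
    {χ : X → ℝ} (hχ : ContMDiff 𝓘(ℝ, ℂ) 𝓘(ℝ, ℝ) ∞ χ) {z : ℂ} (hz : z ∈ e.target) :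
    frmCoeff 0 e (dbarAt 0 fun x => (χ x : ℂ)) z = wirtinger Complex.I (chartFun e χ) z := by
  have hEq : secCoeff 0 e (fun x => (χ x : ℂ)) =ᶠ[𝓝 z] chartFun e χ := by
    filter_upwards [e.open_target.mem_nhds hz] with w hw
    exact (chartFun_eq_secCoeff hw).symm
  have hd : DifferentiableAt ℝ (secCoeff 0 e fun x => (χ x : ℂ)) z := by
    have h1 : DifferentiableAt ℝ (fun z => (χ (e.symm z) : ℂ)) z :=
      ((contDiffOn_ofReal (contDiffOn_comp_symm hχ he)).contDiffAt
        (e.open_target.mem_nhds hz)).differentiableAt (by simp)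
    refine h1.congr_of_eventuallyEq (Eventually.of_forall fun w => ?_)
    rw [secCoeff, pow_zero, one_mul]
  rw [frmCoeff_dbarAt 0 _ he hz hd, wirtinger_congr _ hEq]

omit [IsManifold 𝓘(ℂ) ω X] in
theorem secCoeff_smul (n : ℕ) (e : OpenPartialHomeomorph X ℂ) (χ : X → ℝ) (u : X → ℂ) {z : ℂ}
    (hz : z ∈ e.target) :
    secCoeff n e (fun x => χ x * u x) z = chartFun e χ z * secCoeff n e u z := by
  rw [chartFun_of_mem hz, secCoeff, secCoeff]
  ring

/-- The scalar form ∂̄χ supplies the conjugate factor and u the inverse n-th power; together they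
give the law of an E-valued form, so the product rule is independent of the chart. -/
theorem frmCoeff_leibniz (n : ℕ) {e : OpenPartialHomeomorph X ℂ} (he : e ∈ atlas ℂ X)
    {χ : X → ℝ} (hχ : ContMDiff 𝓘(ℝ, ℂ) 𝓘(ℝ, ℝ) ∞ χ) (u v : X → ℂ) {z : ℂ} (hz : z ∈ e.target) :
    frmCoeff n e (fun x => χ x * v x + dbarAt 0 (fun x => (χ x : ℂ)) x * u x) z =
      chartFun e χ z * frmCoeff n e v z +
        wirtinger Complex.I (chartFun e χ) z * secCoeff n e u z := by
  rw [← frmCoeff_dbarAt_zero he hχ hz, chartFun_of_mem hz, frmCoeff, frmCoeff, frmCoeff, secCoeff]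
  ring

omit [IsManifold 𝓘(ℂ) ω X] in
theorem dbarAt_zero_eq_zero_of_notMem {χ : X → ℝ} {x : X} (hx : x ∉ tsupport χ) :
    dbarAt 0 (fun x => (χ x : ℂ)) x = 0 := by
  refine wirtinger_eq_zero _ ?_
  have h := (((chartAt ℂ x).continuousAt_symm (mem_chart_target ℂ x))).eventually
    (p := fun y => χ y = 0) (by
      rw [(chartAt ℂ x).left_inv (mem_chart_source ℂ x)]
      exact notMem_tsupport_iff_eventuallyEq.1 hx)
  filter_upwards [h] with w hw
  simp [secCoeff, hw]

/-- The sum is ∂̄ of the constant 1. -/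
theorem sum_dbarAt_zero {ι : Type*} [Fintype ι] {χ : ι → X → ℝ}
    (hχ : ∀ i, ContMDiff 𝓘(ℝ, ℂ) 𝓘(ℝ, ℝ) ∞ (χ i)) (hsum : ∀ x, ∑ i, χ i x = 1) (x : X) :
    ∑ i, dbarAt 0 (fun x => (χ i x : ℂ)) x = 0 := by
  have hd : ∀ i ∈ Finset.univ,
      DifferentiableAt ℝ (secCoeff 0 (chartAt ℂ x) fun x => (χ i x : ℂ)) (chartAt ℂ x x) := by
    intro i _
    have h1 : DifferentiableAt ℝ (fun z => (χ i ((chartAt ℂ x).symm z) : ℂ)) (chartAt ℂ x x) :=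
      ((contDiffOn_ofReal (contDiffOn_comp_symm (hχ i) (chart_mem_atlas ℂ x))).contDiffAt
        ((chartAt ℂ x).open_target.mem_nhds (mem_chart_target ℂ x))).differentiableAt (by simp)
    refine h1.congr_of_eventuallyEq (Eventually.of_forall fun w => ?_)
    rw [secCoeff, pow_zero, one_mul]
  have h1 := wirtinger_sum Complex.I Finset.univ hd
  refine h1.symm.trans ?_
  have h2 : (fun z => ∑ i, secCoeff 0 (chartAt ℂ x) (fun x => (χ i x : ℂ)) z) = fun _ => 1 := by
    ext z
    simp only [secCoeff, pow_zero, one_mul]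
    exact_mod_cast hsum _
  rw [h2]
  simp [wirtinger]

namespace ConformalMetric

variable (g : ConformalMetric X) (n : ℕ) {φ : X → ℝ}

theorem baseWeight_mul_normSq (φ : X → ℝ) (u : X → ℂ) {e : OpenPartialHomeomorph X ℂ}
    (he : e ∈ atlas ℂ X) {z : ℂ} (hz : z ∈ e.target) :
    g.baseWeight n φ (e.symm z) * ‖u (e.symm z)‖ ^ 2 =
      g.weight n φ e z * ‖secCoeff n e u z‖ ^ 2 := by
  have h := g.weight_mul_secCoeff n φ u u he hz
  rw [mul_assoc, Complex.mul_conj', Complex.mul_conj'] at h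
  exact_mod_cast h.symm

theorem density_mul_normSq (φ : X → ℝ) (v : X → ℂ) {e : OpenPartialHomeomorph X ℂ}
    (he : e ∈ atlas ℂ X) {z : ℂ} (hz : z ∈ e.target) :
    g.density e z * (2 * g.baseWeight n φ (e.symm z) / g.baseDensity (e.symm z) *
      ‖v (e.symm z)‖ ^ 2) = 2 * g.weight n φ e z * ‖frmCoeff n e v z‖ ^ 2 := by
  have h := g.density_mul_formPair n φ v v he hz
  rw [g.formPair_self, mul_assoc, Complex.mul_conj'] at h
  rw [mul_assoc]
  exact_mod_cast h

variable [MeasurableSpace X] [BorelSpace X] [CompactSpace X]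

/-- Approximation, in the weighted norms, of a cut off section and its weak derivative. -/
theorem exists_local_approx (hφ : ContMDiff 𝓘(ℝ, ℂ) 𝓘(ℝ, ℝ) ∞ φ)
    {e : OpenPartialHomeomorph X ℂ} (he : e ∈ atlas ℂ X) {χ : X → ℝ}
    (hχ : ContMDiff 𝓘(ℝ, ℂ) 𝓘(ℝ, ℝ) ∞ χ) (hs : tsupport χ ⊆ e.source) {u v : X → ℂ}
    (hw : IsWeakPartialZBar e.target (secCoeff n e u) (frmCoeff n e v))
    (hu : Integrable (fun x => g.baseWeight n φ x * ‖u x‖ ^ 2) g.area)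
    (hv : Integrable (fun x => 2 * g.baseWeight n φ x / g.baseDensity x * ‖v x‖ ^ 2) g.area)
    {ε : ℝ} (hε : 0 < ε) :
    ∃ F : ℂ → ℂ, (ContDiff ℝ ∞ F ∧ HasCompactSupport F ∧ tsupport F ⊆ e.target) ∧
      (Integrable (fun x => g.baseWeight n φ x * ‖extendSec n e F x - χ x * u x‖ ^ 2) g.area ∧
        ∫ x, g.baseWeight n φ x * ‖extendSec n e F x - χ x * u x‖ ^ 2 ∂g.area ≤ ε) ∧
      (Integrable (fun x => 2 * g.baseWeight n φ x / g.baseDensity x *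
        ‖extendFrm n e (wirtinger Complex.I F) x -
          (χ x * v x + dbarAt 0 (fun x => (χ x : ℂ)) x * u x)‖ ^ 2) g.area ∧
        ∫ x, 2 * g.baseWeight n φ x / g.baseDensity x *
          ‖extendFrm n e (wirtinger Complex.I F) x -
            (χ x * v x + dbarAt 0 (fun x => (χ x : ℂ)) x * u x)‖ ^ 2 ∂g.area ≤ ε) := by
  have hU := e.open_target
  have hθ := chartFun_contDiff he hχ hs
  obtain ⟨hθc, hθs⟩ := tsupport_chartFun hs
  have hWc : ContinuousOn (g.weight n φ e) e.target := (g.weight_contDiffOn n hφ he).continuousOn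
  have hWp : ∀ z ∈ e.target, 0 < g.weight n φ e z := fun z hz => g.weight_pos n φ he hz
  have hρc : ContinuousOn (g.density e) e.target := (g.density_contDiffOn he).continuousOn
  have hρp : ∀ z ∈ e.target, 0 < g.density e z := fun z hz => g.density_pos he hz
  have w1c : ContinuousOn (fun z => g.density e z * g.weight n φ e z) e.target := hρc.mul hWc
  have w1p : ∀ z ∈ e.target, 0 < g.density e z * g.weight n φ e z := fun z hz =>
    mul_pos (hρp z hz) (hWp z hz)
  have w2c : ContinuousOn (fun z => 2 * g.weight n φ e z) e.target := continuousOn_const.mul hWc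
  have w2p : ∀ z ∈ e.target, 0 < 2 * g.weight n φ e z := fun z hz => by
    have := hWp z hz; positivity
  have mf : AEStronglyMeasurable (secCoeff n e u) (volume.restrict e.target) :=
    hw.1.aestronglyMeasurable
  have mb : AEStronglyMeasurable (frmCoeff n e v) (volume.restrict e.target) :=
    hw.2.1.aestronglyMeasurable
  have mW : AEStronglyMeasurable (g.weight n φ e) (volume.restrict e.target) :=
    hWc.aestronglyMeasurable hU.measurableSet
  have mρ : AEStronglyMeasurable (g.density e) (volume.restrict e.target) :=
    hρc.aestronglyMeasurable hU.measurableSet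
  have iu : IntegrableOn (fun z => (g.density e z * g.weight n φ e z) *
      ‖secCoeff n e u z‖ ^ 2) e.target := by
    have := (g.integrableOn_area_iff he (mW.mul (mf.norm.pow 2)) fun x hx => by
      have := g.baseWeight_mul_normSq n φ u he (e.map_source hx)
      rwa [e.left_inv hx] at this).1 hu.integrableOn
    refine this.congr_fun (fun z _ => ?_) hU.measurableSet
    simp only [Pi.mul_apply, Pi.pow_apply, smul_eq_mul]
    ring
  have iv : IntegrableOn (fun z => (2 * g.weight n φ e z) * ‖frmCoeff n e v z‖ ^ 2) e.target := by
    have := (g.integrableOn_area_iff he (G := fun z => (g.density e z)⁻¹ *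
        ((2 * g.weight n φ e z) * ‖frmCoeff n e v z‖ ^ 2))
      ((mρ.aemeasurable.inv.aestronglyMeasurable).mul ((mW.const_mul 2).mul (mb.norm.pow 2)))
      fun x hx => by
        have := g.density_mul_normSq n φ v he (e.map_source hx)
        rw [← this, inv_mul_cancel_left₀ (hρp _ (e.map_source hx)).ne', e.left_inv hx]).1
          hv.integrableOn
    refine this.congr_fun (fun z hz => ?_) hU.measurableSet
    simp only [smul_eq_mul]
    rw [mul_inv_cancel_left₀ (hρp z hz).ne']
  set θ := chartFun e χ with hθdef
  have hdθ := wirtinger_contDiff Complex.I hθ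
  have hdθs := tsupport_wirtinger_subset Complex.I θ
  set f : ℂ → ℂ := fun z => θ z * secCoeff n e u z with hf
  set b : ℂ → ℂ := fun z => θ z * frmCoeff n e v z +
    wirtinger Complex.I θ z * secCoeff n e u z with hb
  have Lf : MemLp f 2 := memLp_mul_of_tsupport hU hθ.continuous hθc hθs w1c w1p mf iu
  -- The two terms of the product rule are controlled by different weights: the derivative by 2W and
  -- the section by ρW.
  have Lb : MemLp b 2 :=
    (memLp_mul_of_tsupport hU hθ.continuous hθc hθs w2c w2p mb iv).add
      (memLp_mul_of_tsupport hU hdθ.continuous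
        (hθc.of_isClosed_subset (isClosed_tsupport _) hdθs) (hdθs.trans hθs) w1c w1p mf iu)
  have θ0 : ∀ z ∉ tsupport θ, θ z = 0 := fun z hz => image_eq_zero_of_notMem_tsupport hz
  have dθ0 : ∀ z ∉ tsupport θ, wirtinger Complex.I θ z = 0 := fun z hz =>
    image_eq_zero_of_notMem_tsupport fun h => hz (hdθs h)
  obtain ⟨K', hK', hK'U, hKK', happ⟩ := exists_smooth_approx Lf Lb hθc hU hθs
    (fun z hz => by rw [hf]; simp only; rw [θ0 z hz, zero_mul])
    (fun χ' hχ' _ => hw.mul hθ hθc hθs hχ')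
  obtain ⟨C1, hC1, bd1⟩ := exists_integral_weight_le hK' hK'U w1c w1p
  obtain ⟨C2, hC2, bd2⟩ := exists_integral_weight_le hK' hK'U w2c w2p
  -- With this choice both weighted errors, at most C1 η and C2 η, are bounded by ε.
  set η : ℝ := ε / max C1 C2 with hη
  have hη0 : 0 < η := by positivity
  have hη1 : C1 * η ≤ ε := by
    rw [hη, mul_div_assoc', div_le_iff₀ (by positivity), mul_comm]
    gcongr
    exact le_max_left _ _
  have hη2 : C2 * η ≤ ε := by
    rw [hη, mul_div_assoc', div_le_iff₀ (by positivity), mul_comm]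
    gcongr
    exact le_max_right _ _
  obtain ⟨F, hF, hFs, hF1, hF2⟩ := happ (ENNReal.ofReal η) (ENNReal.ofReal_pos.2 hη0)
  have hFc : HasCompactSupport F := hK'.of_isClosed_subset (isClosed_tsupport _) hFs
  have hdF := tsupport_wirtinger_subset Complex.I F
  have z1 : ∀ z ∉ K', F z - f z = 0 := fun z hz => by
    rw [image_eq_zero_of_notMem_tsupport fun h => hz (hFs h), hf]
    simp only
    rw [θ0 z fun h => hz (hKK' h), zero_mul, sub_zero]
  have z2 : ∀ z ∉ K', wirtinger Complex.I F z - b z = 0 := fun z hz => by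
    rw [image_eq_zero_of_notMem_tsupport fun h => hz (hFs (hdF h)), hb]
    simp only
    rw [θ0 z fun h => hz (hKK' h), dθ0 z fun h => hz (hKK' h)]
    simp
  have B1 := bd1 (fun z => F z - f z) (hF.continuous.aestronglyMeasurable.sub Lf.1) z1 η hη0.le hF1
  have B2 := bd2 (fun z => wirtinger Complex.I F z - b z)
    ((wirtinger_contDiff _ hF).continuous.aestronglyMeasurable.sub Lb.1) z2 η hη0.le hF2
  have χ0 : ∀ x ∉ e.source, χ x = 0 := fun x hx =>
    image_eq_zero_of_notMem_tsupport fun h => hx (hs h)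
  have dχ0 : ∀ x ∉ e.source, dbarAt 0 (fun x => (χ x : ℂ)) x = 0 := fun x hx =>
    dbarAt_zero_eq_zero_of_notMem fun h => hx (hs h)
  have R1 := g.integral_area_of_chart he
    (F := fun x => g.baseWeight n φ x * ‖extendSec n e F x - χ x * u x‖ ^ 2) B1.1
    (fun z hz => by rw [z1 z fun h => hz (hK'U h)]; simp)
    (fun x hx => by rw [extendSec, Set.indicator_of_notMem hx, χ0 x hx]; simp)
    (fun z hz => by
      have h := g.baseWeight_mul_normSq n φ (fun x => extendSec n e F x - χ x * u x) he hz
      have h2 : secCoeff n e (fun x => extendSec n e F x - χ x * u x) z = F z - f z := by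
        rw [hf]
        simp only
        rw [hθdef, ← secCoeff_smul n e χ u hz, ← secCoeff_extendSec n he F hz, secCoeff, secCoeff,
          secCoeff]
        ring
      rw [smul_eq_mul, h, h2, mul_assoc])
  have R2 := g.integral_area_of_chart he
    (F := fun x => 2 * g.baseWeight n φ x / g.baseDensity x *
      ‖extendFrm n e (wirtinger Complex.I F) x -
        (χ x * v x + dbarAt 0 (fun x => (χ x : ℂ)) x * u x)‖ ^ 2) B2.1
    (fun z hz => by rw [z2 z fun h => hz (hK'U h)]; simp)
    (fun x hx => by rw [extendFrm, Set.indicator_of_notMem hx, χ0 x hx, dχ0 x hx]; simp)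
    (fun z hz => by
      have h := g.density_mul_normSq n φ (fun x => extendFrm n e (wirtinger Complex.I F) x -
        (χ x * v x + dbarAt 0 (fun x => (χ x : ℂ)) x * u x)) he hz
      have h2 : frmCoeff n e (fun x => extendFrm n e (wirtinger Complex.I F) x -
          (χ x * v x + dbarAt 0 (fun x => (χ x : ℂ)) x * u x)) z =
          wirtinger Complex.I F z - b z := by
        rw [hb]
        simp only
        rw [hθdef, ← frmCoeff_leibniz n he hχ u v hz,
          ← frmCoeff_extendFrm n he (wirtinger Complex.I F) hz, frmCoeff, frmCoeff, frmCoeff]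
        ring
      rw [smul_eq_mul, h, h2])
  exact ⟨F, ⟨hF, hFc, hFs.trans hK'U⟩, ⟨R1.1, R1.2 ▸ B1.2.trans hη1⟩,
    ⟨R2.1, R2.2 ▸ B2.2.trans hη2⟩⟩

end ConformalMetric

end

section

/-! ### Passage to the limit -/

/-- The cross term 2|a||a' - a| is split by Young's inequality with parameter δ, so a small relative
error is traded for a large multiple of the squared distance. -/
theorem abs_normSq_sub_normSq_le (a a' : ℂ) {δ : ℝ} (hδ : 0 < δ) :
    |‖a'‖ ^ 2 - ‖a‖ ^ 2| ≤ δ * ‖a‖ ^ 2 + (1 + 1 / δ) * ‖a' - a‖ ^ 2 := by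
  have h1 : |‖a'‖ - ‖a‖| ≤ ‖a' - a‖ := abs_norm_sub_norm_le a' a
  have h2 : ‖a'‖ + ‖a‖ ≤ 2 * ‖a‖ + ‖a' - a‖ := by
    have := (le_abs_self _).trans h1
    linarith
  have h3 : 2 * ‖a‖ * ‖a' - a‖ ≤ δ * ‖a‖ ^ 2 + 1 / δ * ‖a' - a‖ ^ 2 := by
    have h4 : 0 ≤ (δ * ‖a‖ - ‖a' - a‖) ^ 2 / δ := by positivity
    have h5 : (δ * ‖a‖ - ‖a' - a‖) ^ 2 / δ =
        δ * ‖a‖ ^ 2 + 1 / δ * ‖a' - a‖ ^ 2 - 2 * ‖a‖ * ‖a' - a‖ := by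
      field_simp
      ring
    linarith
  calc |‖a'‖ ^ 2 - ‖a‖ ^ 2| = |‖a'‖ - ‖a‖| * (‖a'‖ + ‖a‖) := by
        rw [sq_sub_sq, abs_mul, abs_of_nonneg (by positivity : 0 ≤ ‖a'‖ + ‖a‖), mul_comm]
    _ ≤ ‖a' - a‖ * (2 * ‖a‖ + ‖a' - a‖) := by gcongr
    _ ≤ _ := by linarith

/-- A quadratic integral inequality passes to limits in weighted `L²` spaces. -/
theorem integral_le_of_approx {Y : Type*} [MeasurableSpace Y] {μ : Measure Y} {w₁ w₂ κ : Y → ℝ}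
    {M : ℝ} (h₁ : ∀ x, 0 ≤ w₁ x) (h₂ : ∀ x, 0 ≤ w₂ x) (hκ : ∀ x, |κ x| ≤ M) {u v : Y → ℂ}
    (hu : Integrable (fun x => w₁ x * ‖u x‖ ^ 2) μ)
    (hκu : Integrable (fun x => κ x * (w₁ x * ‖u x‖ ^ 2)) μ)
    (hv : Integrable (fun x => w₂ x * ‖v x‖ ^ 2) μ)
    (happ : ∀ ε : ℝ, 0 < ε → ∃ (u' v' : Y → ℂ) (R₁ R₂ : Y → ℝ),
      (∀ x, w₁ x * ‖u' x - u x‖ ^ 2 ≤ R₁ x) ∧ Integrable R₁ μ ∧ ∫ x, R₁ x ∂μ ≤ ε ∧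
      (∀ x, w₂ x * ‖v' x - v x‖ ^ 2 ≤ R₂ x) ∧ Integrable R₂ μ ∧ ∫ x, R₂ x ∂μ ≤ ε ∧
      Integrable (fun x => w₂ x * ‖v' x‖ ^ 2) μ ∧
      Integrable (fun x => κ x * (w₁ x * ‖u' x‖ ^ 2)) μ ∧
      ∫ x, κ x * (w₁ x * ‖u' x‖ ^ 2) ∂μ ≤ ∫ x, w₂ x * ‖v' x‖ ^ 2 ∂μ) :
    ∫ x, κ x * (w₁ x * ‖u x‖ ^ 2) ∂μ ≤ ∫ x, w₂ x * ‖v x‖ ^ 2 ∂μ := by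
  rcases isEmpty_or_nonempty Y with hY | ⟨⟨y⟩⟩
  · simp [Measure.eq_zero_of_isEmpty μ]
  have hM : 0 ≤ M := (abs_nonneg _).trans (hκ y)
  set A := ∫ x, κ x * (w₁ x * ‖u x‖ ^ 2) ∂μ with hA
  set B := ∫ x, w₂ x * ‖v x‖ ^ 2 ∂μ with hB
  set I := ∫ x, w₁ x * ‖u x‖ ^ 2 ∂μ with hI
  have key : ∀ δ : ℝ, 0 < δ → δ ≤ 1 → A ≤ B + δ * (M * I + 2 * M + B + 2) := by
    intro δ hδ hδ1
    -- Precision δ² compensates the factor 1 + 1/δ from Young's inequality: the product is at most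
    -- 2δ when δ ≤ 1.
    obtain ⟨u', v', R₁, R₂, r₁, i₁, b₁, r₂, i₂, b₂, iv', iu', hle⟩ := happ (δ ^ 2) (by positivity)
    have l₁ : Integrable (fun x => δ * (w₁ x * ‖u x‖ ^ 2) + (1 + 1 / δ) * R₁ x) μ :=
      (hu.const_mul δ).add (i₁.const_mul _)
    have l₂ : Integrable (fun x => δ * (w₂ x * ‖v x‖ ^ 2) + (1 + 1 / δ) * R₂ x) μ :=
      (hv.const_mul δ).add (i₂.const_mul _)
    have e1 : A ≤ ∫ x, (κ x * (w₁ x * ‖u' x‖ ^ 2) +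
        M * (δ * (w₁ x * ‖u x‖ ^ 2) + (1 + 1 / δ) * R₁ x)) ∂μ := by
      refine integral_mono hκu (iu'.add (l₁.const_mul M)) fun x => ?_
      have a1 := abs_normSq_sub_normSq_le (u x) (u' x) hδ
      have a2 : |κ x * (w₁ x * (‖u' x‖ ^ 2 - ‖u x‖ ^ 2))| ≤
          M * (δ * (w₁ x * ‖u x‖ ^ 2) + (1 + 1 / δ) * R₁ x) := by
        rw [abs_mul, abs_mul, abs_of_nonneg (h₁ x)]
        refine mul_le_mul (hκ x) ?_ (mul_nonneg (h₁ x) (abs_nonneg _)) hM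
        calc w₁ x * |‖u' x‖ ^ 2 - ‖u x‖ ^ 2| ≤
              w₁ x * (δ * ‖u x‖ ^ 2 + (1 + 1 / δ) * ‖u' x - u x‖ ^ 2) :=
                mul_le_mul_of_nonneg_left a1 (h₁ x)
          _ = δ * (w₁ x * ‖u x‖ ^ 2) + (1 + 1 / δ) * (w₁ x * ‖u' x - u x‖ ^ 2) := by ring
          _ ≤ _ := by gcongr; exact r₁ x
      have a3 := (abs_le.1 a2).1
      simp only
      linarith
    have e2 : ∫ x, w₂ x * ‖v' x‖ ^ 2 ∂μ ≤ ∫ x, (w₂ x * ‖v x‖ ^ 2 +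
        (δ * (w₂ x * ‖v x‖ ^ 2) + (1 + 1 / δ) * R₂ x)) ∂μ := by
      refine integral_mono iv' (hv.add l₂) fun x => ?_
      have a1 := (le_abs_self _).trans (abs_normSq_sub_normSq_le (v x) (v' x) hδ)
      have a2 : w₂ x * (‖v' x‖ ^ 2 - ‖v x‖ ^ 2) ≤
          δ * (w₂ x * ‖v x‖ ^ 2) + (1 + 1 / δ) * R₂ x := by
        calc w₂ x * (‖v' x‖ ^ 2 - ‖v x‖ ^ 2) ≤
              w₂ x * (δ * ‖v x‖ ^ 2 + (1 + 1 / δ) * ‖v' x - v x‖ ^ 2) :=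
                mul_le_mul_of_nonneg_left a1 (h₂ x)
          _ = δ * (w₂ x * ‖v x‖ ^ 2) + (1 + 1 / δ) * (w₂ x * ‖v' x - v x‖ ^ 2) := by ring
          _ ≤ _ := by gcongr; exact r₂ x
      simp only
      linarith
    rw [integral_add iu' (l₁.const_mul M),
      integral_const_mul, integral_add (hu.const_mul δ) (i₁.const_mul _), integral_const_mul,
      integral_const_mul, ← hI] at e1
    rw [integral_add hv l₂,
      integral_add (hv.const_mul δ) (i₂.const_mul _), integral_const_mul,
      integral_const_mul, ← hB] at e2
    have hsmall : ∀ r : ℝ, r ≤ δ ^ 2 → (1 + 1 / δ) * r ≤ 2 * δ := fun r hr => by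
      calc (1 + 1 / δ) * r ≤ (1 + 1 / δ) * δ ^ 2 := by gcongr
        _ = δ * δ + δ := by field_simp
        _ ≤ 2 * δ := by nlinarith
    have s1 := mul_le_mul_of_nonneg_left (add_le_add_right (hsmall _ b₁) (δ * I)) hM
    have s2 := hsmall _ b₂
    linarith
  have hlim : Tendsto (fun δ : ℝ => B + δ * (M * I + 2 * M + B + 2)) (𝓝[>] 0) (𝓝 B) := by
    have : Tendsto (fun δ : ℝ => B + δ * (M * I + 2 * M + B + 2)) (𝓝 0)
        (𝓝 (B + 0 * (M * I + 2 * M + B + 2))) := by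
      apply Continuous.tendsto
      fun_prop
    rw [zero_mul, add_zero] at this
    exact this.mono_left nhdsWithin_le_nhds
  refine ge_of_tendsto hlim ?_
  filter_upwards [Ioc_mem_nhdsGT (zero_lt_one' ℝ)] with δ hδ
  exact key δ hδ.1 hδ.2

variable {X : Type*} [TopologicalSpace X] [ChartedSpace ℂ X] [CompactSpace X]

theorem exists_finset_chart_cover :
    ∃ t : Finset X, ⋃ i : t, (chartAt ℂ (i : X)).source = Set.univ := by
  obtain ⟨t, -, ht⟩ := isCompact_univ.elim_nhds_subcover (fun x : X => (chartAt ℂ x).source)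
    fun x _ => (chartAt ℂ x).open_source.mem_nhds (mem_chart_source ℂ x)
  refine ⟨t, Set.eq_univ_of_univ_subset fun x hx => ?_⟩
  obtain ⟨i, hi, hxi⟩ := Set.mem_iUnion₂.1 (ht hx)
  exact Set.mem_iUnion.2 ⟨⟨i, hi⟩, hxi⟩

variable [IsManifold 𝓘(ℂ) ω X]

theorem exists_chart_partition [T2Space X] :
    ∃ (t : Finset X) (χ : t → X → ℝ), (∀ i, ContMDiff 𝓘(ℝ, ℂ) 𝓘(ℝ, ℝ) ∞ (χ i)) ∧
      (∀ i, tsupport (χ i) ⊆ (chartAt ℂ (i : X)).source) ∧ ∀ x, ∑ i, χ i x = 1 := by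
  obtain ⟨t, ht⟩ := exists_finset_chart_cover (X := X)
  have : IsManifold 𝓘(ℝ, ℂ) ∞ X := IsManifold.of_le (n := ω) le_top
  obtain ⟨f, hf⟩ := SmoothPartitionOfUnity.exists_isSubordinate 𝓘(ℝ, ℂ) isClosed_univ
    (fun i : t => (chartAt ℂ (i : X)).source) (fun i => (chartAt ℂ (i : X)).open_source) ht.ge
  refine ⟨t, fun i => f i, fun i => (f i).contMDiff, hf, fun x => ?_⟩
  rw [← finsum_eq_sum_of_fintype]
  exact f.sum_eq_one (Set.mem_univ x)

namespace ConformalMetric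

variable (g : ConformalMetric X) (n : ℕ) {φ : X → ℝ} [MeasurableSpace X] [BorelSpace X]

omit [BorelSpace X] in
theorem ae_area_of_charts {p : X → Prop}
    (h : ∀ e ∈ atlas ℂ X, ∀ᵐ x ∂g.area.restrict e.source, p x) : ∀ᵐ x ∂g.area, p x := by
  obtain ⟨t, ht⟩ := exists_finset_chart_cover (X := X)
  rw [← Measure.restrict_univ (μ := g.area), ← ht, ae_restrict_iUnion_iff]
  exact fun i => h _ (chart_mem_atlas ℂ _)

omit [BorelSpace X] in
theorem aestronglyMeasurable_of_charts {F : X → ℝ}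
    (h : ∀ e ∈ atlas ℂ X, AEStronglyMeasurable F (g.area.restrict e.source)) :
    AEStronglyMeasurable F g.area := by
  obtain ⟨t, ht⟩ := exists_finset_chart_cover (X := X)
  rw [← Measure.restrict_univ (μ := g.area), ← ht, aestronglyMeasurable_iUnion_iff]
  exact fun i => h _ (chart_mem_atlas ℂ _)

theorem aestronglyMeasurable_baseWeight_mul (hφ : ContMDiff 𝓘(ℝ, ℂ) 𝓘(ℝ, ℝ) ∞ φ) {u : X → ℂ}
    (hu : ∀ e ∈ atlas ℂ X, AEStronglyMeasurable (secCoeff n e u) (volume.restrict e.target)) :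
    AEStronglyMeasurable (fun x => g.baseWeight n φ x * ‖u x‖ ^ 2) g.area := by
  refine g.aestronglyMeasurable_of_charts fun e he => ?_
  refine g.aestronglyMeasurable_of_chart he
    (((g.weight_contDiffOn n hφ he).continuousOn.aestronglyMeasurable
      e.open_target.measurableSet).mul ((hu e he).norm.pow 2)) fun x hx => ?_
  have := g.baseWeight_mul_normSq n φ u he (e.map_source hx)
  rwa [e.left_inv hx] at this

theorem aestronglyMeasurable_formWeight_mul (hφ : ContMDiff 𝓘(ℝ, ℂ) 𝓘(ℝ, ℝ) ∞ φ) {v : X → ℂ}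
    (hv : ∀ e ∈ atlas ℂ X, AEStronglyMeasurable (frmCoeff n e v) (volume.restrict e.target)) :
    AEStronglyMeasurable
      (fun x => 2 * g.baseWeight n φ x / g.baseDensity x * ‖v x‖ ^ 2) g.area := by
  refine g.aestronglyMeasurable_of_charts fun e he => ?_
  refine g.aestronglyMeasurable_of_chart he (G := fun z => (g.density e z)⁻¹ *
        ((2 * g.weight n φ e z) * ‖frmCoeff n e v z‖ ^ 2))
    ((((g.density_contDiffOn he).continuousOn.aemeasurable
      e.open_target.measurableSet).inv.aestronglyMeasurable).mul
      ((((g.weight_contDiffOn n hφ he).continuousOn.aestronglyMeasurable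
      e.open_target.measurableSet).const_mul 2).mul ((hv e he).norm.pow 2))) fun x hx => ?_
  have := g.density_mul_normSq n φ v he (e.map_source hx)
  rw [← this, inv_mul_cancel_left₀ (g.density_pos he (e.map_source hx)).ne', e.left_inv hx]

omit [ChartedSpace ℂ X] [IsManifold 𝓘(ℂ) ω X] in
theorem integrable_continuous_mul {μ : Measure X} {κ F : X → ℝ} (hκ : Continuous κ)
    (hF : Integrable F μ) : Integrable (fun x => κ x * F x) μ := by
  obtain ⟨M, hM⟩ := isCompact_univ.exists_bound_of_continuousOn hκ.continuousOn
  exact hF.bdd_mul hκ.aestronglyMeasurable (ae_of_all _ fun x => hM x (Set.mem_univ x))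

/-- The energy inequality for the weak derivative `v` of a section `u`. -/
theorem energy_inequality [T2Space X] (hφ : ContMDiff 𝓘(ℝ, ℂ) 𝓘(ℝ, ℝ) ∞ φ) {u v : X → ℂ}
    (hw : ∀ e ∈ atlas ℂ X, IsWeakPartialZBar e.target (secCoeff n e u) (frmCoeff n e v))
    (hu : Integrable (fun x => g.baseWeight n φ x * ‖u x‖ ^ 2) g.area)
    (hv : Integrable (fun x => 2 * g.baseWeight n φ x / g.baseDensity x * ‖v x‖ ^ 2) g.area) :
    ∫ x, n * (g.laplacian φ x - g.gaussCurvature x) * (g.baseWeight n φ x * ‖u x‖ ^ 2) ∂g.area ≤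
      ∫ x, 2 * g.baseWeight n φ x / g.baseDensity x * ‖v x‖ ^ 2 ∂g.area := by
  have hκ : Continuous fun x => n * (g.laplacian φ x - g.gaussCurvature x) :=
    continuous_const.mul (g.continuous_laplacian_sub_gaussCurvature hφ)
  obtain ⟨M, hM⟩ := isCompact_univ.exists_bound_of_continuousOn hκ.continuousOn
  have w₁ : ∀ x, 0 ≤ g.baseWeight n φ x := fun x => (g.baseWeight_pos n φ x).le
  have w₂ : ∀ x, 0 ≤ 2 * g.baseWeight n φ x / g.baseDensity x := fun x => by
    have h1 := g.baseWeight_pos n φ x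
    have h2 := g.baseDensity_pos x
    positivity
  refine integral_le_of_approx w₁ w₂ (fun x => hM x (Set.mem_univ x)) hu
    (integrable_continuous_mul hκ hu) hv fun ε hε => ?_
  obtain ⟨t, χ, hχ, hχs, hsum⟩ := exists_chart_partition (X := X)
  set N : ℝ := ((Fintype.card t : ℕ) : ℝ) with hN
  -- Cauchy-Schwarz on N summands loses one factor N, and adding N errors loses another; the 1
  -- covers N = 0.
  set η : ℝ := ε / (N * N + 1) with hη
  have hη0 : 0 < η := by positivity
  have hηε : N * (N * η) ≤ ε := by
    rw [hη, mul_div_assoc', mul_div_assoc', div_le_iff₀ (by positivity)]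
    nlinarith
  have he : ∀ i : t, chartAt ℂ (i : X) ∈ atlas ℂ X := fun i => chart_mem_atlas ℂ _
  choose F hF hF₁ hF₂ using fun i : t =>
    g.exists_local_approx n hφ (he i) (hχ i) (hχs i) (hw _ (he i)) hu hv hη0
  obtain ⟨j₁, j₂, hle⟩ := g.energy_inequality_of_smooth n hφ he (fun i => (hF i).1)
    (fun i => (hF i).2.1) (fun i => (hF i).2.2)
  have hsumu : ∀ x, ∑ i, (χ i x : ℂ) * u x = u x := fun x => by
    rw [← Finset.sum_mul, ← Complex.ofReal_sum, hsum x, Complex.ofReal_one, one_mul]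
  -- The cutoff errors (∂̄χ_i)u cancel in the sum, so the local derivatives add up to v exactly.
  have hsumv : ∀ x, ∑ i, ((χ i x : ℂ) * v x + dbarAt 0 (fun x => (χ i x : ℂ)) x * u x) = v x :=
    fun x => by
      rw [Finset.sum_add_distrib, ← Finset.sum_mul, ← Finset.sum_mul, ← Complex.ofReal_sum,
        hsum x, sum_dbarAt_zero hχ hsum, Complex.ofReal_one, one_mul, zero_mul, add_zero]
  have hsq : ∀ r : t → ℂ, ‖∑ i, r i‖ ^ 2 ≤ N * ∑ i, ‖r i‖ ^ 2 := fun r => by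
    calc ‖∑ i, r i‖ ^ 2 ≤ (∑ i, ‖r i‖) ^ 2 := by gcongr; exact norm_sum_le _ _
      _ ≤ _ := by
        have := sq_sum_le_card_mul_sum_sq (s := Finset.univ) (f := fun i => ‖r i‖)
        simpa [hN] using this
  have hle_sum : ∀ {w : X → ℝ}, (∀ x, 0 ≤ w x) → ∀ (a b : t → X → ℂ) (x : X),
      w x * ‖∑ i, a i x - ∑ i, b i x‖ ^ 2 ≤ N * ∑ i, w x * ‖a i x - b i x‖ ^ 2 := by
    intro w hw0 a b x
    rw [← Finset.sum_sub_distrib, ← Finset.mul_sum, mul_left_comm]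
    exact mul_le_mul_of_nonneg_left (hsq _) (hw0 x)
  have hint : ∀ {R : t → X → ℝ}, (∀ i, Integrable (R i) g.area ∧ ∫ x, R i x ∂g.area ≤ η) →
      Integrable (fun x => N * ∑ i, R i x) g.area ∧ ∫ x, N * ∑ i, R i x ∂g.area ≤ ε := by
    intro R hR
    refine ⟨(integrable_finsetSum _ fun i _ => (hR i).1).const_mul N, ?_⟩
    rw [integral_const_mul, integral_finsetSum _ fun i _ => (hR i).1]
    refine le_trans ?_ hηε
    gcongr
    calc ∑ i, ∫ x, R i x ∂g.area ≤ ∑ _i : t, η := Finset.sum_le_sum fun i _ => (hR i).2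
      _ = N * η := by simp [hN]
  -- The majorants are N times the sums of the local errors, whose integrability is known piece by
  -- piece.
  refine ⟨_, _, _, _, fun x => ?_, (hint hF₁).1, (hint hF₁).2, fun x => ?_, (hint hF₂).1,
    (hint hF₂).2, j₁, j₂, hle⟩
  · have := hle_sum w₁ (fun i => extendSec n (chartAt ℂ (i : X)) (F i))
      (fun i x => χ i x * u x) x
    rwa [hsumu] at this
  · have := hle_sum w₂ (fun i => extendFrm n (chartAt ℂ (i : X)) (wirtinger Complex.I (F i)))
      (fun i x => χ i x * v x + dbarAt 0 (fun x => (χ i x : ℂ)) x * u x) x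
    rwa [hsumv] at this

end ConformalMetric

end

section

variable {X : Type*} [TopologicalSpace X] [ChartedSpace ℂ X] [IsManifold 𝓘(ℂ) ω X]

/-! ### The norms of sections and forms -/

theorem IsWeakDbar.isWeakPartialZBar {k : ℕ} {ψ : ∀ x : X, EFibre k x}
    {β : ∀ x : X, EForm01Fibre k x} (h : IsWeakDbar ψ β) {e : OpenPartialHomeomorph X ℂ}
    (he : e ∈ atlas ℂ X) :
    IsWeakPartialZBar e.target (secCoeff (k - 1) e (baseSection ψ))
      (frmCoeff (k - 1) e (baseForm β)) :=
  (h e he).congr e.open_target (fun _ hz => sectionCoeff_eq he ψ hz)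
    fun _ hz => formCoeff_eq he β hz

namespace ConformalMetric

variable (g : ConformalMetric X) {k : ℕ}

theorem sectionNormSq_nonneg (ψ : ∀ x : X, EFibre k x) (x : X) : 0 ≤ g.sectionNormSq ψ x := by
  have := g.density_pos (chart_mem_atlas ℂ x) (mem_chart_target ℂ x)
  unfold sectionNormSq hermitianCoeff
  positivity

theorem formNormSq_nonneg (β : ∀ x : X, EForm01Fibre k x) (x : X) : 0 ≤ g.formNormSq β x := by
  have := g.density_pos (chart_mem_atlas ℂ x) (mem_chart_target ℂ x)
  unfold formNormSq hermitianCoeff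
  positivity

theorem baseWeight_mul_baseSection (φ : X → ℝ) (ψ : ∀ x : X, EFibre k x) (x : X) :
    g.baseWeight (k - 1) φ x * ‖baseSection ψ x‖ ^ 2 =
      Real.exp (2 * ((k - 1 : ℕ) : ℝ) * φ x) * g.sectionNormSq ψ x := by
  rw [sectionNormSq, sectionCoeff_eq (chart_mem_atlas ℂ x) ψ (mem_chart_target ℂ x),
    secCoeff_chartAt, hermitianCoeff, g.density_chartAt, baseWeight]
  ring

theorem formWeight_mul_baseForm (φ : X → ℝ) (β : ∀ x : X, EForm01Fibre k x) (x : X) :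
    2 * g.baseWeight (k - 1) φ x / g.baseDensity x * ‖baseForm β x‖ ^ 2 =
      Real.exp (2 * ((k - 1 : ℕ) : ℝ) * φ x) * g.formNormSq β x := by
  have := g.baseDensity_pos x
  rw [formNormSq, formCoeff_eq (chart_mem_atlas ℂ x) β (mem_chart_target ℂ x),
    frmCoeff_chartAt, hermitianCoeff, g.density_chartAt, baseWeight, inv_div]
  ring

theorem laplacian_zero : g.laplacian (fun _ => 0) = fun _ => 0 := by
  ext x
  rw [laplacian, InnerProductSpace.laplacian_const, Pi.zero_apply, zero_div]

theorem continuous_gaussCurvature : Continuous g.gaussCurvature := by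
  have h := (g.continuous_laplacian_sub_gaussCurvature (φ := fun _ => 0) contMDiff_const).neg
  simpa only [g.laplacian_zero, zero_sub, Pi.neg_def, neg_neg] using h

/-! ### Consequences of membership in W^{1,2}. -/

variable [CompactSpace X] [MeasurableSpace X] [BorelSpace X]

/-- Weak derivatives are unique almost everywhere in each chart, and finitely many charts cover X.
Hence the witness in `MemW12` may be exchanged for any other weak derivative. -/
theorem formNormSq_ae_eq {ψ : ∀ x : X, EFibre k x} {β β' : ∀ x : X, EForm01Fibre k x}
    (h : IsWeakDbar ψ β) (h' : IsWeakDbar ψ β') :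
    g.formNormSq β =ᵐ[g.area] g.formNormSq β' := by
  refine g.ae_area_of_charts fun e he => ?_
  refine g.ae_restrict_of_chart he ((h.isWeakPartialZBar he).ae_eq e.open_target
    (h'.isWeakPartialZBar he)) fun x hx hq => ?_
  have hb := frmCoeff_injective (k - 1) he hx hq
  have h1 := g.formWeight_mul_baseForm (fun _ => 0) β x
  have h2 := g.formWeight_mul_baseForm (fun _ => 0) β' x
  rw [hb, h2] at h1
  simpa using h1.symm

/-- Only the sum of the two square norms is assumed integrable. Each is nonnegative, hence dominated
by the sum, and its measurability comes from local integrability of the coefficients in charts. -/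
theorem MemW12.integrable {ψ : ∀ x : X, EFibre k x} (hψ : g.MemW12 ψ)
    {β : ∀ x : X, EForm01Fibre k x} (hβ : IsWeakDbar ψ β) :
    Integrable (g.sectionNormSq ψ) g.area ∧ Integrable (g.formNormSq β) g.area := by
  obtain ⟨β₀, hβ₀, hi⟩ := hψ
  have m1 : AEStronglyMeasurable (g.sectionNormSq ψ) g.area := by
    have := g.aestronglyMeasurable_baseWeight_mul (k - 1) (φ := fun _ => 0) contMDiff_const
      fun e he => (hβ₀.isWeakPartialZBar he).1.aestronglyMeasurable
    simpa [baseWeight_mul_baseSection] using this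
  have m2 : AEStronglyMeasurable (g.formNormSq β₀) g.area := by
    have := g.aestronglyMeasurable_formWeight_mul (k - 1) (φ := fun _ => 0) contMDiff_const
      fun e he => (hβ₀.isWeakPartialZBar he).2.1.aestronglyMeasurable
    simpa [formWeight_mul_baseForm] using this
  refine ⟨hi.mono' m1 (ae_of_all _ fun x => ?_),
    (hi.mono' m2 (ae_of_all _ fun x => ?_)).congr (g.formNormSq_ae_eq hβ₀ hβ)⟩
  · rw [Real.norm_of_nonneg (g.sectionNormSq_nonneg ψ x)]
    exact le_add_of_nonneg_right (g.formNormSq_nonneg β₀ x)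
  · rw [Real.norm_of_nonneg (g.formNormSq_nonneg β₀ x)]
    exact le_add_of_nonneg_left (g.sectionNormSq_nonneg ψ x)

/-- The weighted Bochner-Kodaira inequality on `W^{1,2}`. -/
theorem weighted_energy_inequality [T2Space X] {ψ : ∀ x : X, EFibre k x} (hψ : g.MemW12 ψ)
    {β : ∀ x : X, EForm01Fibre k x} (hβ : IsWeakDbar ψ β)
    {φ : X → ℝ} (hφ : ContMDiff 𝓘(ℝ, ℂ) 𝓘(ℝ, ℝ) ∞ φ) :
    ∫ x, ((k - 1 : ℕ) : ℝ) * (g.laplacian φ x - g.gaussCurvature x) *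
      (Real.exp (2 * ((k - 1 : ℕ) : ℝ) * φ x) * g.sectionNormSq ψ x) ∂g.area ≤
    ∫ x, Real.exp (2 * ((k - 1 : ℕ) : ℝ) * φ x) * g.formNormSq β x ∂g.area := by
  obtain ⟨i1, i2⟩ := hψ.integrable g hβ
  have hc : Continuous fun x => Real.exp (2 * ((k - 1 : ℕ) : ℝ) * φ x) :=
    Real.continuous_exp.comp (continuous_const.mul hφ.continuous)
  have key := g.energy_inequality (k - 1) hφ (fun e he => hβ.isWeakPartialZBar he)
    (by simpa only [baseWeight_mul_baseSection] using integrable_continuous_mul hc i1)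
    (by simpa only [formWeight_mul_baseForm] using integrable_continuous_mul hc i2)
  simpa only [baseWeight_mul_baseSection, formWeight_mul_baseForm] using key

end ConformalMetric

end

end RiemannSurface

end

/-! ### The three inequalities as cases of the weighted one. -/

open RiemannSurface in
theorem proposition2p1 {X : Type*} [TopologicalSpace X] [T2Space X] [CompactSpace X]
    [ChartedSpace ℂ X] [IsManifold 𝓘(ℂ) ω X] [MeasurableSpace X] [BorelSpace X]
    (k : ℕ) (hk : 2 ≤ k) :
    -- an arbitrary metric `g`
    (∀ (g : ConformalMetric X) (ψ : ∀ x : X, EFibre k x) (β : ∀ x : X, EForm01Fibre k x),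
      g.MemW12 ψ → IsWeakDbar ψ β →
        MeasureTheory.Integrable (fun x => g.formNormSq β x) g.area ∧
        MeasureTheory.Integrable (fun x => g.gaussCurvature x * g.sectionNormSq ψ x) g.area ∧
        ∫ x, g.formNormSq β x ∂g.area ≥
          -((k : ℝ) - 1) * ∫ x, g.gaussCurvature x * g.sectionNormSq ψ x ∂g.area) ∧
    -- the hyperbolic metric
    (∀ g : ConformalMetric X, g.IsHyperbolic →
      ∀ (ψ : ∀ x : X, EFibre k x) (β : ∀ x : X, EForm01Fibre k x),
      g.MemW12 ψ → IsWeakDbar ψ β →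
        MeasureTheory.Integrable (fun x => g.formNormSq β x) g.area ∧
        MeasureTheory.Integrable (fun x => g.sectionNormSq ψ x) g.area ∧
        ∫ x, g.formNormSq β x ∂g.area ≥
          ((k : ℝ) - 1) * ∫ x, g.sectionNormSq ψ x ∂g.area) ∧
    -- the weighted inequality for the hyperbolic metric
    (∀ g : ConformalMetric X, g.IsHyperbolic →
      ∀ φ : X → ℝ, ContMDiff 𝓘(ℝ, ℂ) 𝓘(ℝ, ℝ) ∞ φ →
      ∀ (ψ : ∀ x : X, EFibre k x) (β : ∀ x : X, EForm01Fibre k x),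
      g.MemW12 ψ → IsWeakDbar ψ β →
        MeasureTheory.Integrable
          (fun x => g.formNormSq β x * Real.exp (2 * ((k : ℝ) - 1) * φ x)) g.area ∧
        MeasureTheory.Integrable
          (fun x => (g.laplacian φ x + 1) * g.sectionNormSq ψ x *
            Real.exp (2 * ((k : ℝ) - 1) * φ x)) g.area ∧
        ∫ x, g.formNormSq β x * Real.exp (2 * ((k : ℝ) - 1) * φ x) ∂g.area ≥
          ((k : ℝ) - 1) * ∫ x, (g.laplacian φ x + 1) * g.sectionNormSq ψ x *
            Real.exp (2 * ((k : ℝ) - 1) * φ x) ∂g.area) := by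
  -- The exponent k - 1 of the bundle is a truncated subtraction; k ≥ 2 makes it the real number k -
  -- 1.
  have hk1 : ((k - 1 : ℕ) : ℝ) = (k : ℝ) - 1 := by
    rw [Nat.cast_sub (by omega), Nat.cast_one]
  have main : ∀ (g : ConformalMetric X) (ψ : ∀ x : X, EFibre k x) (β : ∀ x : X, EForm01Fibre k x),
      g.MemW12 ψ → IsWeakDbar ψ β →
        MeasureTheory.Integrable (fun x => g.formNormSq β x) g.area ∧
        MeasureTheory.Integrable (fun x => g.gaussCurvature x * g.sectionNormSq ψ x) g.area ∧
        ∫ x, g.formNormSq β x ∂g.area ≥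
          -((k : ℝ) - 1) * ∫ x, g.gaussCurvature x * g.sectionNormSq ψ x ∂g.area := by
    intro g ψ β hψ hβ
    obtain ⟨i1, i2⟩ := hψ.integrable g hβ
    refine ⟨i2, ConformalMetric.integrable_continuous_mul g.continuous_gaussCurvature i1, ?_⟩
    -- With the trivial weight function the curvature factor Δφ - K reduces to -K.
    have key := g.weighted_energy_inequality hψ hβ (φ := fun _ => 0) contMDiff_const
    simp only [g.laplacian_zero, mul_zero, Real.exp_zero, one_mul, zero_sub, hk1] at key
    rw [ge_iff_le, ← MeasureTheory.integral_const_mul]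
    refine le_of_eq_of_le (MeasureTheory.integral_congr_ae (.of_forall fun x => ?_)) key
    ring
  refine ⟨main, fun g hg ψ β hψ hβ => ?_, fun g hg φ hφ ψ β hψ hβ => ?_⟩
  · obtain ⟨i1, i2⟩ := hψ.integrable g hβ
    have key := (main g ψ β hψ hβ).2.2
    simp only [hg _, neg_mul, one_mul, MeasureTheory.integral_neg, mul_neg, neg_neg] at key
    exact ⟨i2, i1, key⟩
  · obtain ⟨i1, i2⟩ := hψ.integrable g hβ
    have hc : Continuous fun x => Real.exp (2 * ((k : ℝ) - 1) * φ x) :=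
      Real.continuous_exp.comp (continuous_const.mul hφ.continuous)
    have hΔ := g.continuous_laplacian_sub_gaussCurvature hφ
    -- Since K = -1, continuity of Δφ - K is continuity of Δφ + 1, which gives integrability of the
    -- right-hand side on compact X.
    simp only [hg _, sub_neg_eq_add] at hΔ
    refine ⟨?_, ?_, ?_⟩
    · simpa only [mul_comm] using ConformalMetric.integrable_continuous_mul hc i2
    · refine (ConformalMetric.integrable_continuous_mul (hΔ.mul hc) i1).congr
        (.of_forall fun x => ?_)
      simp only [Pi.mul_apply]
      ring
    · have key := g.weighted_energy_inequality hψ hβ hφ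
      simp only [hg _, sub_neg_eq_add, hk1] at key
      rw [ge_iff_le, ← MeasureTheory.integral_const_mul]
      refine (le_of_eq_of_le (MeasureTheory.integral_congr_ae (.of_forall fun x => ?_))
        key).trans_eq (MeasureTheory.integral_congr_ae (.of_forall fun x => ?_))
      · ring
      · exact mul_comm _ _
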